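/- **Model (random phone call model with direct addressing).** There are $n$ nodes with distinct IDs (natural numbers); every node knows $n$ and its own ID. Communication takes place in synchronous rounds. In each round each node may initiate one communication: it PUSHes a message to, or PULLs a message from, either a uniformly random node (independently for all nodes and rounds) or the node with an ID it has learned. A node gives the same answer to all nodes that PULL from it in a round. Local computation and private coin flips are free, and messages may have any size. Every node $v$ has a variable $follow_v$, the ID of the leader of its cluster ($\infty$ if $v$ is unclustered); a leader has $follow_v=\mathrm{ID}(v)$, other clustered nodes are followers, and the ID of a cluster is the ID of its leader. **Primitives.** - ClusterDissolve($s$): followers PUSH their IDs to their leader; then followers PULL from the leader (and the leader sets likewise) the new $follow$ value: the leader's ID if the cluster has at least $s$ nodes, $\infty$ otherwise. - ClusterResize($s$): followers PUSH their IDs to the leader, who cuts its cluster of size $s'$, in ID order, into $\max(1,\lfloor s'/s\rfloor)$ parts of equal size up to one; followers PULL the list of the largest IDs of the parts, and every node of the cluster follows the smallest listed ID that is at least its own. - ClusterActivate($p$): every leader flips a $p$-biased coin deciding whether its cluster is active; followers PULL the outcome. - ClusterPUSH($msg$): followers PULL from their leader the decision whether to push and the message; all instructed nodes PUSH it to a random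 node; followers relay all messages received to their leader. - ClusterMerge($\ell$): followers PULL the new leader ID $\ell$ from their leader, and all nodes of the cluster set $follow=\ell$. - ClusterShare: followers PUSH the information they have to the leader, then PULL the union from it. **Algorithm ClusterOne** with constants $C,C',\gamma,a,b>0$. 1. *GrowInitialClusters.* Every node independently sets $follow$ to its own ID with probability $1/(C\log n)$, otherwise to $\infty$. Repeat $\lceil a\log\log n\rceil$ times: ClusterPUSH($follow$); every unclustered node that received IDs sets $follow$ to one of them (chosen by an arbitrary fixed selection rule). 2. *SquareClusters.* $s\leftarrow\lceil C'\log n\rceil$; ClusterDissolve($s$). Repeat: ClusterResize($s$); ClusterActivate($1/s$); twice: active clusters ClusterPUSH($follow$), and inactive clusters ClusterMerge(smallest ID received, if any); $s\leftarrow\lceil\gamma s^2\rceil$; until $s>\sqrt n/\log n$. 3. *MergeAllClusters.* Twice: ClusterPUSH($follow$); ClusterMerge(smallest among the cluster's own $follow$ value and the IDs received). 4. *UnclusteredNodesPull.* Repeat $\lceil b\log\log n\rceil$ times: every unclustered node PULLs the $follow$ value of a random node and adopts it. 5. ClusterShare(message). **Theorem.** For every $c>0$ there are constants $C,C',\gamma,a,b,K>0$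 and $n_0$ such that for all $n\ge n_0$ and every selection rule the following holds. ClusterOne with the constants $C,C',\gamma,a,b$ terminates after at most $K\log\log n$ rounds; and for every assignment of distinct IDs to the nodes, every nonempty set of nodes that initially know a message, and every message, with probability at least $1-n^{-c}$ all nodes know the message when the algorithm terminates. -/

import Mathlib

noncomputable section

namespace Gossip

/-! ## The random phone call model with direct addressing -/

/-- The partner of a communication: a uniformly random node, or the node with a given ID. -/
inductive Target where
  | random : Target
  | addr (i : ℕ) : Target

/-- What a node may initiate in one round: nothing, one PUSH or one PULL. -/
inductive Action (Msg : Type) where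
  | idle : Action Msg
  | push (t : Target) (m : Msg) : Action Msg
  | pull (t : Target) : Action Msg

/-- One synchronous communication round, as a program that every node runs on its own local
state: the communication which the node initiates, the answer that it gives to every node which
PULLs from it (one and the same answer for all of them), and its new local state, given the
messages PUSHed to it and the answer to its own PULL (if any). -/
structure Round (σ : Type) where
  Msg : Type
  act : σ → Action Msg
  respond : σ → Option Msg
  update : σ → Multiset Msg → Option Msg → σ

/-- A step of an algorithm: a communication round; a local computation; or a local random choice,
in which every node flips its own coin with success probability `p` (clamped to `[0, 1]`). -/
inductive Step (σ : Type) : Type 1 where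
  | comm (r : Round σ) : Step σ
  | compute (f : σ → σ) : Step σ
  | coin (p : ℝ) (f : Bool → σ → σ) : Step σ

/-- The number of communication rounds in a list of steps. -/
def rounds {σ : Type} : List (Step σ) → ℕ
  | [] => 0
  | .comm _ :: L => rounds L + 1
  | .compute _ :: L => rounds L
  | .coin _ _ :: L => rounds L

section Execution

variable {σ : Type} {n : ℕ}

/-- The node that `u` reaches, if `ρ u` is its random contact in this round. -/
def dest (ID : Fin n → ℕ) (ρ : Fin n → Fin n) (u : Fin n) : Target → Option (Fin n)
  | .random => some (ρ u)
  | .addr i => if h : ∃ v, ID v = i then some h.choose else none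

/-- The messages PUSHed to `v`. -/
def Round.inbox (r : Round σ) (ID : Fin n → ℕ) (ρ : Fin n → Fin n) (x : Fin n → σ) (v : Fin n) :
    Multiset r.Msg :=
  (Finset.univ : Finset (Fin n)).val.filterMap fun u =>
    match r.act (x u) with
    | .push t m => if dest ID ρ u t = some v then some m else none
    | _ => none

/-- The answer to the PULL of `v`, if `v` PULLs and is answered. -/
def Round.answer (r : Round σ) (ID : Fin n → ℕ) (ρ : Fin n → Fin n) (x : Fin n → σ) (v : Fin n) :
    Option r.Msg :=
  match r.act (x v) with
  | .pull t => (dest ID ρ v t).bind fun u => r.respond (x u)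
  | _ => none

/-- The effect of a round on the configuration `x`, for given random contacts `ρ`. -/
def Round.exec (r : Round σ) (ID : Fin n → ℕ) (ρ : Fin n → Fin n) (x : Fin n → σ) : Fin n → σ :=
  fun v => r.update (x v) (r.inbox ID ρ x v) (r.answer ID ρ x v)

/-- Independent uniformly random contacts of all nodes. -/
def contacts (n : ℕ) : PMF (Fin n → Fin n) :=
  haveI : Nonempty (Fin n → Fin n) := ⟨id⟩
  PMF.uniformOfFintype (Fin n → Fin n)

/-- `p` clamped to `[0, 1]`. -/
def clamp (p : ℝ) : ENNReal := min 1 (ENNReal.ofReal p)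

/-- Independent coins of all nodes, each showing `true` with probability `clamp p`. -/
def coins (n : ℕ) (p : ℝ) : PMF (Fin n → Bool) :=
  PMF.ofFintype (fun b => ∏ v, if b v then clamp p else 1 - clamp p) (by
    have h := Finset.prod_univ_sum (fun _ : Fin n => (Finset.univ : Finset Bool))
      (fun _ c => if c = true then clamp p else 1 - clamp p)
    rw [Fintype.piFinset_univ] at h
    rw [← h]
    simp [clamp])

/-- The distribution of the configuration after one step. -/
def Step.exec (ID : Fin n → ℕ) : Step σ → (Fin n → σ) → PMF (Fin n → σ)
  | .comm r, x => (contacts n).map fun ρ => r.exec ID ρ x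
  | .compute f, x => PMF.pure fun v => f (x v)
  | .coin p f, x => (coins n p).map fun b v => f (b v) (x v)

/-- The distribution of the configuration after a list of steps. -/
def run (ID : Fin n → ℕ) : List (Step σ) → (Fin n → σ) → PMF (Fin n → σ)
  | [], x => PMF.pure x
  | a :: L, x => (a.exec ID x).bind (run ID L)

end Execution

/-! ## Clusterings and their primitives -/

/-- The local state of a node. -/
structure NodeState where
  /-- the own ID -/
  id : ℕ
  /-- the ID of the leader of the node's cluster; `none` (for `∞`) if the node is unclustered -/
  follow : Option ℕ
  /-- whether the node's cluster is activated -/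
  active : Bool
  /-- the message which the node was told to PUSH in the current ClusterPUSH, if any -/
  order : Option ℕ
  /-- the IDs received in the current ClusterPUSH -/
  heard : Finset ℕ
  /-- the IDs of the members of the cluster, as collected by its leader -/
  members : Finset ℕ
  /-- the messages to be broadcast that the node knows -/
  info : Finset (List Bool)

def NodeState.IsLeader (st : NodeState) : Prop := st.follow = some st.id

instance (st : NodeState) : Decidable st.IsLeader := by
  unfold NodeState.IsLeader; infer_instance

/-- The smallest element, if any. -/
def smallest (S : Finset ℕ) : Option ℕ := if h : S.Nonempty then some (S.min' h) else none

/-- Followers PUSH `content` (if any) to their leader; all nodes store what they receive. -/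
def pushToLeader {R : Type} (content : NodeState → Option R)
    (store : Multiset R → NodeState → NodeState) : Round NodeState where
  Msg := R
  act st := match st.follow, content st with
    | some l, some m => if l = st.id then .idle else .push (.addr l) m
    | _, _ => .idle
  respond _ := none
  update st inbox _ := store inbox st

/-- Followers PULL `directive` from their leader and store it; leaders apply their directive to
themselves. -/
def pullFromLeader {R : Type} (directive : NodeState → R)
    (store : R → NodeState → NodeState) : Round NodeState where
  Msg := R
  act st := match st.follow with
    | some l => if l = st.id then .idle else .pull (.addr l)
    | none => .idle
  respond st := some (directive st)
  update st _ ans := match ans with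
    | some r => store r st
    | none => if st.IsLeader then store (directive st) st else st

/-- The leaders learn the IDs of all members of their clusters. -/
def collectMembers : Round NodeState :=
  pushToLeader (fun st => some st.id) fun inbox st =>
    { st with members := insert st.id inbox.toFinset }

/-- ClusterActivate(`p`). -/
def clusterActivate (p : ℝ) : List (Step NodeState) :=
  [.coin p fun b st => if st.IsLeader then { st with active := b } else st,
   .comm (pullFromLeader (fun st => st.active) fun b st => { st with active := b })]

/-- ClusterDissolve(`s`). -/
def clusterDissolve (s : ℕ) : List (Step NodeState) :=
  [.comm collectMembers,
   .comm (pullFromLeader (fun st => if s ≤ st.members.card then some st.id else none)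
     fun f st => { st with follow := f })]

/-- The block (numbered from `0`) of `x`, if the elements of `S` are cut, in increasing order, into
`k` blocks of equal size up to one. -/
def block (S : Finset ℕ) (k x : ℕ) : ℕ := (S.filter (· < x)).card * k / S.card

/-- The largest IDs of the blocks when the cluster `S` is split into `⌊|S| / s⌋` clusters (a
cluster with fewer than `s` nodes is kept as it is). -/
def newLeaders (s : ℕ) (S : Finset ℕ) : Finset ℕ :=
  S.filter fun x => ∀ y ∈ S,
    block S (max 1 (S.card / s)) y = block S (max 1 (S.card / s)) x → y ≤ x

/-- ClusterResize(`s`). A node follows the smallest new leader ID that is at least as large as its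
own ID. -/
def clusterResize (s : ℕ) : List (Step NodeState) :=
  [.comm collectMembers,
   .comm (pullFromLeader (fun st => newLeaders s st.members)
     fun T st => { st with follow := smallest (T.filter (st.id ≤ ·)) })]

/-- ClusterPUSH: a leader decides on the message to be pushed (`none`: no push); its followers
pull this decision; all nodes instructed to do so PUSH the message to a random node; followers
relay what they received to their leader. -/
def clusterPush (msg : NodeState → Option ℕ) : List (Step NodeState) :=
  [.compute fun st => { st with order := none, heard := ∅ },
   .comm (pullFromLeader msg fun m st => { st with order := m }),
   .comm
    { Msg := ℕ
      act := fun st => match st.order with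
        | some m => .push .random m
        | none => .idle
      respond := fun _ => none
      update := fun st inbox _ => { st with heard := inbox.toFinset } },
   .comm (pushToLeader (fun st => if st.heard.Nonempty then some st.heard else none)
     fun inbox st => { st with heard := st.heard ∪ inbox.sup })]

/-- ClusterMerge: the nodes of a cluster move to the new leader chosen by their leader. -/
def clusterMerge (newLeader : NodeState → Option ℕ) : List (Step NodeState) :=
  [.comm (pullFromLeader newLeader fun f st => { st with follow := f })]

/-- ClusterShare. -/
def clusterShare : List (Step NodeState) :=
  [.comm (pushToLeader (fun st => if st.info.Nonempty then some st.info else none)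
     fun inbox st => { st with info := st.info ∪ inbox.sup }),
   .comm (pullFromLeader (fun st => st.info) fun I st => { st with info := st.info ∪ I })]

/-! ## The algorithm ClusterOne -/

/-- `L` executed `k` times. -/
def repeatSteps (k : ℕ) (L : List (Step NodeState)) : List (Step NodeState) :=
  (List.replicate k L).flatten

/-- The number `⌈a log log n⌉` of iterations of a loop that runs `Θ(log log n)` times. -/
def loopCount (a : ℝ) (n : ℕ) : ℕ := ⌈a * Real.log (Real.log n)⌉₊

/-- GrowInitialClusters, where `select` picks one of the received IDs. -/
def growInitialClusters (C a : ℝ) (select : Finset ℕ → ℕ) (n : ℕ) : List (Step NodeState) :=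
  .coin (1 / (C * Real.log n)) (fun b st => { st with follow := if b then some st.id else none }) ::
  repeatSteps (loopCount a n)
    (clusterPush (fun st => st.follow) ++
     [.compute fun st =>
        if st.follow = none ∧ st.heard.Nonempty then { st with follow := some (select st.heard) }
        else st])

/-- The body of the loop of SquareClusters: active clusters recruit inactive clusters. -/
def squareBody (s : ℕ) : List (Step NodeState) :=
  clusterResize s ++ clusterActivate (1 / s) ++
  repeatSteps 2
    (clusterPush (fun st => if st.active then st.follow else none) ++
     clusterMerge (fun st => if st.active then st.follow else (smallest st.heard).or st.follow))

/-- The update `s ← Θ(s²)`. -/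
def nextSize (γ : ℝ) (s : ℕ) : ℕ := ⌈γ * (s : ℝ) ^ 2⌉₊

/-- `SquareLoop γ θ s L`: the loop "repeat body(`s`); `s ← ⌈γ s²⌉` until `s > θ`", started with
the value `s`, terminates and executes exactly the steps `L`. -/
inductive SquareLoop (γ θ : ℝ) : ℕ → List (Step NodeState) → Prop
  | exit (s : ℕ) : θ < nextSize γ s → SquareLoop γ θ s (squareBody s)
  | again (s : ℕ) (L : List (Step NodeState)) : (nextSize γ s : ℝ) ≤ θ →
      SquareLoop γ θ (nextSize γ s) L → SquareLoop γ θ s (squareBody s ++ L)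

/-- MergeAllClusters: every cluster joins the smallest among its own ID and the received IDs. -/
def mergeAllClusters : List (Step NodeState) :=
  repeatSteps 2
    (clusterPush (fun st => st.follow) ++
     clusterMerge (fun st => smallest (st.heard ∪ st.follow.toFinset)))

/-- UnclusteredNodesPull. -/
def unclusteredNodesPull (b : ℝ) (n : ℕ) : List (Step NodeState) :=
  repeatSteps (loopCount b n)
    [.comm
      { Msg := Option ℕ
        act := fun st => if st.follow = none then .pull .random else .idle
        respond := fun st => some st.follow
        update := fun st _ ans =>
          if st.follow = none then { st with follow := ans.join } else st }]

/-- `ClusterOne C C' γ a b select n L`: on `n` nodes, the algorithm ClusterOne with the constants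
`C, C', γ, a, b` terminates and executes exactly the steps `L`. -/
def ClusterOne (C C' γ a b : ℝ) (select : Finset ℕ → ℕ) (n : ℕ) (L : List (Step NodeState)) :
    Prop :=
  ∃ Lsq, SquareLoop γ (√(n : ℝ) / Real.log n) ⌈C' * Real.log n⌉₊ Lsq ∧
    L = growInitialClusters C a select n ++
        (clusterDissolve ⌈C' * Real.log n⌉₊ ++ Lsq) ++
        mergeAllClusters ++ unclusteredNodesPull b n ++ clusterShare

/-- The initial configuration: nodes know their own ID, and exactly the nodes in `A` know the
message `m`. -/
def initial {n : ℕ} (ID : Fin n → ℕ) (A : Finset (Fin n)) (m : List Bool) : Fin n → NodeState :=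
  fun v =>
    { id := ID v, follow := none, active := false, order := none, heard := ∅, members := ∅,
      info := if v ∈ A then {m} else ∅ }

end Gossip

end

noncomputable section

namespace Gossip

open Finset

/-! The clustering is driven to one cluster that contains all nodes; then two deterministic rounds
of ClusterShare suffice.

Growth. About `n / (C log n)` leaders start. Each push enlarges the clustered set by a constant
factor until only `n / 200` nodes are missing (`triple_grow`); only a factor of order `log n` has to
be gained, so `O(log log n)` iterations do. As there are few clusters, dissolving those with fewer
than `C' log n` nodes costs at most another `n / 200` nodes (`triple_dissolve`).

Squaring. If all clusters have between `s` and `2 s` nodes and one in `s` is active, the active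
clusters contain only `O(n / s)` nodes. So, for any given active cluster, a constant fraction of the
inactive clusters is hit by no other active one. Among these the given cluster wins every cluster
that it hits, whatever the IDs are, and it grows to `γ s²` nodes (`triple_recruit_first`). The
active clusters then hold a constant fraction of all nodes, and a second push reaches every cluster
(`triple_recruit_second`). Thus `γ s` is at least squared per iteration, and `O(log log n)`
iterations lead to size `√n / log n`.

Merging. The cluster with the smallest ID first gains a total of `s² / 16` nodes
(`triple_merge_first`); these reach every cluster, because `s³ / n` is much larger than `log n`
(`triple_merge_second`). Finally the unclustered fraction is roughly squared per pull until it is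
about `n ^ (-1/4)`, after which constantly many pulls and a union bound finish
(`triple_unclusteredNodesPull`).

Every tail bound is an exponential moment estimate: contacts are exposed one node at a time
(`avg_le_pow`), coins are treated by their generating function (`coins_mgf`). `Rep` replaces a
configuration by the map sending each node to its leader, each iteration depends on a single vector
of contacts or coins, and `Triple`s are chained by adding failure probabilities. Each is a multiple
of `n ^ (-(c + 2))`, and there are at most `n` such units. -/

/-! ## Averages over the random contacts -/

section Average

variable {n : ℕ}

/-- The expectation of `g` under uniformly random contacts. -/
def avg (g : (Fin n → Fin n) → ℝ) : ℝ := (∑ ρ, g ρ) / (n : ℝ) ^ n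

theorem avg_mono {g h : (Fin n → Fin n) → ℝ} (H : ∀ ρ, g ρ ≤ h ρ) : avg g ≤ avg h := by
  unfold avg
  gcongr
  exact H _

theorem avg_const (hn : 0 < n) (c : ℝ) : avg (fun _ : Fin n → Fin n => c) = c := by
  have : (0 : ℝ) < (n : ℝ) ^ n := by positivity
  unfold avg
  rw [Finset.sum_const, Finset.card_univ, Fintype.card_fun, Fintype.card_fin, nsmul_eq_mul]
  push_cast
  field_simp

theorem avg_mul (c : ℝ) (g : (Fin n → Fin n) → ℝ) : avg (fun ρ => c * g ρ) = c * avg g := by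
  unfold avg
  rw [← Finset.mul_sum, mul_div_assoc]

/-- Exchanging the contact of `o` with an independent value `y` is an involution of the pairs `(ρ,
y)`. Hence resampling one contact does not change an average. -/
theorem sum_update (g : (Fin n → Fin n) → ℝ) (o : Fin n) :
    ∑ ρ, ∑ y, g (Function.update ρ o y) = n * ∑ ρ, g ρ := by
  have key : ∑ q : (Fin n → Fin n) × Fin n, g (Function.update q.1 o q.2) =
      ∑ q : (Fin n → Fin n) × Fin n, g q.1 := by
    refine Finset.sum_bij' (fun q _ => (Function.update q.1 o q.2, q.1 o))
      (fun q _ => (Function.update q.1 o q.2, q.1 o)) ?_ ?_ ?_ ?_ ?_ <;> simp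
  rw [Fintype.sum_prod_type, Fintype.sum_prod_type] at key
  rw [key, Finset.mul_sum]
  simp

theorem avg_update (hn : 0 < n) (g : (Fin n → Fin n) → ℝ) (o : Fin n) :
    avg (fun ρ => (∑ y, g (Function.update ρ o y)) / n) = avg g := by
  have : (0 : ℝ) < n := by exact_mod_cast hn
  unfold avg
  rw [← Finset.sum_div, sum_update]
  field_simp

/-- Exposing the contacts of the nodes of `T` one at a time. -/
theorem avg_le_pow (hn : 0 < n) (T : Finset (Fin n)) {β : ℝ} (hβ : 0 ≤ β)
    (g : Finset (Fin n) → (Fin n → Fin n) → ℝ)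
    (h : ∀ U o, o ∉ U → o ∈ T → U ⊆ T → ∀ ρ,
      ∑ y, g (insert o U) (Function.update ρ o y) ≤ n * (β * g U ρ)) :
    avg (g T) ≤ β ^ T.card * avg (g ∅) := by
  have hn' : (0 : ℝ) < n := by exact_mod_cast hn
  suffices H : ∀ U, U ⊆ T → avg (g U) ≤ β ^ U.card * avg (g ∅) from H T subset_rfl
  intro U
  induction U using Finset.induction_on with
  | empty => intro _; simp
  | insert o U ho ih =>
    intro hU
    rw [Finset.insert_subset_iff] at hU
    -- Resampling the contact of `o` allows the hypothesis to be applied with all other contacts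
    -- fixed.
    calc avg (g (insert o U))
        = avg (fun ρ => (∑ y, g (insert o U) (Function.update ρ o y)) / n) :=
          (avg_update hn _ o).symm
      _ ≤ avg (fun ρ => β * g U ρ) := by
          apply avg_mono
          intro ρ
          rw [div_le_iff₀' hn']
          exact h U o ho hU.1 hU.2 ρ
      _ = β * avg (g U) := avg_mul _ _
      _ ≤ β * (β ^ U.card * avg (g ∅)) := by gcongr; exact ih hU.2
      _ = β ^ (insert o U).card * avg (g ∅) := by
          rw [Finset.card_insert_of_notMem ho]; ring

/-- Markov's inequality in the form used throughout: a nonnegative function that is at least `1` on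
the event dominates its indicator. -/
theorem contacts_le_avg (g : (Fin n → Fin n) → ℝ) (S : Set (Fin n → Fin n))
    (h0 : ∀ ρ, 0 ≤ g ρ) (h1 : ∀ ρ ∈ S, 1 ≤ g ρ) :
    (contacts n).toOuterMeasure S ≤ ENNReal.ofReal (avg g) := by
  classical
  unfold contacts
  have : Nonempty (Fin n → Fin n) := ⟨id⟩
  rw [PMF.toOuterMeasure_uniformOfFintype_apply]
  rw [Fintype.card_fun, Fintype.card_fin, Fintype.card_subtype]
  have hc : (((Finset.univ.filter (· ∈ S)).card : ℕ) : ℝ) ≤ ∑ ρ, g ρ := by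
    rw [Finset.card_eq_sum_ones, Nat.cast_sum, Finset.sum_filter]
    apply Finset.sum_le_sum
    intro ρ _
    split_ifs with hρ
    · simpa using h1 ρ hρ
    · exact h0 ρ
  have hpos : (0 : ℝ) < (n : ℝ) ^ n := by
    rcases Nat.eq_zero_or_pos n with rfl | hn
    · simp
    · positivity
  unfold avg
  rw [ENNReal.ofReal_div_of_pos hpos]
  refine ENNReal.div_le_div ?_ ?_
  · rw [← ENNReal.ofReal_natCast]
    exact ENNReal.ofReal_le_ofReal (by convert hc)
  · rw [ENNReal.ofReal_pow (by positivity)]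
    simp

theorem half_le_one_sub_exp_neg_one : (1 : ℝ) / 2 ≤ 1 - Real.exp (-1) := by
  have h1 := Real.exp_one_gt_d9
  rw [Real.exp_neg]
  have : (Real.exp 1)⁻¹ ≤ 2⁻¹ := inv_anti₀ (by norm_num) (by linarith)
  linarith

/-- A counter `H` which, while it is at most `w` (and `ρ` is `Good`), increases with probability
at least `1 - q` when the contact of another node of `T` is exposed. -/
theorem contacts_counter_le (hn : 0 < n) (T : Finset (Fin n)) (w : ℕ) {q : ℝ} (hq0 : 0 ≤ q)
    (hq1 : q ≤ 1) (Good : (Fin n → Fin n) → Prop) (H : Finset (Fin n) → (Fin n → Fin n) → ℕ)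
    (hgood : ∀ o ∈ T, ∀ ρ y, Good (Function.update ρ o y) → Good ρ)
    (hmono : ∀ U o, o ∉ U → o ∈ T → U ⊆ T → ∀ ρ y,
      H U ρ ≤ H (insert o U) (Function.update ρ o y))
    (hcount : ∀ U o, o ∉ U → o ∈ T → U ⊆ T → ∀ ρ, Good ρ → H U ρ ≤ w →
      ((Finset.univ.filter fun y => H (insert o U) (Function.update ρ o y) ≤ H U ρ).card : ℝ)
        ≤ q * n) :
    (contacts n).toOuterMeasure {ρ | Good ρ ∧ H T ρ ≤ w} ≤
      ENNReal.ofReal (Real.exp (w - (1 - q) * T.card / 2)) := by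
  classical
  have hn' : (0 : ℝ) < n := by exact_mod_cast hn
  -- The potential `exp (-H)` is cut off outside the event, since the growth of `H` is only
  -- guaranteed inside it. One exposure multiplies its mean by at most `q + (1 - q) / e ≤ 1 - (1 -
  -- q) / 2`.
  set g : Finset (Fin n) → (Fin n → Fin n) → ℝ := fun U ρ =>
    if Good ρ ∧ H U ρ ≤ w then Real.exp (-(H U ρ : ℝ)) else 0 with hg
  have hg0 : ∀ U ρ, 0 ≤ g U ρ := by
    intro U ρ; simp only [hg]; split_ifs <;> positivity
  have e1 := half_le_one_sub_exp_neg_one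
  have hβ0 : 0 ≤ 1 - (1 - q) / 2 := by linarith
  have hstep := avg_le_pow hn T hβ0 g (by
    intro U o ho hoT hUT ρ
    by_cases hcase : Good ρ ∧ H U ρ ≤ w
    · have hb : ∀ y, g (insert o U) (Function.update ρ o y) ≤
          Real.exp (-(H U ρ : ℝ)) * (Real.exp (-1) + (1 - Real.exp (-1)) *
            (if H (insert o U) (Function.update ρ o y) ≤ H U ρ then 1 else 0)) := by
        intro y
        have hm := hmono U o ho hoT hUT ρ y
        split_ifs with hy
        · have : H (insert o U) (Function.update ρ o y) = H U ρ := le_antisymm hy hm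
          simp only [hg, this]
          split_ifs
          · simp
          · simp; positivity
        · have h2 : (H U ρ : ℝ) + 1 ≤ H (insert o U) (Function.update ρ o y) := by
            exact_mod_cast Nat.lt_of_not_le hy
          simp only [hg]
          split_ifs
          · rw [mul_zero, add_zero, ← Real.exp_add]
            apply Real.exp_le_exp.2; linarith
          · positivity
      refine (Finset.sum_le_sum fun y _ => hb y).trans ?_
      rw [← Finset.mul_sum, Finset.sum_add_distrib, ← Finset.mul_sum, Finset.sum_boole]
      have hc := hcount U o ho hoT hUT ρ hcase.1 hcase.2
      simp only [hg, if_pos hcase, Finset.sum_const, Finset.card_univ, Fintype.card_fin,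
        nsmul_eq_mul]
      have hE : 0 < Real.exp (-(H U ρ : ℝ)) := Real.exp_pos _
      have : (n : ℝ) * Real.exp (-1) + (1 - Real.exp (-1)) *
          ((Finset.univ.filter fun y => H (insert o U) (Function.update ρ o y) ≤ H U ρ).card : ℝ)
          ≤ n * (1 - (1 - q) / 2) := by
        have h3 := mul_le_mul_of_nonneg_left hc (by linarith : 0 ≤ 1 - Real.exp (-1))
        have h4 : 0 ≤ (1 - q) * n := mul_nonneg (by linarith) hn'.le
        nlinarith
      calc _ ≤ Real.exp (-(H U ρ : ℝ)) * (n * (1 - (1 - q) / 2)) :=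
            mul_le_mul_of_nonneg_left this hE.le
        _ = _ := by ring
    -- Once zero, the potential stays zero: `Good` is inherited backwards and `H` never decreases.
    · have : ∀ y, g (insert o U) (Function.update ρ o y) = 0 := by
        intro y
        simp only [hg]
        rw [if_neg]
        rintro ⟨h1, h2⟩
        exact hcase ⟨hgood o hoT ρ y h1, (hmono U o ho hoT hUT ρ y).trans h2⟩
      have h0 : g U ρ = 0 := by simp only [hg, if_neg hcase]
      simp [this, h0])
  have h0 : avg (g ∅) ≤ 1 := by
    rw [← avg_const hn (1 : ℝ)]
    apply avg_mono
    intro ρ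
    simp only [hg]
    split_ifs
    · exact Real.exp_le_one_iff.2 (by simp)
    · norm_num
  have hfin : avg (g T) ≤ Real.exp (-((1 - q) * T.card / 2)) := by
    refine hstep.trans ?_
    calc (1 - (1 - q) / 2) ^ T.card * avg (g ∅) ≤ (1 - (1 - q) / 2) ^ T.card * 1 := by gcongr
      _ ≤ Real.exp (-((1 - q) / 2)) ^ T.card * 1 := by
          gcongr
          have := Real.add_one_le_exp (-((1 - q) / 2))
          linarith
      _ = _ := by rw [mul_one, ← Real.exp_nat_mul]; congr 1; ring
  refine (contacts_le_avg (fun ρ => Real.exp w * g T ρ) _ ?_ ?_).trans ?_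
  · intro ρ; exact mul_nonneg (Real.exp_pos _).le (hg0 _ _)
  · rintro ρ ⟨h1, h2⟩
    simp only [hg, if_pos (And.intro h1 h2)]
    rw [← Real.exp_add]
    apply Real.one_le_exp
    have : (H T ρ : ℝ) ≤ w := by exact_mod_cast h2
    linarith
  · apply ENNReal.ofReal_le_ofReal
    rw [avg_mul, sub_eq_add_neg, Real.exp_add]
    gcongr

end Average

/-! ### Tail bounds for random contacts and for coins -/

section Tail

variable {n : ℕ}

theorem exp_neg_two_mul_le {x : ℝ} (h0 : 0 ≤ x) (h1 : x ≤ 1 / 2) :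
    Real.exp (-(2 * x)) ≤ 1 - x := by
  rw [Real.exp_neg]
  have h2 := Real.add_one_le_exp (2 * x)
  have h3 : 1 ≤ (1 - x) * (2 * x + 1) := by nlinarith
  have h4 : (0 : ℝ) ≤ 1 - x := by linarith
  rw [inv_le_iff_one_le_mul₀ (Real.exp_pos _)]
  nlinarith

theorem exp_sub_one_le_two_mul {x : ℝ} (h0 : 0 ≤ x) (h1 : x ≤ 1) :
    Real.exp x - 1 ≤ 2 * x := by
  have := Real.abs_exp_sub_one_le (x := x) (by rw [abs_of_nonneg h0]; exact h1)
  rw [abs_of_nonneg h0] at this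
  exact (le_abs_self _).trans this

/-- The classes `{v | f v = some i}`, `i ∈ I`, that are not hit by the contacts of `U`. -/
def unhit (f : Fin n → Option (Fin n)) (I U : Finset (Fin n)) (ρ : Fin n → Fin n) :
    Finset (Fin n) :=
  I.filter fun i => ∀ o ∈ U, f (ρ o) ≠ some i

/-- Many classes of bounded size stay unhit. -/
theorem contacts_unhit_le (hn : 0 < n) (f : Fin n → Option (Fin n)) (I O : Finset (Fin n))
    {M z : ℝ} (hM0 : 0 ≤ M) (hM : 4 * M ≤ n)
    (hsize : ∀ i ∈ I, ((Finset.univ.filter fun v => f v = some i).card : ℝ) ≤ M) :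
    (contacts n).toOuterMeasure {ρ | ((unhit f I O ρ).card : ℝ) ≤ z} ≤
      ENNReal.ofReal (Real.exp (z - Real.exp (-(4 * M / n * O.card)) * I.card)) := by
  classical
  have hn' : (0 : ℝ) < n := by exact_mod_cast hn
  set x : ℝ := 2 * M / n with hx
  have hx0 : 0 ≤ x := by positivity
  have hx1 : x ≤ 1 / 2 := by rw [hx, div_le_iff₀ hn']; linarith
  set r : ℝ := 1 - x with hr
  have hr0 : 0 ≤ r := by linarith
  have hr1 : r ≤ 1 := by linarith
  -- The weight `r ^ (number of contacts still to come)` discounts the unhit classes by the fraction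
  -- expected to survive. This makes the potential a supermartingale, so `avg_le_pow` applies with
  -- factor `1`; at the end the weight is `1`.
  set g : Finset (Fin n) → (Fin n → Fin n) → ℝ := fun U ρ =>
    Real.exp (-(r ^ (O.card - U.card) * (unhit f I U ρ).card)) with hg
  have hstep := avg_le_pow hn O zero_le_one g (by
    intro U o ho hoO hUO ρ
    have hcard : O.card - U.card = (O.card - (insert o U).card) + 1 := by
      have h1 : (insert o U).card ≤ O.card :=
        Finset.card_le_card (Finset.insert_subset hoO hUO)
      rw [Finset.card_insert_of_notMem ho] at h1 ⊢
      omega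
    set l : ℝ := r ^ (O.card - (insert o U).card) with hl
    have hl0 : 0 ≤ l := pow_nonneg hr0 _
    have hl1 : l ≤ 1 := pow_le_one₀ hr0 hr1
    set Z : Finset (Fin n) := unhit f I U ρ with hZ
    have hupd : ∀ y, ∀ u ∈ U, Function.update ρ o y u = ρ u := by
      intro y u hu
      rw [Function.update_of_ne]
      rintro rfl
      exact ho hu
    have hin : ∀ y i, i ∈ unhit f I (insert o U) (Function.update ρ o y) ↔
        i ∈ Z ∧ f y ≠ some i := by
      intro y i
      simp only [unhit, hZ, Finset.mem_filter, Finset.mem_insert, forall_eq_or_imp,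
        Function.update_self]
      constructor
      · rintro ⟨h1, h2, h3⟩
        exact ⟨⟨h1, fun u hu => by rw [← hupd y u hu]; exact h3 u hu⟩, h2⟩
      · rintro ⟨⟨h1, h3⟩, h2⟩
        exact ⟨h1, h2, fun u hu => by rw [hupd y u hu]; exact h3 u hu⟩
    have hb : ∀ y, g (insert o U) (Function.update ρ o y) ≤ Real.exp (-(l * Z.card)) *
        (1 + 2 * l * (if ∃ i ∈ Z, f y = some i then 1 else 0)) := by
      intro y
      simp only [hg]
      rw [← hl]
      split_ifs with hy
      · obtain ⟨i, hi, hyi⟩ := hy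
        have h1 : Z.erase i ⊆ unhit f I (insert o U) (Function.update ρ o y) := by
          intro j hj
          rw [Finset.mem_erase] at hj
          rw [hin]
          refine ⟨hj.2, ?_⟩
          rw [hyi]
          intro h
          exact hj.1 (Option.some_injective _ h).symm
        have h2 := Finset.card_le_card h1
        rw [Finset.card_erase_of_mem hi] at h2
        have h3 : (Z.card : ℝ) ≤
            (unhit f I (insert o U) (Function.update ρ o y)).card + 1 := by
          exact_mod_cast (by omega)
        have h4 := exp_sub_one_le_two_mul hl0 hl1
        calc _ ≤ Real.exp (-(l * Z.card) + l) := by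
              apply Real.exp_le_exp.2
              nlinarith
          _ = Real.exp (-(l * Z.card)) * Real.exp l := Real.exp_add _ _
          _ ≤ _ := by gcongr; linarith
      · have h1 : Z ⊆ unhit f I (insert o U) (Function.update ρ o y) := by
          intro j hj
          rw [hin]
          exact ⟨hj, fun h => hy ⟨j, hj, h⟩⟩
        have h2 : (Z.card : ℝ) ≤ (unhit f I (insert o U) (Function.update ρ o y)).card := by
          exact_mod_cast Finset.card_le_card h1
        rw [mul_zero, add_zero, mul_one]
        apply Real.exp_le_exp.2
        nlinarith
    refine (Finset.sum_le_sum fun y _ => hb y).trans ?_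
    rw [← Finset.mul_sum, Finset.sum_add_distrib, ← Finset.mul_sum, Finset.sum_boole]
    have hcnt : ((Finset.univ.filter fun y => ∃ i ∈ Z, f y = some i).card : ℝ) ≤
        Z.card * M := by
      have h1 : (Finset.univ.filter fun y => ∃ i ∈ Z, f y = some i) ⊆
          Z.biUnion fun i => Finset.univ.filter fun v => f v = some i := by
        intro y
        simp
      have h2 := (Finset.card_le_card h1).trans Finset.card_biUnion_le
      calc ((Finset.univ.filter fun y => ∃ i ∈ Z, f y = some i).card : ℝ)
          ≤ ∑ i ∈ Z, ((Finset.univ.filter fun v => f v = some i).card : ℝ) := by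
            exact_mod_cast h2
        _ ≤ ∑ i ∈ Z, M :=
            Finset.sum_le_sum fun i hi => hsize i (Finset.mem_filter.1 hi).1
        _ = Z.card * M := by simp
    simp only [Finset.sum_const, Finset.card_univ, Fintype.card_fin, nsmul_eq_mul, mul_one,
      one_mul]
    -- Before the exposure the weight is `r * l` with `r = 1 - x`. The slack `exp (x * l * Z.card)`
    -- pays for the possible loss of one class, whose cost is `2 * l` times its probability.
    have hgU : g U ρ = Real.exp (-(l * Z.card)) * Real.exp (x * l * Z.card) := by
      simp only [hg]
      rw [hcard, pow_succ, ← hl, ← Real.exp_add, hr]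
      congr 1
      ring
    rw [hgU]
    have h5 := Real.add_one_le_exp (x * l * Z.card)
    have h6 : 2 * l * (Z.card * M) = n * (x * l * Z.card) := by
      rw [hx]; field_simp
    have h7 := mul_le_mul_of_nonneg_left hcnt (by positivity : 0 ≤ 2 * l)
    calc _ ≤ Real.exp (-(l * Z.card)) * (n * Real.exp (x * l * Z.card)) := by
          gcongr
          nlinarith
      _ = _ := by ring)
  rw [one_pow, one_mul] at hstep
  have hemp : avg (g ∅) = Real.exp (-(r ^ O.card * I.card)) := by
    rw [← avg_const hn (Real.exp (-(r ^ O.card * I.card)))]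
    congr 1
    funext ρ
    simp [hg, unhit]
  rw [hemp] at hstep
  have hlam : Real.exp (-(4 * M / n * O.card)) ≤ r ^ O.card := by
    have := exp_neg_two_mul_le hx0 hx1
    calc Real.exp (-(4 * M / n * O.card)) = Real.exp (-(2 * x)) ^ O.card := by
          rw [← Real.exp_nat_mul]
          congr 1
          rw [hx]; ring
      _ ≤ _ := by gcongr
  refine (contacts_le_avg (fun ρ => Real.exp z * g O ρ) _ ?_ ?_).trans ?_
  · intro ρ; positivity
  · intro ρ hρ
    simp only [Set.mem_ofPred_eq] at hρ
    simp only [hg, Nat.sub_self, pow_zero, one_mul]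
    rw [← Real.exp_add]
    apply Real.one_le_exp
    linarith
  · apply ENNReal.ofReal_le_ofReal
    rw [avg_mul, sub_eq_add_neg, Real.exp_add]
    gcongr
    refine hstep.trans (Real.exp_le_exp.2 ?_)
    nlinarith [mul_le_mul_of_nonneg_right hlam (Nat.cast_nonneg (α := ℝ) I.card)]

/-- Few nodes of `T` contact the small set `G`. -/
theorem contacts_card_mem_ge (hn : 0 < n) (T G : Finset (Fin n)) (w : ℝ) :
    (contacts n).toOuterMeasure {ρ | w ≤ ((T.filter fun o => ρ o ∈ G).card : ℝ)} ≤
      ENNReal.ofReal (Real.exp (2 * (G.card / n) * T.card - w)) := by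
  classical
  have hn' : (0 : ℝ) < n := by exact_mod_cast hn
  -- A contact lies in `G` with probability `|G| / n` and then multiplies the potential by `e ≤ 1 +
  -- 2`.
  set g : Finset (Fin n) → (Fin n → Fin n) → ℝ := fun U ρ =>
    Real.exp ((U.filter fun o => ρ o ∈ G).card : ℝ) with hg
  have hβ0 : 0 ≤ 1 + 2 * ((G.card : ℝ) / n) := by positivity
  have hstep := avg_le_pow hn T hβ0 g (by
    intro U o ho hoT hUT ρ
    have hcard : ∀ y, ((insert o U).filter fun u => Function.update ρ o y u ∈ G).card =
        (U.filter fun u => ρ u ∈ G).card + if y ∈ G then 1 else 0 := by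
      intro y
      rw [Finset.filter_insert, Function.update_self]
      have : (U.filter fun u => Function.update ρ o y u ∈ G) = U.filter fun u => ρ u ∈ G := by
        apply Finset.filter_congr
        intro u hu
        rw [Function.update_of_ne]
        rintro rfl
        exact ho hu
      rw [this]
      split_ifs
      · rw [Finset.card_insert_of_notMem]
        simp [ho]
      · simp
    have hb : ∀ y, g (insert o U) (Function.update ρ o y) ≤
        g U ρ * (1 + 2 * if y ∈ G then 1 else 0) := by
      intro y
      simp only [hg, hcard]
      split_ifs
      · push_cast
        rw [Real.exp_add]
        have := Real.exp_one_lt_d9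
        gcongr
        linarith
      · simp
    refine (Finset.sum_le_sum fun y _ => hb y).trans ?_
    rw [← Finset.mul_sum, Finset.sum_add_distrib, ← Finset.mul_sum, Finset.sum_boole]
    simp only [Finset.sum_const, Finset.card_univ, Fintype.card_fin, nsmul_eq_mul, mul_one]
    have : (Finset.univ.filter fun y => y ∈ G) = G := by ext; simp
    rw [this]
    apply le_of_eq
    field_simp)
  have hemp : avg (g ∅) = 1 := by
    rw [← avg_const hn (1 : ℝ)]
    congr 1
    funext ρ
    simp [hg]
  rw [hemp, mul_one] at hstep
  refine (contacts_le_avg (fun ρ => Real.exp (-w) * g T ρ) _ ?_ ?_).trans ?_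
  · intro ρ; positivity
  · intro ρ hρ
    simp only [Set.mem_ofPred_eq] at hρ
    simp only [hg]
    rw [← Real.exp_add]
    apply Real.one_le_exp
    linarith
  · apply ENNReal.ofReal_le_ofReal
    rw [avg_mul, sub_eq_neg_add, Real.exp_add]
    gcongr
    refine hstep.trans ?_
    calc (1 + 2 * ((G.card : ℝ) / n)) ^ T.card ≤ Real.exp (2 * (G.card / n)) ^ T.card := by
          gcongr
          rw [add_comm]
          exact Real.add_one_le_exp _
      _ = _ := by rw [← Real.exp_nat_mul]; congr 1; ring

/-! ## Coins -/

theorem coins_apply {p : ℝ} (hp0 : 0 ≤ p) (hp1 : p ≤ 1) (b : Fin n → Bool) :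
    coins n p b = ENNReal.ofReal (∏ v, if b v then p else 1 - p) := by
  have hc : clamp p = ENNReal.ofReal p := by
    unfold clamp
    exact min_eq_right (by simpa using ENNReal.ofReal_le_ofReal hp1)
  unfold coins
  rw [PMF.ofFintype_apply, ENNReal.ofReal_prod_of_nonneg]
  · refine Finset.prod_congr rfl fun v _ => ?_
    rw [hc]
    split_ifs
    · rfl
    · rw [ENNReal.ofReal_sub _ hp0, ENNReal.ofReal_one]
  · intro v _
    split_ifs <;> linarith

/-- Chernoff's method with Markov's inequality built into the event: by independence the generating
function factorises, with a factor `1 - p + p * z` for each node of `A` and `1` for the others. The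
values `z = e` and `z = 1 / e` give the upper and the lower tail. -/
theorem coins_mgf {p : ℝ} (hp0 : 0 ≤ p) (hp1 : p ≤ 1) (A : Finset (Fin n)) {z K : ℝ}
    (hz : 0 ≤ z) (hK : 0 ≤ K) :
    (coins n p).toOuterMeasure {b | 1 ≤ K * z ^ (A.filter fun v => b v = true).card} ≤
      ENNReal.ofReal (K * (1 - p + p * z) ^ A.card) := by
  classical
  rw [PMF.toOuterMeasure_apply_fintype]
  have hw : ∀ b : Fin n → Bool, 0 ≤ ∏ v, (if b v then p else 1 - p) := by
    intro b
    refine Finset.prod_nonneg fun v _ => ?_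
    split_ifs <;> linarith
  have h1 : ∀ b : Fin n → Bool,
      Set.indicator {b | 1 ≤ K * z ^ (A.filter fun v => b v = true).card} (coins n p) b ≤
      ENNReal.ofReal ((∏ v, if b v then p else 1 - p) *
        (K * z ^ (A.filter fun v => b v = true).card)) := by
    intro b
    by_cases hb : b ∈ {b | 1 ≤ K * z ^ (A.filter fun v => b v = true).card}
    · rw [Set.indicator_of_mem hb, coins_apply hp0 hp1]
      apply ENNReal.ofReal_le_ofReal
      exact le_mul_of_one_le_right (hw b) hb
    · rw [Set.indicator_of_notMem hb]
      exact zero_le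
  refine (Finset.sum_le_sum fun b _ => h1 b).trans ?_
  rw [← ENNReal.ofReal_sum_of_nonneg]
  · apply ENNReal.ofReal_le_ofReal
    apply le_of_eq
    have h2 : ∀ b : Fin n → Bool, (∏ v, if b v then p else 1 - p) *
        (K * z ^ (A.filter fun v => b v = true).card) =
        K * ∏ v, ((if b v then p else 1 - p) * if v ∈ A ∧ b v = true then z else 1) := by
      intro b
      rw [Finset.prod_mul_distrib, ← Finset.prod_filter]
      have : (Finset.univ.filter fun v => v ∈ A ∧ b v = true) =
          A.filter fun v => b v = true := by ext; simp
      rw [this, Finset.prod_const]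
      ring
    simp only [h2]
    rw [← Finset.mul_sum]
    congr 1
    have h3 := Finset.prod_univ_sum (fun _ : Fin n => (Finset.univ : Finset Bool))
      (fun v c => (if c = true then p else 1 - p) * if v ∈ A ∧ c = true then z else 1)
    rw [Fintype.piFinset_univ] at h3
    rw [← h3]
    simp only [Fintype.sum_bool]
    have h4 : ∀ v : Fin n, ((if True then p else 1 - p) * (if v ∈ A ∧ True then z else 1) +
        (if False then p else 1 - p) * if v ∈ A ∧ False then z else 1) =
        if v ∈ A then 1 - p + p * z else 1 := by
      intro v
      by_cases hv : v ∈ A <;> simp [hv]; ring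
    simp only [Bool.false_eq_true]
    simp only [h4]
    rw [← Finset.prod_filter]
    have : (Finset.univ.filter fun v => v ∈ A) = A := by ext; simp
    rw [this, Finset.prod_const]
  · intro b _
    exact mul_nonneg (hw b) (by positivity)

theorem coins_card_ge {p : ℝ} (hp0 : 0 ≤ p) (hp1 : p ≤ 1) (A : Finset (Fin n)) (w : ℝ) :
    (coins n p).toOuterMeasure {b | w ≤ ((A.filter fun v => b v = true).card : ℝ)} ≤
      ENNReal.ofReal (Real.exp (2 * p * A.card - w)) := by
  refine le_trans (MeasureTheory.measure_mono ?_) ((coins_mgf hp0 hp1 A (z := Real.exp 1)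
    (K := Real.exp (-w)) (by positivity) (by positivity)).trans ?_)
  · intro b hb
    simp only [Set.mem_ofPred_eq] at hb ⊢
    rw [← Real.exp_nat_mul, ← Real.exp_add]
    apply Real.one_le_exp
    linarith
  · apply ENNReal.ofReal_le_ofReal
    have h1 := Real.exp_one_lt_d9
    have h2 := Real.exp_one_gt_d9
    calc Real.exp (-w) * (1 - p + p * Real.exp 1) ^ A.card
        ≤ Real.exp (-w) * Real.exp (2 * p) ^ A.card := by
          refine mul_le_mul_of_nonneg_left (pow_le_pow_left₀ (by nlinarith) ?_ _) (by positivity)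
          have := Real.add_one_le_exp (2 * p)
          nlinarith
      _ = _ := by rw [← Real.exp_nat_mul, ← Real.exp_add]; congr 1; ring

theorem coins_card_le {p : ℝ} (hp0 : 0 ≤ p) (hp1 : p ≤ 1) (A : Finset (Fin n)) (w : ℝ) :
    (coins n p).toOuterMeasure {b | ((A.filter fun v => b v = true).card : ℝ) ≤ w} ≤
      ENNReal.ofReal (Real.exp (w - p * A.card / 2)) := by
  refine le_trans (MeasureTheory.measure_mono ?_) ((coins_mgf hp0 hp1 A (z := Real.exp (-1))
    (K := Real.exp w) (by positivity) (by positivity)).trans ?_)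
  · intro b hb
    simp only [Set.mem_ofPred_eq] at hb ⊢
    rw [← Real.exp_nat_mul, ← Real.exp_add]
    apply Real.one_le_exp
    linarith
  · apply ENNReal.ofReal_le_ofReal
    have h1 := half_le_one_sub_exp_neg_one
    have h2 := Real.exp_pos (-1)
    calc Real.exp w * (1 - p + p * Real.exp (-1)) ^ A.card
        ≤ Real.exp w * Real.exp (-(p / 2)) ^ A.card := by
          refine mul_le_mul_of_nonneg_left (pow_le_pow_left₀ (by nlinarith) ?_ _) (by positivity)
          have := Real.add_one_le_exp (-(p / 2))
          nlinarith
      _ = _ := by rw [← Real.exp_nat_mul, ← Real.exp_add]; congr 1; ring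

end Tail

/-! ## Hoare triples with failure probabilities -/

section Triple

variable {σ : Type} {n : ℕ}

/-- From every configuration in `P`, the steps `L` lead to `Q` except with probability `ε`. -/
def Triple (ID : Fin n → ℕ) (L : List (Step σ)) (P : (Fin n → σ) → Prop) (ε : ℝ)
    (Q : (Fin n → σ) → Prop) : Prop :=
  0 ≤ ε ∧ ∀ x, P x → (run ID L x).toOuterMeasure {y | ¬ Q y} ≤ ENNReal.ofReal ε

theorem toOuterMeasure_le_one {α : Type} (p : PMF α) (S : Set α) : p.toOuterMeasure S ≤ 1 := by
  rw [PMF.toOuterMeasure_apply, ← p.tsum_coe]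
  exact ENNReal.tsum_le_tsum fun a => Set.indicator_le_self _ _ _

theorem bind_outer_le {α β : Type} (p : PMF α) (f : α → PMF β) (S : Set β) (Q : α → Prop)
    {ε₁ ε₂ : ENNReal} (h1 : p.toOuterMeasure {a | ¬ Q a} ≤ ε₁)
    (h2 : ∀ a, Q a → (f a).toOuterMeasure S ≤ ε₂) :
    (p.bind f).toOuterMeasure S ≤ ε₁ + ε₂ := by
  classical
  rw [PMF.toOuterMeasure_bind_apply]
  have hb : ∀ a, p a * (f a).toOuterMeasure S ≤
      Set.indicator {a | ¬ Q a} p a + p a * ε₂ := by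
    intro a
    by_cases ha : Q a
    · exact (mul_le_mul_right (h2 a ha) _).trans le_add_self
    · rw [Set.indicator_of_mem (by exact ha)]
      calc p a * (f a).toOuterMeasure S ≤ p a * 1 :=
            mul_le_mul_right (toOuterMeasure_le_one _ _) _
        _ = p a := mul_one _
        _ ≤ _ := le_self_add
  refine (ENNReal.tsum_le_tsum hb).trans ?_
  rw [ENNReal.tsum_add, ENNReal.tsum_mul_right, p.tsum_coe, one_mul, ← PMF.toOuterMeasure_apply]
  gcongr

theorem run_append (ID : Fin n → ℕ) (L₁ L₂ : List (Step σ)) (x : Fin n → σ) :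
    run ID (L₁ ++ L₂) x = (run ID L₁ x).bind (run ID L₂) := by
  induction L₁ generalizing x with
  | nil => simp [run]
  | cons a L ih =>
    simp only [List.cons_append, run, PMF.bind_bind]
    congr 1
    funext y
    exact ih y

theorem rounds_append (L₁ L₂ : List (Step σ)) : rounds (L₁ ++ L₂) = rounds L₁ + rounds L₂ := by
  induction L₁ with
  | nil => simp [rounds]
  | cons a L ih => cases a <;> simp [rounds, ih]; omega

variable {ID : Fin n → ℕ} {L L₁ L₂ : List (Step σ)} {P Q R : (Fin n → σ) → Prop} {ε ε₁ ε₂ : ℝ}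

theorem Triple.append (h1 : Triple ID L₁ P ε₁ Q) (h2 : Triple ID L₂ Q ε₂ R) :
    Triple ID (L₁ ++ L₂) P (ε₁ + ε₂) R := by
  refine ⟨add_nonneg h1.1 h2.1, fun x hx => ?_⟩
  rw [run_append, ENNReal.ofReal_add h1.1 h2.1]
  exact bind_outer_le _ _ _ Q (h1.2 x hx) h2.2

theorem Triple.weaken {P' Q' : (Fin n → σ) → Prop} {ε' : ℝ} (h : Triple ID L P ε Q)
    (hP : ∀ x, P' x → P x) (hε : ε ≤ ε') (hQ : ∀ x, Q x → Q' x) : Triple ID L P' ε' Q' := by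
  refine ⟨h.1.trans hε, fun x hx => ?_⟩
  refine (MeasureTheory.measure_mono ?_).trans
    ((h.2 x (hP x hx)).trans (ENNReal.ofReal_le_ofReal hε))
  intro y hy hq
  exact hy (hQ y hq)

theorem Triple.nil (h : ∀ x, P x → Q x) : Triple ID ([] : List (Step σ)) P 0 Q := by
  refine ⟨le_rfl, fun x hx => ?_⟩
  simp [run, PMF.toOuterMeasure_pure_apply, h x hx]

end Triple

/-! ## The effect of the primitives on the clustering -/

section Semantics

variable {n : ℕ}

/-- The clustering of the configuration `x` is `f`, which maps every node to its leader; nodes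
know their IDs and the node `v` has the information `I v`. -/
structure Rep (ID : Fin n → ℕ) (I : Fin n → Finset (List Bool)) (x : Fin n → NodeState)
    (f : Fin n → Option (Fin n)) : Prop where
  id : ∀ v, (x v).id = ID v
  info : ∀ v, (x v).info = I v
  follow : ∀ v, (x v).follow = (f v).map ID

/-- Leaders follow themselves. -/
def Flat (f : Fin n → Option (Fin n)) : Prop := ∀ v u, f v = some u → f u = some u

/-- The nodes that follow `u`. -/
def fiber (f : Fin n → Option (Fin n)) (u : Fin n) : Finset (Fin n) :=
  Finset.univ.filter fun v => f v = some u

/-- The leaders. -/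
def leaders (f : Fin n → Option (Fin n)) : Finset (Fin n) :=
  Finset.univ.filter fun u => f u = some u

/-- The clustered nodes. -/
def clustered (f : Fin n → Option (Fin n)) : Finset (Fin n) :=
  Finset.univ.filter fun v => f v ≠ none

theorem mem_fiber {f : Fin n → Option (Fin n)} {u v : Fin n} : v ∈ fiber f u ↔ f v = some u := by
  simp [fiber]

theorem mem_leaders {f : Fin n → Option (Fin n)} {u : Fin n} : u ∈ leaders f ↔ f u = some u := by
  simp [leaders]

theorem mem_clustered {f : Fin n → Option (Fin n)} {v : Fin n} :
    v ∈ clustered f ↔ f v ≠ none := by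
  simp [clustered]

variable {ID : Fin n → ℕ} {I : Fin n → Finset (List Bool)} {x : Fin n → NodeState}
  {f : Fin n → Option (Fin n)}

theorem dest_addr (hID : Function.Injective ID) (ρ : Fin n → Fin n) (u w : Fin n) :
    dest ID ρ u (.addr (ID w)) = some w := by
  have h : ∃ v, ID v = ID w := ⟨w, rfl⟩
  simp only [dest, dif_pos h]
  congr 1
  exact hID h.choose_spec

theorem Rep.isLeader_iff (hID : Function.Injective ID) (hx : Rep ID I x f) (v : Fin n) :
    (x v).IsLeader ↔ f v = some v := by
  unfold NodeState.IsLeader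
  rw [hx.follow, hx.id]
  constructor
  · intro h
    rw [Option.map_eq_some_iff] at h
    obtain ⟨u, hu, hu'⟩ := h
    rw [hu, hID hu']
  · intro h
    rw [h]; rfl

/-- All PULLs are addressed, so the random contacts play no role. A leader applies its own
directive, which agrees with the formula for `u = v`. The node `u` need not be a leader itself: it
answers in any case. -/
theorem pullFromLeader_exec {R : Type} (hID : Function.Injective ID) (hx : Rep ID I x f)
    (directive : NodeState → R) (store : R → NodeState → NodeState) (ρ : Fin n → Fin n) :
    (pullFromLeader directive store).exec ID ρ x = fun v =>
      match f v with
      | some u => store (directive (x u)) (x v)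
      | none => x v := by
  funext v
  have hf := hx.follow v
  have hid := hx.id v
  have hl := hx.isLeader_iff hID v
  rcases hv : f v with _ | u
  · rw [hv] at hf hl
    simp only [Option.map_none] at hf
    simp [Round.exec, Round.answer, pullFromLeader, hf, hl]
  · rw [hv] at hf hl
    simp only [Option.map_some] at hf
    by_cases huv : u = v
    · subst huv
      simp [Round.exec, Round.answer, pullFromLeader, hf, hid, hl]
    · have hne : ID u ≠ (x v).id := by rw [hid]; exact fun h => huv (hID h)
      simp [Round.exec, Round.answer, pullFromLeader, hf, hne, dest_addr hID]

theorem mem_inbox {σ : Type} (r : Round σ) (ID : Fin n → ℕ) (ρ : Fin n → Fin n) (x : Fin n → σ)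
    (v : Fin n) (m : r.Msg) :
    m ∈ r.inbox ID ρ x v ↔ ∃ u t, r.act (x u) = .push t m ∧ dest ID ρ u t = some v := by
  simp only [Round.inbox, Multiset.mem_filterMap, Finset.mem_val, Finset.mem_univ, true_and]
  refine exists_congr fun u => ?_
  rcases h : r.act (x u) with _ | ⟨t, m'⟩ | t
  · simp
  · simp only [Action.push.injEq]
    constructor
    · intro h1
      split_ifs at h1 with h2
      exact ⟨t, ⟨rfl, Option.some_injective _ h1⟩, h2⟩
    · rintro ⟨t', ⟨rfl, rfl⟩, h2⟩
      rw [if_pos h2]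
  · simp

theorem pushToLeader_act {R : Type} (hID : Function.Injective ID) (hx : Rep ID I x f)
    (content : NodeState → Option R) (store : Multiset R → NodeState → NodeState) (u : Fin n)
    (t : Target) (m : R) :
    (pushToLeader content store).act (x u) = Action.push t m ↔
      ∃ w, f u = some w ∧ w ≠ u ∧ content (x u) = some m ∧ t = .addr (ID w) := by
  have hf := hx.follow u
  have hid := hx.id u
  rcases hu : f u with _ | w
  · rw [hu] at hf
    simp only [Option.map_none] at hf
    simp [pushToLeader, hf]
  · rw [hu] at hf
    simp only [Option.map_some] at hf
    rcases hc : content (x u) with _ | r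
    · simp [pushToLeader, hf, hc]
    · by_cases hwu : w = u
      · subst hwu
        simp only [pushToLeader, hf, hc, hid]
        simp
      · have hne : ID w ≠ (x u).id := by rw [hid]; exact fun h => hwu (hID h)
        simp only [pushToLeader, hf, hc, hne, if_false, Action.push.injEq, Option.some.injEq]
        constructor
        · rintro ⟨rfl, rfl⟩
          exact ⟨w, rfl, hwu, rfl, rfl⟩
        · rintro ⟨w', rfl, _, rfl, rfl⟩
          exact ⟨rfl, rfl⟩

/-- Only addressed PUSHes occur, so `ρ` may be replaced by any fixed value. -/
theorem pushToLeader_inbox {R : Type} (content : NodeState → Option R)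
    (store : Multiset R → NodeState → NodeState) (ρ : Fin n → Fin n) (v : Fin n) :
    (pushToLeader content store).inbox ID ρ x v = (pushToLeader content store).inbox ID id x v := by
  simp only [Round.inbox]
  congr 1
  funext u
  rcases h1 : (x u).follow with _ | l
  · simp [pushToLeader, h1]
  · rcases h2 : content (x u) with _ | m
    · simp [pushToLeader, h1, h2]
    · by_cases h3 : l = (x u).id <;> simp [pushToLeader, h1, h2, h3, dest]

/-- Received messages are stored as finite sets or unions, so multiplicities never matter. The inbox
is therefore known only through its members, and it is the same for all `ρ`. -/
theorem pushToLeader_exec {R : Type} (hID : Function.Injective ID) (hx : Rep ID I x f)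
    (content : NodeState → Option R) (store : Multiset R → NodeState → NodeState) :
    ∃ inbox : Fin n → Multiset R,
      (∀ v m, m ∈ inbox v ↔ ∃ u, f u = some v ∧ u ≠ v ∧ content (x u) = some m) ∧
      ∀ ρ, (pushToLeader content store).exec ID ρ x = fun v => store (inbox v) (x v) := by
  refine ⟨fun v => (pushToLeader content store).inbox ID id x v, ?_, ?_⟩
  · intro v m
    refine (mem_inbox (pushToLeader content store) ID id x v m).trans (exists_congr fun u => ?_)
    constructor
    · rintro ⟨t, h1, h2⟩
      obtain ⟨w, h3, h4, h5, rfl⟩ := (pushToLeader_act hID hx content store u t m).1 h1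
      rw [dest_addr hID] at h2
      obtain rfl := Option.some_injective _ h2
      exact ⟨h3, Ne.symm h4, h5⟩
    · rintro ⟨h1, h2, h3⟩
      exact ⟨_, (pushToLeader_act hID hx content store u _ m).2 ⟨v, h1, Ne.symm h2, h3, rfl⟩,
        dest_addr hID _ _ _⟩
  · intro ρ
    funext v
    show store ((pushToLeader content store).inbox ID ρ x v) (x v) = _
    rw [pushToLeader_inbox]

theorem run_compute (g : NodeState → NodeState) (L : List (Step NodeState))
    (x : Fin n → NodeState) : run ID (.compute g :: L) x = run ID L fun v => g (x v) := by
  simp [run, Step.exec]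

theorem run_coin (p : ℝ) (g : Bool → NodeState → NodeState) (L : List (Step NodeState))
    (x : Fin n → NodeState) :
    run ID (.coin p g :: L) x = (coins n p).bind fun b => run ID L fun v => g (b v) (x v) := by
  simp [run, Step.exec, PMF.bind_map, Function.comp_def]

theorem run_comm (r : Round NodeState) (L : List (Step NodeState)) (x : Fin n → NodeState) :
    run ID (.comm r :: L) x = (contacts n).bind fun ρ => run ID L (r.exec ID ρ x) := by
  simp [run, Step.exec, PMF.bind_map, Function.comp_def]

theorem run_comm_const (r : Round NodeState) (L : List (Step NodeState)) {x y : Fin n → NodeState}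
    (h : ∀ ρ, r.exec ID ρ x = y) : run ID (.comm r :: L) x = run ID L y := by
  rw [run_comm]
  simp [h]

theorem run_pull {R : Type} (hID : Function.Injective ID) (hx : Rep ID I x f)
    (directive : NodeState → R) (store : R → NodeState → NodeState) (L : List (Step NodeState)) :
    run ID (.comm (pullFromLeader directive store) :: L) x = run ID L fun v =>
      match f v with
      | some u => store (directive (x u)) (x v)
      | none => x v :=
  run_comm_const _ _ (pullFromLeader_exec hID hx directive store)

theorem run_push {R : Type} (hID : Function.Injective ID) (hx : Rep ID I x f)
    (content : NodeState → Option R) (store : Multiset R → NodeState → NodeState) :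
    ∃ inbox : Fin n → Multiset R,
      (∀ v m, m ∈ inbox v ↔ ∃ u, f u = some v ∧ u ≠ v ∧ content (x u) = some m) ∧
      ∀ L, run ID (.comm (pushToLeader content store) :: L) x =
        run ID L fun v => store (inbox v) (x v) := by
  obtain ⟨inbox, h1, h2⟩ := pushToLeader_exec hID hx content store
  exact ⟨inbox, h1, fun L => run_comm_const _ _ h2⟩

/-- The messages which `v` or its followers receive contain the ID of `l`, if `g u` is the ID
which the cluster of `u` is told to PUSH. -/
def Recv (f g : Fin n → Option (Fin n)) (ρ : Fin n → Fin n) (l v : Fin n) : Prop :=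
  ∃ o, (f o).bind g = some l ∧ (ρ o = v ∨ f (ρ o) = some v)

theorem mem_sup_finset {s : Multiset (Finset ℕ)} {a : ℕ} : a ∈ s.sup ↔ ∃ t ∈ s, a ∈ t := by
  induction s using Multiset.induction_on <;> simp_all

/-- Only the middle one of the three rounds is random, so the outcome is a function of one vector of
contacts. The hypothesis on `msg` refers to the state after the reset of `order` and `heard`,
because the leader decides after it. -/
theorem run_clusterPush (hID : Function.Injective ID) (hx : Rep ID I x f)
    (msg : NodeState → Option ℕ) (g : Fin n → Option (Fin n))
    (hmsg : ∀ u, msg { x u with order := none, heard := ∅ } = (g u).map ID) :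
    ∃ Y : (Fin n → Fin n) → Fin n → NodeState,
      (∀ L, run ID (clusterPush msg ++ L) x = (contacts n).bind fun ρ => run ID L (Y ρ)) ∧
      ∀ ρ, Rep ID I (Y ρ) f ∧ (∀ v, (Y ρ v).active = (x v).active) ∧
        ∀ v m, m ∈ (Y ρ v).heard ↔ ∃ l, Recv f g ρ l v ∧ m = ID l := by
  set x1 : Fin n → NodeState := fun v => { x v with order := none, heard := ∅ } with hx1
  have hR1 : Rep ID I x1 f := ⟨hx.id, hx.info, hx.follow⟩
  set x2 : Fin n → NodeState := fun v =>
    match f v with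
    | some u => { x1 v with order := msg (x1 u) }
    | none => x1 v with hx2
  have hx2' : ∀ v, x2 v = { x v with order := ((f v).bind g).map ID, heard := ∅ } := by
    intro v
    rcases hv : f v with _ | u
    · simp [hx2, hv, hx1]
    · simp [hx2, hv, hx1, hmsg]
  have hR2 : Rep ID I x2 f :=
    ⟨fun v => by rw [hx2']; exact hx.id v, fun v => by rw [hx2']; exact hx.info v,
      fun v => by rw [hx2']; exact hx.follow v⟩
  set r3 : Round NodeState :=
    { Msg := ℕ
      act := fun st => match st.order with
        | some m => .push .random m
        | none => .idle
      respond := fun _ => none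
      update := fun st inbox _ => { st with heard := inbox.toFinset } } with hr3
  have hx3 : ∀ ρ v, r3.exec ID ρ x2 v =
      { x2 v with heard := Multiset.toFinset (r3.inbox ID ρ x2 v) } := fun ρ v => rfl
  have hR3 : ∀ ρ, Rep ID I (r3.exec ID ρ x2) f := fun ρ =>
    ⟨fun v => by rw [hx3]; exact hR2.id v, fun v => by rw [hx3]; exact hR2.info v,
      fun v => by rw [hx3]; exact hR2.follow v⟩
  have hh3 : ∀ ρ v m, m ∈ (r3.exec ID ρ x2 v).heard ↔
      ∃ l, (∃ o, (f o).bind g = some l ∧ ρ o = v) ∧ m = ID l := by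
    intro ρ v m
    have hact : ∀ o t, r3.act (x2 o) = Action.push t m ↔
        ((f o).bind g).map ID = some m ∧ t = .random := by
      intro o t
      have hord : (x2 o).order = ((f o).bind g).map ID := by rw [hx2']
      show (match (x2 o).order with
        | some m => Action.push .random m
        | none => Action.idle) = Action.push t m ↔ _
      rw [hord]
      rcases ((f o).bind g).map ID with _ | k
      · simp
      · simp [eq_comm, and_comm]
    have h1 : m ∈ (r3.exec ID ρ x2 v).heard ↔ m ∈ r3.inbox ID ρ x2 v := by
      rw [hx3]; exact Multiset.mem_toFinset
    rw [h1]
    refine (mem_inbox r3 ID ρ x2 v m).trans ?_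
    constructor
    · rintro ⟨o, t, h2, h3⟩
      obtain ⟨h4, rfl⟩ := (hact o t).1 h2
      obtain ⟨l, hl, rfl⟩ := Option.map_eq_some_iff.1 h4
      exact ⟨l, ⟨o, hl, Option.some_injective _ h3⟩, rfl⟩
    · rintro ⟨l, ⟨o, hl, ho⟩, rfl⟩
      exact ⟨o, .random, (hact o _).2 ⟨by rw [hl]; rfl, rfl⟩, congrArg some ho⟩
  choose inbox hin hrun using fun ρ => run_push (R := Finset ℕ) hID (hR3 ρ)
    (fun st => if st.heard.Nonempty then some st.heard else none)
    (fun inbox st => { st with heard := st.heard ∪ inbox.sup })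
  refine ⟨fun ρ v => { r3.exec ID ρ x2 v with
    heard := (r3.exec ID ρ x2 v).heard ∪ (inbox ρ v).sup }, ?_, ?_⟩
  · intro L
    rw [clusterPush]
    simp only [List.cons_append, List.nil_append]
    rw [run_compute, run_pull hID hR1, run_comm]
    congr 1
    funext ρ
    exact hrun ρ L
  · intro ρ
    refine ⟨⟨(hR3 ρ).id, (hR3 ρ).info, (hR3 ρ).follow⟩, ?_, ?_⟩
    · intro v
      simp only [hx3, hx2']
    · intro v m
      simp only [Finset.mem_union, mem_sup_finset, hin, hh3]
      constructor
      · rintro (⟨l, ⟨o, h1, h2⟩, rfl⟩ | ⟨t, ⟨u, h1, h2, h3⟩, h4⟩)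
        · exact ⟨l, ⟨o, h1, Or.inl h2⟩, rfl⟩
        · split_ifs at h3 with h5
          obtain rfl := Option.some_injective _ h3
          rw [hh3] at h4
          obtain ⟨l, ⟨o, h6, h7⟩, rfl⟩ := h4
          exact ⟨l, ⟨o, h6, Or.inr (by rw [h7]; exact h1)⟩, rfl⟩
      · rintro ⟨l, ⟨o, h1, h2⟩, rfl⟩
        -- A node does not relay to itself: what `v` received directly is in its own `heard`, and
        -- only the rest comes from followers.
        by_cases h3 : ρ o = v
        · exact Or.inl ⟨l, ⟨o, h1, h3⟩, rfl⟩
        · right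
          have h4 : f (ρ o) = some v := h2.resolve_left h3
          have h5 : ID l ∈ (r3.exec ID ρ x2 (ρ o)).heard := by
            rw [hh3]; exact ⟨l, ⟨o, h1, rfl⟩, rfl⟩
          exact ⟨_, ⟨ρ o, h4, h3, if_pos ⟨_, h5⟩⟩, h5⟩

/-- Every clustered node asks its old leader, so the clustering is composed with `h`. The result
need not be flat, since `h u` may itself move elsewhere. -/
theorem run_clusterMerge (hID : Function.Injective ID) (hx : Rep ID I x f)
    (newLeader : NodeState → Option ℕ) (h : Fin n → Option (Fin n))
    (hnew : ∀ u v, f v = some u → newLeader (x u) = (h u).map ID) :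
    ∃ y, (∀ L, run ID (clusterMerge newLeader ++ L) x = run ID L y) ∧
      Rep ID I y (fun v => (f v).bind h) ∧ ∀ v, (y v).active = (x v).active := by
  refine ⟨_, fun L => run_pull hID hx _ _ L, ⟨?_, ?_, ?_⟩, ?_⟩ <;> intro v <;>
    rcases hv : f v with _ | u
  · exact hx.id v
  · exact hx.id v
  · exact hx.info v
  · exact hx.info v
  · have := hx.follow v
    rw [hv] at this
    simpa using this
  · simpa using hnew u v hv
  · rfl
  · rfl

theorem smallest_eq_none {S : Finset ℕ} (h : ¬ S.Nonempty) : smallest S = none := dif_neg h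

theorem smallest_eq_some {S : Finset ℕ} {m : ℕ} (h1 : m ∈ S) (h2 : ∀ k ∈ S, m ≤ k) :
    smallest S = some m := by
  rw [smallest, dif_pos ⟨m, h1⟩]
  congr 1
  exact le_antisymm (S.min'_le m h1) (S.le_min' _ _ h2)

/-- The node with the smallest ID. -/
theorem exists_smallest {S : Finset ℕ} {X : Fin n → Prop} (hS : ∀ m, m ∈ S ↔ ∃ l, X l ∧ m = ID l) :
    (∃ l, X l ∧ (∀ l', X l' → ID l ≤ ID l') ∧ smallest S = some (ID l)) ∨
      (∀ l, ¬ X l) ∧ smallest S = none := by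
  by_cases h : S.Nonempty
  · left
    obtain ⟨l, hl, hm⟩ := (hS _).1 (S.min'_mem h)
    refine ⟨l, hl, ?_, ?_⟩
    · intro l' hl'
      rw [← hm]
      exact S.min'_le _ ((hS _).2 ⟨l', hl', rfl⟩)
    · rw [smallest, dif_pos h, hm]
  · right
    refine ⟨fun l hl => h ⟨ID l, (hS _).2 ⟨l, hl, rfl⟩⟩, smallest_eq_none h⟩

theorem run_nil (x : Fin n → NodeState) : run ID [] x = PMF.pure x := rfl

end Semantics

/-! ## Splitting a cluster into blocks -/

section Blocks

theorem rank_strictMonoOn (S : Finset ℕ) :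
    StrictMonoOn (fun x => (S.filter (· < x)).card) (S : Set ℕ) := by
  intro x hx y _ hxy
  apply Finset.card_lt_card
  rw [Finset.ssubset_iff_of_subset]
  · exact ⟨x, by simpa using ⟨hx, hxy⟩, by simp⟩
  · intro z hz
    rw [Finset.mem_filter] at hz ⊢
    exact ⟨hz.1, hz.2.trans hxy⟩

theorem image_rank (S : Finset ℕ) :
    S.image (fun x => (S.filter (· < x)).card) = Finset.range S.card := by
  apply Finset.eq_of_subset_of_card_le
  · intro i hi
    obtain ⟨x, hx, rfl⟩ := Finset.mem_image.1 hi
    rw [Finset.mem_range]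
    apply Finset.card_lt_card
    rw [Finset.ssubset_iff_of_subset (Finset.filter_subset _ _)]
    exact ⟨x, hx, by simp⟩
  · rw [Finset.card_range, Finset.card_image_of_injOn (rank_strictMonoOn S).injOn]

/-- The rank is a bijection from `S` to `range S.card`, so counting in blocks of IDs becomes
counting indices. -/
theorem card_filter_rank (S : Finset ℕ) (P : ℕ → Prop) [DecidablePred P] :
    (S.filter fun x => P (S.filter (· < x)).card).card = ((Finset.range S.card).filter P).card := by
  rw [← image_rank, Finset.filter_image, Finset.card_image_of_injOn]
  exact (rank_strictMonoOn S).injOn.mono (by intro x; simp +contextual)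

/-- The indices of block `j` are those with `j * m ≤ i * k < (j + 1) * m`, an interval of length `m
/ k`, which lies between `s` and `2 * s`. -/
theorem card_block_index {m k s j : ℕ} (hk : 0 < k) (hm : 0 < m) (hj : j < k) (h1 : s * k ≤ m)
    (h2 : m ≤ 2 * s * k) :
    s ≤ ((Finset.range m).filter fun i => i * k / m = j).card ∧
      ((Finset.range m).filter fun i => i * k / m = j).card ≤ 2 * s := by
  have hiff : ∀ i, i * k / m = j ↔ j * m ≤ i * k ∧ i * k < (j + 1) * m := by
    intro i
    rw [Nat.div_eq_iff hm]
    constructor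
    · rintro ⟨h3, h4⟩
      refine ⟨h3, ?_⟩
      have : (j + 1) * m = j * m + m := by ring
      omega
    · rintro ⟨h3, h4⟩
      have : (j + 1) * m = j * m + m := by ring
      exact ⟨h3, by omega⟩
  -- `i0 = ⌈j * m / k⌉` is the first index of the block.
  obtain ⟨i0, ha, hb⟩ : ∃ i0, j * m ≤ i0 * k ∧ i0 * k ≤ j * m + k - 1 := by
    refine ⟨(j * m + k - 1) / k, ?_, Nat.div_mul_le_self _ _⟩
    have := Nat.lt_div_mul_add (a := j * m + k - 1) hk
    omega
  have hjm : (j + 1) * m = j * m + m := by ring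
  constructor
  · calc s = (Finset.Ico i0 (i0 + s)).card := by simp
      _ ≤ _ := by
        apply Finset.card_le_card
        intro i hi
        rw [Finset.mem_Ico] at hi
        rw [Finset.mem_filter, Finset.mem_range, hiff]
        have h3 : i0 * k ≤ i * k := Nat.mul_le_mul_right k hi.1
        have h4 : (i + 1) * k ≤ (i0 + s) * k := Nat.mul_le_mul_right k hi.2
        have h5 : (i + 1) * k = i * k + k := by ring
        have h6 : (i0 + s) * k = i0 * k + s * k := by ring
        have h7 : i * k < (j + 1) * m := by omega
        refine ⟨?_, by omega, h7⟩
        have h8 : (j + 1) * m ≤ k * m := Nat.mul_le_mul_right m hj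
        have h9 : i * k < m * k := by rw [mul_comm m k]; omega
        exact Nat.lt_of_mul_lt_mul_right h9
  · calc _ ≤ (Finset.Ico i0 (i0 + 2 * s)).card := by
          apply Finset.card_le_card
          intro i hi
          rw [Finset.mem_filter, Finset.mem_range, hiff] at hi
          rw [Finset.mem_Ico]
          constructor
          · by_contra h3
            have h4 : (i + 1) * k ≤ i0 * k := Nat.mul_le_mul_right k (by omega)
            have h5 : (i + 1) * k = i * k + k := by ring
            omega
          · by_contra h3
            have h4 : (i0 + 2 * s) * k ≤ i * k := Nat.mul_le_mul_right k (by omega)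
            have h5 : (i0 + 2 * s) * k = i0 * k + 2 * s * k := by ring
            omega
      _ = 2 * s := by simp

/-- The block number is monotone in the ID. Hence the smallest listed ID that is at least `x` is the
maximum `φ x` of the block of `x`, and the fibres of `φ` are the blocks. -/
theorem exists_newLeader (S : Finset ℕ) {s : ℕ} (hs : 1 ≤ s) (hS : s ≤ S.card) :
    ∃ φ : ℕ → ℕ, ∀ x ∈ S, smallest ((newLeaders s S).filter (x ≤ ·)) = some (φ x) ∧ φ x ∈ S ∧
      φ (φ x) = φ x ∧ s ≤ (S.filter fun y => φ y = φ x).card ∧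
      (S.filter fun y => φ y = φ x).card ≤ 2 * s := by
  have hm : 0 < S.card := by omega
  set k := max 1 (S.card / s) with hk
  have hk1 : S.card / s = k := by
    rw [hk, max_eq_right]
    exact (Nat.one_le_div_iff (by omega)).2 hS
  have hk0 : 0 < k := by rw [hk]; omega
  have h1 : s * k ≤ S.card := by rw [← hk1]; exact Nat.mul_div_le _ _
  -- With `k = ⌊|S| / s⌋ ≥ 1` one has `|S| < s * (k + 1) ≤ 2 * s * k`.
  have h2 : S.card ≤ 2 * s * k := by
    have h3 := Nat.lt_mul_div_succ S.card (by omega : 0 < s)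
    rw [hk1] at h3
    nlinarith
  have hmono : ∀ x y, x ≤ y → block S k x ≤ block S k y := by
    intro x y hxy
    unfold block
    apply Nat.div_le_div_right
    apply Nat.mul_le_mul_right
    apply Finset.card_le_card
    intro z hz
    rw [Finset.mem_filter] at hz ⊢
    exact ⟨hz.1, by omega⟩
  have hne : ∀ x ∈ S, (S.filter fun y => block S k y = block S k x).Nonempty :=
    fun x hx => ⟨x, by simp [hx]⟩
  set φ : ℕ → ℕ := fun x => if h : x ∈ S then
    (S.filter fun y => block S k y = block S k x).max' (hne x h) else 0 with hφ
  have hφ1 : ∀ x ∈ S, φ x ∈ S ∧ block S k (φ x) = block S k x := by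
    intro x hx
    simp only [hφ, dif_pos hx]
    have := (S.filter fun y => block S k y = block S k x).max'_mem (hne x hx)
    rwa [Finset.mem_filter] at this
  have hφ2 : ∀ x ∈ S, ∀ y ∈ S, block S k y = block S k x → y ≤ φ x := by
    intro x hx y hy hxy
    simp only [hφ, dif_pos hx]
    exact Finset.le_max' _ _ (by simp [hy, hxy])
  have hφ3 : ∀ x ∈ S, ∀ y ∈ S, φ y = φ x ↔ block S k y = block S k x := by
    intro x hx y hy
    constructor
    · intro h
      rw [← (hφ1 y hy).2, ← (hφ1 x hx).2, h]
    · intro h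
      apply le_antisymm
      · exact hφ2 x hx _ (hφ1 y hy).1 (by rw [(hφ1 y hy).2, h])
      · exact hφ2 y hy _ (hφ1 x hx).1 (by rw [(hφ1 x hx).2, h])
  refine ⟨φ, fun x hx => ⟨?_, (hφ1 x hx).1, ?_, ?_⟩⟩
  · apply smallest_eq_some
    · rw [Finset.mem_filter, newLeaders, Finset.mem_filter]
      refine ⟨⟨(hφ1 x hx).1, ?_⟩, hφ2 x hx x hx rfl⟩
      intro y hy hxy
      rw [← hk] at hxy
      exact hφ2 x hx y hy (hxy.trans (hφ1 x hx).2)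
    · intro t ht
      rw [Finset.mem_filter, newLeaders, Finset.mem_filter] at ht
      by_contra hlt
      have h3 := hmono x t ht.2
      have h4 := hmono t (φ x) (by omega)
      rw [(hφ1 x hx).2] at h4
      have h5 := ht.1.2 (φ x) (hφ1 x hx).1 (by rw [← hk, (hφ1 x hx).2]; omega)
      omega
  · exact (hφ3 x hx _ (hφ1 x hx).1).2 (hφ1 x hx).2
  · have h3 : (S.filter fun y => φ y = φ x) = S.filter fun y => block S k y = block S k x :=
      Finset.filter_congr fun y hy => hφ3 x hx y hy
    rw [h3]
    have h4 := card_filter_rank S fun i => i * k / S.card = block S k x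
    have h5 : (S.filter fun y => block S k y = block S k x) =
        S.filter fun y => (S.filter (· < y)).card * k / S.card = block S k x := rfl
    rw [h5, h4]
    apply card_block_index hk0 hm _ h1 h2
    unfold block
    rw [Nat.div_lt_iff_lt_mul hm, mul_comm k]
    apply Nat.mul_lt_mul_of_pos_right _ hk0
    apply Finset.card_lt_card
    rw [Finset.ssubset_iff_of_subset (Finset.filter_subset _ _)]
    exact ⟨x, hx, by simp⟩

end Blocks

/-! ## The effect of the phases on the clustering -/

section Phases

variable {n : ℕ} {ID : Fin n → ℕ} {I : Fin n → Finset (List Bool)} {x : Fin n → NodeState}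
  {f : Fin n → Option (Fin n)}

/-- A leader does not push to itself and therefore inserts its own ID. For other nodes the collected
set is never consulted if the clustering is flat. -/
theorem run_collect (hID : Function.Injective ID) (hx : Rep ID I x f) :
    ∃ y, (∀ L, run ID (.comm collectMembers :: L) x = run ID L y) ∧ Rep ID I y f ∧
      ∀ u, f u = some u → (y u).members = (fiber f u).image ID := by
  obtain ⟨inbox, hin, hrun⟩ := run_push (R := ℕ) hID hx (fun st => some st.id)
    (fun inbox st => { st with members := insert st.id inbox.toFinset })
  refine ⟨_, hrun, ⟨hx.id, hx.info, hx.follow⟩, ?_⟩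
  intro u hu
  ext m
  simp only [Finset.mem_insert, Multiset.mem_toFinset, hin, Finset.mem_image, mem_fiber, hx.id,
    Option.some.injEq]
  constructor
  · rintro (rfl | ⟨v, h1, _, h2⟩)
    · exact ⟨u, hu, rfl⟩
    · exact ⟨v, h1, h2⟩
  · rintro ⟨v, h1, h2⟩
    by_cases h3 : v = u
    · subst h3
      exact Or.inl h2.symm
    · exact Or.inr ⟨v, h1, h3, h2⟩

theorem card_image_ID (hID : Function.Injective ID) (S : Finset (Fin n)) :
    (S.image ID).card = S.card := Finset.card_image_of_injective _ hID

theorem run_dissolve (hID : Function.Injective ID) (hx : Rep ID I x f) (hf : Flat f) (s : ℕ) :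
    ∃ y, run ID (clusterDissolve s) x = PMF.pure y ∧
      Rep ID I y fun v => (f v).bind fun u => if s ≤ (fiber f u).card then some u else none := by
  obtain ⟨y, h1, h2, h3⟩ := run_collect hID hx
  refine ⟨_, (h1 _).trans ((run_pull hID h2 _ _ []).trans (run_nil _)), ?_, ?_, ?_⟩ <;>
    intro v <;> rcases hv : f v with _ | u
  · exact h2.id v
  · exact h2.id v
  · exact h2.info v
  · exact h2.info v
  · have := h2.follow v
    rw [hv] at this
    simpa using this
  · simp only [h3 u (hf v u hv), card_image_ID hID, Option.bind_some, h2.id]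
    split_ifs <;> rfl

/-- This carries `exists_newLeader` over from IDs to nodes, separately in every old cluster;
injectivity of `ID` preserves all block sizes. -/
theorem run_resize (hID : Function.Injective ID) (hx : Rep ID I x f) (hf : Flat f) {s : ℕ}
    (hs : 1 ≤ s) (hsize : ∀ u ∈ leaders f, s ≤ (fiber f u).card) :
    ∃ y f', run ID (clusterResize s) x = PMF.pure y ∧ Rep ID I y f' ∧ Flat f' ∧
      (∀ v, f' v = none ↔ f v = none) ∧
      ∀ u ∈ leaders f', s ≤ (fiber f' u).card ∧ (fiber f' u).card ≤ 2 * s := by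
  obtain ⟨y, h1, h2, h3⟩ := run_collect hID hx
  have hφ : ∀ u, ∃ φ : Fin n → Fin n, ∀ v, f v = some u →
      smallest ((newLeaders s ((fiber f u).image ID)).filter (ID v ≤ ·)) = some (ID (φ v)) ∧
      f (φ v) = some u ∧ φ (φ v) = φ v ∧
      s ≤ ((fiber f u).filter fun w => φ w = φ v).card ∧
      ((fiber f u).filter fun w => φ w = φ v).card ≤ 2 * s := by
    intro u
    by_cases hu : ∃ v, f v = some u
    · obtain ⟨v₀, hv₀⟩ := hu
      have hu := hsize u (mem_leaders.2 (hf _ _ hv₀))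
      obtain ⟨φ, h4⟩ := exists_newLeader ((fiber f u).image ID) hs (by rwa [card_image_ID hID])
      have hmem : ∀ v, f v = some u → ID v ∈ (fiber f u).image ID := fun v hv =>
        Finset.mem_image_of_mem _ (mem_fiber.2 hv)
      have h5 : ∀ v, ∃ w, f v = some u → f w = some u ∧ ID w = φ (ID v) := by
        intro v
        by_cases hv : f v = some u
        · obtain ⟨w, h6, h7⟩ := Finset.mem_image.1 (h4 _ (hmem v hv)).2.1
          exact ⟨w, fun _ => ⟨mem_fiber.1 h6, h7⟩⟩
        · exact ⟨v, fun h => absurd h hv⟩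
      choose ψ hψ using h5
      refine ⟨ψ, fun v hv => ?_⟩
      obtain ⟨h6, h7⟩ := hψ v hv
      obtain ⟨h8, _, h9, h10, h11⟩ := h4 _ (hmem v hv)
      have hcard : ((fiber f u).filter fun w => ψ w = ψ v).card =
          (((fiber f u).image ID).filter fun y => φ y = φ (ID v)).card := by
        rw [Finset.filter_image, card_image_ID hID]
        congr 1
        apply Finset.filter_congr
        intro w hw
        rw [← h7, ← (hψ w (mem_fiber.1 hw)).2]
        exact hID.eq_iff.symm
      refine ⟨by rw [h8, h7], h6, ?_, by rwa [hcard], by rwa [hcard]⟩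
      apply hID
      rw [(hψ _ h6).2, h7, h9]
    · exact ⟨id, fun v hv => absurd ⟨v, hv⟩ hu⟩
  choose φ hφ using hφ
  set f' : Fin n → Option (Fin n) := fun v => (f v).map fun u => φ u v with hf'
  have hf's : ∀ v u, f v = some u → f' v = some (φ u v) := by
    intro v u hv
    simp [hf', hv]
  have hff : Flat f' := by
    intro v w hv
    obtain ⟨u, h4, rfl⟩ := Option.map_eq_some_iff.1 hv
    obtain ⟨_, h5, h6, _⟩ := hφ u v h4
    rw [hf's _ u h5, h6]
  refine ⟨_, f', (h1 _).trans ((run_pull hID h2 _ _ []).trans (run_nil _)), ⟨?_, ?_, ?_⟩, hff,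
    ?_, ?_⟩
  · intro v
    rcases hv : f v with _ | u <;> exact h2.id v
  · intro v
    rcases hv : f v with _ | u <;> exact h2.info v
  · intro v
    rcases hv : f v with _ | u
    · have := h2.follow v
      rw [hv] at this
      simpa [hf', hv] using this
    · simp only [h3 u (hf v u hv), h2.id, hf's v u hv]
      exact (hφ u v hv).1
  · intro v
    simp [hf']
  · intro w hw
    rw [mem_leaders] at hw
    obtain ⟨u, h4, h5⟩ := Option.map_eq_some_iff.1 hw
    obtain ⟨_, h6, h7, h8, h9⟩ := hφ u w h4
    rw [h5] at h8 h9
    -- A new leader belongs to the old cluster that it was chosen for, so parts of different old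
    -- clusters never share a leader and each new cluster is exactly one block.
    have : fiber f' w = (fiber f u).filter fun v => φ u v = w := by
      ext v
      rw [mem_fiber, Finset.mem_filter, mem_fiber]
      constructor
      · intro hv
        obtain ⟨u', h10, h11⟩ := Option.map_eq_some_iff.1 hv
        have h12 := (hφ u' v h10).2.1
        rw [h11, h4] at h12
        obtain rfl := Option.some_injective _ h12
        exact ⟨h10, h11⟩
      · rintro ⟨h10, h11⟩
        rw [hf's v u h10, h11]
    rw [this]
    exact ⟨h8, h9⟩

theorem run_activate (hID : Function.Injective ID) (hx : Rep ID I x f) (p : ℝ) :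
    ∃ Z : (Fin n → Bool) → Fin n → NodeState,
      run ID (clusterActivate p) x = (coins n p).map Z ∧
      ∀ b, Rep ID I (Z b) f ∧ ∀ u, f u = some u → (Z b u).active = b u := by
  set x1 : (Fin n → Bool) → Fin n → NodeState := fun b v =>
    if (x v).IsLeader then { x v with active := b v } else x v with hx1
  have hR1 : ∀ b, Rep ID I (x1 b) f := by
    intro b
    refine ⟨fun v => ?_, fun v => ?_, fun v => ?_⟩ <;> simp only [hx1] <;> split_ifs
    · exact hx.id v
    · exact hx.id v
    · exact hx.info v
    · exact hx.info v
    · exact hx.follow v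
    · exact hx.follow v
  refine ⟨fun b v => match f v with
    | some u => { x1 b v with active := (x1 b u).active }
    | none => x1 b v, ?_, ?_⟩
  · rw [clusterActivate, run_coin]
    show (coins n p).bind _ = (coins n p).bind _
    congr 1
    funext b
    exact (run_pull hID (hR1 b) _ _ []).trans (run_nil _)
  · intro b
    refine ⟨⟨fun v => ?_, fun v => ?_, fun v => ?_⟩, ?_⟩
    · dsimp only
      rcases hv : f v with _ | u <;> exact (hR1 b).id v
    · dsimp only
      rcases hv : f v with _ | u <;> exact (hR1 b).info v
    · have := (hR1 b).follow v
      dsimp only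
      rcases hv : f v with _ | u <;> rw [hv] at this <;> exact this
    · intro u hu
      simp only [hu, hx1, (hx.isLeader_iff hID u).2 hu, if_true]

theorem run_initial_coin (ID : Fin n → ℕ) (A : Finset (Fin n)) (m : List Bool) (p : ℝ) :
    ∃ Z : (Fin n → Bool) → Fin n → NodeState,
      run ID [.coin p fun b st => { st with follow := if b then some st.id else none }]
        (initial ID A m) = (coins n p).map Z ∧
      ∀ b, Rep ID (fun v => if v ∈ A then {m} else ∅) (Z b)
        (fun v => if b v = true then some v else none) := by
  refine ⟨_, run_coin _ _ [] _, ?_⟩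
  intro b
  refine ⟨fun v => rfl, fun v => rfl, fun v => ?_⟩
  simp only [initial]
  split_ifs <;> rfl

/-- These facts are independent of the selection rule: clustered nodes stay where they are, no new
leader arises because every pushed ID belongs to a leader, and every contact of a clustered node
becomes clustered. -/
theorem run_grow (hID : Function.Injective ID) (hx : Rep ID I x f) (hf : Flat f)
    {select : Finset ℕ → ℕ} (hsel : ∀ S : Finset ℕ, S.Nonempty → select S ∈ S) :
    ∃ Y : (Fin n → Fin n) → Fin n → NodeState,
      run ID (clusterPush (fun st => st.follow) ++
        [.compute fun st =>
          if st.follow = none ∧ st.heard.Nonempty then { st with follow := some (select st.heard) }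
          else st]) x = (contacts n).map Y ∧
      ∀ ρ, ∃ f', Rep ID I (Y ρ) f' ∧ (∀ v u, f v = some u → f' v = some u) ∧
        (∀ v u, f' v = some u → f u = some u) ∧ ∀ o, f o ≠ none → f' (ρ o) ≠ none := by
  obtain ⟨Y, hrun, hY⟩ := run_clusterPush hID hx (fun st => st.follow) f (fun u => hx.follow u)
  refine ⟨fun ρ v => if (Y ρ v).follow = none ∧ (Y ρ v).heard.Nonempty then
      { Y ρ v with follow := some (select (Y ρ v).heard) } else Y ρ v, ?_, ?_⟩
  · rw [hrun]
    show _ = (contacts n).bind _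
    congr 1
    funext ρ
    rw [run_compute]
    rfl
  · intro ρ
    obtain ⟨hR, _, hh⟩ := hY ρ
    have hex : ∀ v, ∃ w : Option (Fin n), (if (Y ρ v).follow = none ∧ (Y ρ v).heard.Nonempty then
        { Y ρ v with follow := some (select (Y ρ v).heard) } else Y ρ v).follow = w.map ID ∧
        (∀ u, f v = some u → w = some u) ∧ (∀ u, w = some u → f u = some u) ∧
        ∀ o, f o ≠ none → ρ o = v → w ≠ none := by
      intro v
      have hfv := hR.follow v
      rcases hv : f v with _ | u
      · rw [hv] at hfv
        simp only [Option.map_none] at hfv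
        by_cases hne : (Y ρ v).heard.Nonempty
        · obtain ⟨l, ⟨o, h1, _⟩, h3⟩ := (hh v _).1 (hsel _ hne)
          refine ⟨some l, ?_, by simp, ?_, by simp⟩
          · simp [hfv, hne, h3]
          · rintro _ ⟨⟩
            rw [Option.bind_eq_some_iff] at h1
            obtain ⟨w, h4, h5⟩ := h1
            exact hf _ _ h5
        · refine ⟨none, ?_, by simp, by simp, ?_⟩
          · simp [hne, hfv]
          · intro o ho hov
            exfalso
            apply hne
            obtain ⟨l, hl⟩ := Option.ne_none_iff_exists'.1 ho
            exact ⟨ID l, (hh v _).2 ⟨l, ⟨o, by rw [hl]; exact hf _ _ hl, Or.inl hov⟩, rfl⟩⟩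
      · rw [hv] at hfv
        simp only [Option.map_some] at hfv
        refine ⟨some u, ?_, by simp, ?_, by simp⟩
        · simp [hfv]
        · rintro _ ⟨⟩
          exact hf _ _ hv
    choose f' h1 h2 h3 h4 using hex
    refine ⟨f', ⟨fun v => ?_, fun v => ?_, h1⟩, h2, h3, fun o ho => h4 _ o ho rfl⟩
    · dsimp only
      split_ifs <;> exact hR.id v
    · dsimp only
      split_ifs <;> exact hR.info v

/-- An active cluster `l` reaches the cluster `u`. -/
def Hit (f : Fin n → Option (Fin n)) (act : Fin n → Bool) (ρ : Fin n → Fin n) (l u : Fin n) :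
    Prop :=
  ∃ o, f o = some l ∧ act l = true ∧ f (ρ o) = some u

/-- One iteration relabels leaders by `h`. Active leaders stay, an inactive leader moves to the
smallest active ID that hit its cluster, and it stays if there was none. -/
theorem run_recruit (hID : Function.Injective ID) (hx : Rep ID I x f) (hf : Flat f) :
    ∃ Y : (Fin n → Fin n) → Fin n → NodeState,
      run ID (clusterPush (fun st => if st.active then st.follow else none) ++
        clusterMerge (fun st => if st.active then st.follow else
          (smallest st.heard).or st.follow)) x = (contacts n).map Y ∧
      ∀ ρ, (∀ v, (Y ρ v).active = (x v).active) ∧ ∃ h : Fin n → Fin n,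
        Rep ID I (Y ρ) (fun v => (f v).map h) ∧ ∀ u ∈ leaders f,
          ((x u).active = true → h u = u) ∧
          ((x u).active = false → (∃ l, Hit f (fun v => (x v).active) ρ l u) →
            Hit f (fun v => (x v).active) ρ (h u) u ∧
              ∀ l, Hit f (fun v => (x v).active) ρ l u → ID (h u) ≤ ID l) ∧
          ((x u).active = false → (¬ ∃ l, Hit f (fun v => (x v).active) ρ l u) → h u = u) := by
  obtain ⟨Y, hrun, hY⟩ := run_clusterPush hID hx (fun st => if st.active then st.follow else none)
    (fun u => if (x u).active then f u else none) (by
      intro u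
      have := hx.follow u
      by_cases h : (x u).active = true <;> simp [h, this])
  have hrecv : ∀ ρ u, f u = some u → ∀ l,
      Recv f (fun u => if (x u).active then f u else none) ρ l u ↔
        Hit f (fun v => (x v).active) ρ l u := by
    intro ρ u hu l
    refine exists_congr fun o => ?_
    -- A leader is a member of its own cluster, so receiving directly and receiving through
    -- followers merge into one condition.
    have h2 : (ρ o = u ∨ f (ρ o) = some u) ↔ f (ρ o) = some u :=
      ⟨fun h => h.elim (fun h => by rw [h]; exact hu) _root_.id, Or.inr⟩
    rw [h2]
    rcases ho : f o with _ | w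
    · simp
    · have hw := hf _ _ ho
      by_cases ha : (x w).active = true
      · simp only [Option.bind_some, ha, if_true, hw, Option.some.injEq]
        constructor
        · rintro ⟨rfl, h3⟩; exact ⟨rfl, ha, h3⟩
        · rintro ⟨rfl, _, h3⟩; exact ⟨rfl, h3⟩
      · simp only [Option.bind_some, ha, Option.some.injEq]
        constructor
        · rintro ⟨h3, _⟩; simp at h3
        · rintro ⟨rfl, h3, _⟩; exact absurd h3 ha
  have hex : ∀ ρ u, ∃ h : Fin n, (f u = some u →
      (if (Y ρ u).active then (Y ρ u).follow else
        (smallest (Y ρ u).heard).or (Y ρ u).follow) = some (ID h)) ∧ (u ∈ leaders f →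
          ((x u).active = true → h = u) ∧
          ((x u).active = false → (∃ l, Hit f (fun v => (x v).active) ρ l u) →
            Hit f (fun v => (x v).active) ρ h u ∧
              ∀ l, Hit f (fun v => (x v).active) ρ l u → ID h ≤ ID l) ∧
          ((x u).active = false → (¬ ∃ l, Hit f (fun v => (x v).active) ρ l u) → h = u)) := by
    intro ρ u
    obtain ⟨hR, hact, hh⟩ := hY ρ
    by_cases hu : f u = some u
    · have hfu : (Y ρ u).follow = some (ID u) := by rw [hR.follow, hu]; rfl
      by_cases ha : (x u).active = true
      · refine ⟨u, fun _ => ?_, fun _ => ⟨fun _ => rfl, ?_, fun _ _ => rfl⟩⟩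
        · rw [hact, if_pos ha, hfu]
        · intro h; rw [h] at ha; simp at ha
      · have hS : ∀ m, m ∈ (Y ρ u).heard ↔ ∃ l, Hit f (fun v => (x v).active) ρ l u ∧ m = ID l := by
          intro m
          rw [hh]
          exact exists_congr fun l => by rw [hrecv ρ u hu]
        rcases exists_smallest hS with ⟨l, h1, h2, h3⟩ | ⟨h1, h2⟩
        · refine ⟨l, fun _ => ?_, fun _ => ⟨fun h => absurd h ha, fun _ _ => ⟨h1, h2⟩,
            fun _ h => absurd ⟨l, h1⟩ h⟩⟩
          rw [hact, if_neg ha, h3]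
          rfl
        · refine ⟨u, fun _ => ?_, fun _ => ⟨fun h => absurd h ha, ?_, fun _ _ => rfl⟩⟩
          · rw [hact, if_neg ha, h2, hfu]
            rfl
          · rintro _ ⟨l, hl⟩
            exact absurd hl (h1 l)
    · exact ⟨u, fun h => absurd h hu, fun h => absurd (mem_leaders.1 h) hu⟩
  choose h h1 h2 using hex
  have hmerge : ∀ ρ, ∃ y, (∀ L, run ID (clusterMerge (fun st => if st.active then st.follow else
      (smallest st.heard).or st.follow) ++ L) (Y ρ) = run ID L y) ∧
      Rep ID I y (fun v => (f v).bind fun u => some (h ρ u)) ∧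
      ∀ v, (y v).active = (Y ρ v).active := by
    intro ρ
    apply run_clusterMerge hID (hY ρ).1
    intro u v hv
    exact h1 ρ u (hf _ _ hv)
  choose y hy1 hy2 hy3 using hmerge
  refine ⟨y, ?_, fun ρ => ⟨fun v => by rw [hy3, (hY ρ).2.1], h ρ, ?_, h2 ρ⟩⟩
  · rw [hrun]
    show _ = (contacts n).bind _
    congr 1
    funext ρ
    have := hy1 ρ []
    rw [List.append_nil] at this
    exact this
  · have h5 := hy2 ρ
    have h6 : (fun v => (f v).bind fun u => some (h ρ u)) = fun v => (f v).map (h ρ) := by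
      funext v
      cases f v <;> rfl
    rwa [h6] at h5

/-- Flatness is deliberately not assumed: after the first merge a cluster may follow a node that has
itself moved to another leader, and the second merge starts from such a clustering. -/
theorem run_mergeAll (hID : Function.Injective ID) (hx : Rep ID I x f) :
    ∃ Y : (Fin n → Fin n) → Fin n → NodeState,
      run ID (clusterPush (fun st => st.follow) ++
        clusterMerge (fun st => smallest (st.heard ∪ st.follow.toFinset))) x =
          (contacts n).map Y ∧
      ∀ ρ, ∃ h : Fin n → Option (Fin n), Rep ID I (Y ρ) (fun v => (f v).bind h) ∧
        ∀ u, (∃ l, (Recv f f ρ l u ∨ f u = some l) ∧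
          (∀ l', Recv f f ρ l' u ∨ f u = some l' → ID l ≤ ID l') ∧ h u = some l) ∨
          (∀ l, ¬ (Recv f f ρ l u ∨ f u = some l)) ∧ h u = none := by
  obtain ⟨Y, hrun, hY⟩ := run_clusterPush hID hx (fun st => st.follow) f (fun u => hx.follow u)
  have hex : ∀ ρ u, ∃ h : Option (Fin n),
      smallest ((Y ρ u).heard ∪ (Y ρ u).follow.toFinset) = h.map ID ∧
        ((∃ l, (Recv f f ρ l u ∨ f u = some l) ∧
          (∀ l', Recv f f ρ l' u ∨ f u = some l' → ID l ≤ ID l') ∧ h = some l) ∨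
          (∀ l, ¬ (Recv f f ρ l u ∨ f u = some l)) ∧ h = none) := by
    intro ρ u
    obtain ⟨hR, _, hh⟩ := hY ρ
    have hS : ∀ m, m ∈ (Y ρ u).heard ∪ (Y ρ u).follow.toFinset ↔
        ∃ l, (Recv f f ρ l u ∨ f u = some l) ∧ m = ID l := by
      intro m
      rw [Finset.mem_union, hh, Option.mem_toFinset, hR.follow, Option.mem_def,
        Option.map_eq_some_iff]
      constructor
      · rintro (⟨l, h1, h2⟩ | ⟨l, h1, h2⟩)
        · exact ⟨l, Or.inl h1, h2⟩
        · exact ⟨l, Or.inr h1, h2.symm⟩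
      · rintro ⟨l, h1 | h1, h2⟩
        · exact Or.inl ⟨l, h1, h2⟩
        · exact Or.inr ⟨l, h1, h2.symm⟩
    rcases exists_smallest hS with ⟨l, h1, h2, h3⟩ | ⟨h1, h2⟩
    · exact ⟨some l, h3, Or.inl ⟨l, h1, h2, rfl⟩⟩
    · exact ⟨none, h2, Or.inr ⟨h1, rfl⟩⟩
  choose h h1 h2 using hex
  choose y hy1 hy2 _ using fun ρ => run_clusterMerge hID (hY ρ).1
    (fun st => smallest (st.heard ∪ st.follow.toFinset)) (h ρ) (fun u v _ => h1 ρ u)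
  refine ⟨y, ?_, fun ρ => ⟨h ρ, hy2 ρ, h2 ρ⟩⟩
  rw [hrun]
  show _ = (contacts n).bind _
  congr 1
  funext ρ
  have := hy1 ρ []
  rw [List.append_nil] at this
  exact this

theorem run_unclusteredPull (hx : Rep ID I x f) :
    ∃ Y : (Fin n → Fin n) → Fin n → NodeState,
      run ID [.comm
        { Msg := Option ℕ
          act := fun st => if st.follow = none then .pull .random else .idle
          respond := fun st => some st.follow
          update := fun st _ ans =>
            if st.follow = none then { st with follow := ans.join } else st }] x =
          (contacts n).map Y ∧
      ∀ ρ, Rep ID I (Y ρ) (fun v => if f v = none then f (ρ v) else f v) := by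
  refine ⟨_, run_comm _ [] x, fun ρ => ⟨fun v => ?_, fun v => ?_, fun v => ?_⟩⟩
  · simp only [Round.exec]
    split_ifs <;> exact hx.id v
  · simp only [Round.exec]
    split_ifs <;> exact hx.info v
  · have hfv := hx.follow v
    rcases hv : f v with _ | u
    · rw [hv] at hfv
      simp only [Option.map_none] at hfv
      simp [Round.exec, Round.answer, hfv, dest, hx.follow (ρ v)]
    · rw [hv] at hfv
      simp only [Option.map_some] at hfv
      simp [Round.exec, hfv]

theorem run_share (hID : Function.Injective ID) (hx : Rep ID I x f) {u₀ : Fin n}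
    (hf : ∀ v, f v = some u₀) {m : List Bool} (hm : ∃ v, m ∈ I v) :
    ∃ y, run ID clusterShare x = PMF.pure y ∧ ∀ v, m ∈ (y v).info := by
  obtain ⟨inbox, hin, hrun⟩ := run_push (R := Finset (List Bool)) hID hx
    (fun st => if st.info.Nonempty then some st.info else none)
    (fun inbox st => { st with info := st.info ∪ inbox.sup })
  set y : Fin n → NodeState := fun v => { x v with info := (x v).info ∪ (inbox v).sup } with hy
  have hsup : ∀ {s : Multiset (Finset (List Bool))} {t : Finset (List Bool)}, t ∈ s → t ⊆ s.sup :=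
    fun h => Multiset.le_sup h
  have hu₀ : m ∈ (y u₀).info := by
    obtain ⟨v, hv⟩ := hm
    rw [← hx.info] at hv
    simp only [hy, Finset.mem_union]
    by_cases h : v = u₀
    · subst h; exact Or.inl hv
    · exact Or.inr (hsup ((hin _ _).2 ⟨v, hf v, h, if_pos ⟨_, hv⟩⟩) hv)
  have hRy : Rep ID (fun v => (y v).info) y f := ⟨hx.id, fun _ => rfl, hx.follow⟩
  refine ⟨_, (hrun _).trans ((run_pull hID hRy _ _ []).trans (run_nil _)), ?_⟩
  intro v
  simp only [hf v, Finset.mem_union]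
  exact Or.inr hu₀

end Phases

/-! ## Growing the initial clusters -/

section Grow

variable {n : ℕ} {ID : Fin n → ℕ} {I : Fin n → Finset (List Bool)}

theorem Triple.of_exists_pure {σ : Type} {L : List (Step σ)} {P Q : (Fin n → σ) → Prop}
    (h : ∀ x, P x → ∃ y, run ID L x = PMF.pure y ∧ Q y) : Triple ID L P 0 Q := by
  refine ⟨le_rfl, fun x hx => ?_⟩
  obtain ⟨y, h1, h2⟩ := h x hx
  simp [h1, PMF.toOuterMeasure_pure_apply, h2]

theorem Triple.of_exists_map {σ α : Type} {L : List (Step σ)} {P Q : (Fin n → σ) → Prop} {ε : ℝ}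
    (hε : 0 ≤ ε) (p : PMF α)
    (h : ∀ x, P x → ∃ Y : α → Fin n → σ, run ID L x = p.map Y ∧
      p.toOuterMeasure {a | ¬ Q (Y a)} ≤ ENNReal.ofReal ε) : Triple ID L P ε Q := by
  refine ⟨hε, fun x hx => ?_⟩
  obtain ⟨Y, h1, h2⟩ := h x hx
  rw [h1, PMF.toOuterMeasure_map_apply]
  exact h2

theorem Triple.repeatSteps {L : List (Step NodeState)} {P : ℕ → (Fin n → NodeState) → Prop}
    {ε : ℝ} (h : ∀ i, Triple ID L (P i) ε (P (i + 1))) (k : ℕ) :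
    Triple ID (Gossip.repeatSteps k L) (P 0) (k * ε) (P k) := by
  suffices H : ∀ j, Triple ID (Gossip.repeatSteps k L) (P j) (k * ε) (P (j + k)) by
    simpa using H 0
  induction k with
  | zero => intro j; simpa [Gossip.repeatSteps] using Triple.nil (fun x hx => hx)
  | succ k ih =>
    intro j
    have h1 : Gossip.repeatSteps (k + 1) L = L ++ Gossip.repeatSteps k L := by
      simp [Gossip.repeatSteps, List.replicate_succ]
    rw [h1]
    have h2 := (h j).append (ih (j + 1))
    refine h2.weaken (fun _ h => h) (le_of_eq (by push_cast; ring)) ?_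
    intro x hx
    rwa [show j + (k + 1) = j + 1 + k by ring]

theorem outer_union_le {α : Type} (p : PMF α) {S A B : Set α} {a b : ℝ} (ha : 0 ≤ a) (hb : 0 ≤ b)
    (hS : S ⊆ A ∪ B) (hA : p.toOuterMeasure A ≤ ENNReal.ofReal a)
    (hB : p.toOuterMeasure B ≤ ENNReal.ofReal b) :
    p.toOuterMeasure S ≤ ENNReal.ofReal (a + b) := by
  rw [ENNReal.ofReal_add ha hb]
  exact (MeasureTheory.measure_mono hS).trans
    ((MeasureTheory.measure_union_le A B).trans (add_le_add hA hB))

theorem outer_biUnion_le {α : Type} (p : PMF α) {S : Set α} (J : Finset (Fin n))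
    (B : Fin n → Set α) {b : ℝ} (hS : S ⊆ ⋃ l ∈ J, B l)
    (hB : ∀ l ∈ J, p.toOuterMeasure (B l) ≤ ENNReal.ofReal b) :
    p.toOuterMeasure S ≤ ENNReal.ofReal (n * b) := by
  refine (MeasureTheory.measure_mono hS).trans
    ((MeasureTheory.measure_biUnion_finset_le J B).trans ?_)
  refine (Finset.sum_le_sum hB).trans ?_
  rw [Finset.sum_const, ENNReal.ofReal_mul (by positivity), ENNReal.ofReal_natCast, nsmul_eq_mul]
  gcongr
  simpa using Finset.card_le_univ J

/-- There are at most `M` clusters, which contain at least `k` nodes. -/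
def Grown (ID : Fin n → ℕ) (I : Fin n → Finset (List Bool)) (M k : ℝ) (x : Fin n → NodeState) :
    Prop :=
  ∃ f, Rep ID I x f ∧ Flat f ∧ ((leaders f).card : ℝ) ≤ M ∧ k ≤ (clustered f).card

/-- With mean `n * p`, the thresholds `3 * (n * p)` and `n * p / 4` turn the two coin bounds into
`exp (-(n * p))` and `exp (-(n * p / 4))`. -/
theorem triple_initial_coin (ID : Fin n → ℕ) (A : Finset (Fin n)) (m : List Bool) {p : ℝ}
    (hp0 : 0 ≤ p) (hp1 : p ≤ 1) :
    Triple ID [.coin p fun b st => { st with follow := if b then some st.id else none }]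
      (· = initial ID A m) (2 * Real.exp (-(n * p / 4)))
      (Grown ID (fun v => if v ∈ A then {m} else ∅) (3 * (n * p)) (n * p / 4)) := by
  refine Triple.of_exists_map (by positivity) (coins n p) ?_
  rintro x rfl
  obtain ⟨Z, h1, h2⟩ := run_initial_coin ID A m p
  refine ⟨Z, h1, ?_⟩
  have hL : ∀ b : Fin n → Bool, leaders (fun v => if b v = true then some v else none) =
      Finset.univ.filter fun v => b v = true := by
    intro b; ext v; simp [leaders]
  have hC : ∀ b : Fin n → Bool, clustered (fun v => if b v = true then some v else none) =
      Finset.univ.filter fun v => b v = true := by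
    intro b; ext v; simp [clustered]
  have hnp : 0 ≤ n * p := by positivity
  rw [two_mul]
  refine outer_union_le (coins n p)
    (A := {b | 3 * (n * p) ≤ ((Finset.univ.filter fun v => b v = true).card : ℝ)})
    (B := {b | ((Finset.univ.filter fun v => b v = true).card : ℝ) ≤ n * p / 4})
    (by positivity) (by positivity) ?_
    ((coins_card_ge hp0 hp1 Finset.univ _).trans ?_) ((coins_card_le hp0 hp1 Finset.univ _).trans ?_)
  · intro b hb
    by_contra hcon
    simp only [Set.mem_union, Set.mem_ofPred_eq, not_or, not_le] at hcon
    refine hb ⟨_, h2 b, ?_, ?_, ?_⟩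
    · intro v u hv
      have hv' : b v = true ∧ v = u := by simpa using hv
      obtain ⟨hv1, rfl⟩ := hv'
      exact hv
    · rw [hL]; exact hcon.1.le
    · rw [hC]; exact hcon.2.le
  · apply ENNReal.ofReal_le_ofReal
    apply Real.exp_le_exp.2
    simp only [Finset.card_univ, Fintype.card_fin]
    linarith
  · apply ENNReal.ofReal_le_ofReal
    apply Real.exp_le_exp.2
    simp only [Finset.card_univ, Fintype.card_fin]
    linarith

/-- As long as a fraction `1 / 200` of the nodes is unclustered, each push has a constant chance of
finding a new node. The size `y₀` only serves to give all iterations the same failure probability.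
-/
theorem triple_grow (hn : 0 < n) (hID : Function.Injective ID) {select : Finset ℕ → ℕ}
    (hsel : ∀ S : Finset ℕ, S.Nonempty → select S ∈ S) {M y y₀ : ℝ} (hy : y₀ ≤ y) :
    Triple ID (clusterPush (fun st => st.follow) ++
        [.compute fun st =>
          if st.follow = none ∧ st.heard.Nonempty then { st with follow := some (select st.heard) }
          else st])
      (Grown ID I M (min y (199 / 200 * n))) (Real.exp (-(y₀ / 800)))
      (Grown ID I M (min ((1 + 1 / 1600) * y) (199 / 200 * n))) := by
  classical
  have hn' : (0 : ℝ) < n := by exact_mod_cast hn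
  refine Triple.of_exists_map (by positivity) (contacts n) ?_
  rintro x ⟨f, hx, hf, hM, hX⟩
  obtain ⟨Y, hrun, hY⟩ := run_grow hID hx hf hsel
  refine ⟨Y, hrun, ?_⟩
  have key : ∀ ρ, Grown ID I M ((clustered f ∪ (clustered f).image ρ).card) (Y ρ) := by
    intro ρ
    obtain ⟨f', h1, h2, h3, h4⟩ := hY ρ
    refine ⟨f', h1, fun v u h => h2 _ _ (h3 _ _ h), ?_, ?_⟩
    · refine le_trans ?_ hM
      gcongr
      intro u hu
      rw [mem_leaders] at hu ⊢
      exact h3 _ _ hu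
    · gcongr
      intro v hv
      rw [mem_clustered]
      rcases Finset.mem_union.1 hv with h | h
      · obtain ⟨u, hu⟩ := Option.ne_none_iff_exists'.1 (mem_clustered.1 h)
        rw [h2 _ _ hu]
        simp
      · obtain ⟨o, ho, rfl⟩ := Finset.mem_image.1 h
        exact h4 o (mem_clustered.1 ho)
  have hweak : ∀ ρ k, k ≤ ((clustered f ∪ (clustered f).image ρ).card : ℝ) →
      Grown ID I M k (Y ρ) := by
    intro ρ k hk
    obtain ⟨f', h1, h2, h3, h4⟩ := key ρ
    exact ⟨f', h1, h2, h3, hk.trans h4⟩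
  set X : ℝ := ((clustered f).card : ℝ) with hXdef
  by_cases hbig : 199 / 200 * (n : ℝ) ≤ X
  · have : {ρ | ¬ Grown ID I M (min ((1 + 1 / 1600) * y) (199 / 200 * n)) (Y ρ)} = ∅ := by
      ext ρ
      simp only [Set.mem_ofPred_eq, Set.mem_empty_iff_false, iff_false, not_not]
      refine hweak ρ _ ((min_le_right _ _).trans (hbig.trans ?_))
      rw [hXdef]
      gcongr
      exact Finset.subset_union_left
    rw [this]
    simp
  · push Not at hbig
    have hyX : y ≤ X := by
      rcases min_le_iff.1 hX with h | h
      · exact h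
      · linarith
    have hX0 : 0 ≤ X := by positivity
    -- A contact is wasted if it is already clustered or newly found, with probability at most `(X +
    -- w) / n ≤ 199 / 200 + 1 / 1600`. The success rate is thus at least `7 / 1600`, and the
    -- exponent `X / 1600 - 7 * X / 3200` is below `-X / 800`.
    set w := ⌊X / 1600⌋₊ with hw
    have hw1 : (w : ℝ) ≤ X / 1600 := Nat.floor_le (by positivity)
    have hw2 : X / 1600 < w + 1 := Nat.lt_floor_add_one _
    have hcnt := contacts_counter_le hn (clustered f) w (q := 199 / 200 + 1 / 1600)
      (by norm_num) (by norm_num) (fun _ => True) (fun U ρ => (U.image ρ \ clustered f).card)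
      (fun _ _ _ _ h => h) (by
        intro U o ho _ _ ρ y
        apply Finset.card_le_card
        intro v
        simp only [Finset.mem_sdiff, Finset.mem_image, Finset.mem_insert]
        rintro ⟨⟨u, hu, rfl⟩, h⟩
        refine ⟨⟨u, Or.inr hu, ?_⟩, h⟩
        rw [Function.update_of_ne]
        rintro rfl
        exact ho hu) (by
        intro U o ho _ _ ρ _ hH
        have hsub : (Finset.univ.filter fun y =>
            ((insert o U).image (Function.update ρ o y) \ clustered f).card ≤
              (U.image ρ \ clustered f).card) ⊆ clustered f ∪ (U.image ρ \ clustered f) := by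
          intro y hy
          rw [Finset.mem_filter] at hy
          by_contra hcon
          rw [Finset.mem_union, not_or] at hcon
          have h1 : insert y (U.image ρ \ clustered f) ⊆
              (insert o U).image (Function.update ρ o y) \ clustered f := by
            intro v hv
            rw [Finset.mem_insert] at hv
            rw [Finset.mem_sdiff, Finset.mem_image]
            rcases hv with rfl | hv
            · exact ⟨⟨o, by simp, by simp⟩, hcon.1⟩
            · rw [Finset.mem_sdiff, Finset.mem_image] at hv
              obtain ⟨⟨u, hu, rfl⟩, h2⟩ := hv
              refine ⟨⟨u, by simp [hu], ?_⟩, h2⟩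
              rw [Function.update_of_ne]
              rintro rfl
              exact ho hu
          have h2 := Finset.card_le_card h1
          rw [Finset.card_insert_of_notMem hcon.2] at h2
          omega
        have h3 := (Finset.card_le_card hsub).trans (Finset.card_union_le _ _)
        have h4 : ((U.image ρ \ clustered f).card : ℝ) ≤ w := by exact_mod_cast hH
        calc _ ≤ (((clustered f).card + (U.image ρ \ clustered f).card : ℕ) : ℝ) := by
              exact_mod_cast h3
          _ ≤ X + w := by push_cast; linarith
          _ ≤ _ := by linarith)
    refine (MeasureTheory.measure_mono ?_).trans (hcnt.trans (ENNReal.ofReal_le_ofReal ?_))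
    · intro ρ hρ
      refine ⟨trivial, ?_⟩
      by_contra hcon
      push Not at hcon
      refine hρ (hweak ρ _ ((min_le_left _ _).trans ?_))
      have h1 : (clustered f ∪ (clustered f).image ρ).card =
          (clustered f).card + ((clustered f).image ρ \ clustered f).card := by
        rw [← Finset.card_union_of_disjoint Finset.disjoint_sdiff, Finset.union_sdiff_self_eq_union]
      rw [h1]
      push_cast
      rw [← hXdef]
      have h2 : (w : ℝ) + 1 ≤ ((clustered f).image ρ \ clustered f).card := by
        exact_mod_cast hcon
      linarith
    · apply Real.exp_le_exp.2
      rw [← hXdef]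
      linarith

/-- All clusters have at least `s` nodes, and almost all nodes are clustered. -/
def Large (ID : Fin n → ℕ) (I : Fin n → Finset (List Bool)) (s : ℕ) (x : Fin n → NodeState) :
    Prop :=
  ∃ f, Rep ID I x f ∧ Flat f ∧ (∀ u ∈ leaders f, s ≤ (fiber f u).card) ∧
    99 / 100 * (n : ℝ) ≤ (clustered f).card

/-- A dissolved cluster loses fewer than `s` nodes and there are at most `M` clusters, so at most `n
/ 200` nodes are lost and `199 / 200 - 1 / 200 = 99 / 100` remains. -/
theorem triple_dissolve (hID : Function.Injective ID) {s : ℕ} {M : ℝ} (hs : M * s ≤ n / 200) :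
    Triple ID (clusterDissolve s) (Grown ID I M (199 / 200 * n)) 0 (Large ID I s) := by
  classical
  refine Triple.of_exists_pure ?_
  rintro x ⟨f, hx, hf, hM, hX⟩
  obtain ⟨y, h1, h2⟩ := run_dissolve hID hx hf s
  refine ⟨y, h1, _, h2, ?_, ?_, ?_⟩
  · intro v u hv
    obtain ⟨w, h3, h4⟩ := Option.bind_eq_some_iff.1 hv
    split_ifs at h4 with h5
    obtain rfl := Option.some_injective _ h4
    simp [hf _ _ h3, h5]
  · intro u hu
    rw [mem_leaders] at hu
    obtain ⟨w, h3, h4⟩ := Option.bind_eq_some_iff.1 hu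
    split_ifs at h4 with h5
    obtain rfl := Option.some_injective _ h4
    refine h5.trans (Finset.card_le_card ?_)
    intro v hv
    rw [mem_fiber] at hv ⊢
    simp [hv, h5]
  · set f' : Fin n → Option (Fin n) :=
      fun v => (f v).bind fun u => if s ≤ (fiber f u).card then some u else none with hf'
    have hsub : clustered f \ clustered f' ⊆
        ((leaders f).filter fun u => (fiber f u).card < s).biUnion (fiber f) := by
      intro v hv
      rw [Finset.mem_sdiff, mem_clustered, mem_clustered, not_not] at hv
      obtain ⟨u, hu⟩ := Option.ne_none_iff_exists'.1 hv.1
      rw [Finset.mem_biUnion]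
      refine ⟨u, Finset.mem_filter.2 ⟨mem_leaders.2 (hf _ _ hu), ?_⟩, mem_fiber.2 hu⟩
      by_contra hcon
      have := hv.2
      simp [hf', hu, not_lt.1 hcon] at this
    have h3 : (clustered f \ clustered f').card ≤ (leaders f).card * s := by
      refine (Finset.card_le_card hsub).trans (Finset.card_biUnion_le.trans ?_)
      calc _ ≤ ∑ u ∈ (leaders f).filter fun u => (fiber f u).card < s, s :=
            Finset.sum_le_sum fun u hu => (Finset.mem_filter.1 hu).2.le
        _ ≤ _ := by
            rw [Finset.sum_const, smul_eq_mul]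
            exact Nat.mul_le_mul_right _ (Finset.card_filter_le _ _)
    have h4 : (clustered f).card ≤ (clustered f \ clustered f').card + (clustered f').card := by
      exact Finset.card_le_card_sdiff_add_card
    have h5 : ((clustered f).card : ℝ) ≤ (leaders f).card * s + (clustered f').card := by
      exact_mod_cast h4.trans (by omega)
    have h6 : ((leaders f).card : ℝ) * s ≤ M * s := by gcongr
    linarith

end Grow

/-! ## Squaring the cluster sizes -/

section Square

variable {n : ℕ} {ID : Fin n → ℕ} {I : Fin n → Finset (List Bool)} {f : Fin n → Option (Fin n)}

theorem card_biUnion_fiber (f : Fin n → Option (Fin n)) (J : Finset (Fin n)) :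
    (J.biUnion (fiber f)).card = ∑ u ∈ J, (fiber f u).card := by
  apply Finset.card_biUnion
  intro u _ w _ huw
  rw [Function.onFun, Finset.disjoint_left]
  intro v hv hv'
  rw [mem_fiber] at hv hv'
  rw [hv] at hv'
  exact huw (Option.some_injective _ hv')

theorem mul_card_le_card_biUnion_fiber {J : Finset (Fin n)} {s : ℝ}
    (h : ∀ u ∈ J, s ≤ (fiber f u).card) : J.card * s ≤ (J.biUnion (fiber f)).card := by
  rw [card_biUnion_fiber, Nat.cast_sum, ← nsmul_eq_mul]
  exact Finset.card_nsmul_le_sum _ _ _ h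

theorem card_biUnion_fiber_le_mul {J : Finset (Fin n)} {s : ℝ}
    (h : ∀ u ∈ J, ((fiber f u).card : ℝ) ≤ s) : ((J.biUnion (fiber f)).card : ℝ) ≤ J.card * s := by
  rw [card_biUnion_fiber, Nat.cast_sum, ← nsmul_eq_mul]
  exact Finset.sum_le_card_nsmul _ _ _ h

theorem card_le_n (S : Finset (Fin n)) : (S.card : ℝ) ≤ n := by
  have := Finset.card_le_univ S
  rw [Fintype.card_fin] at this
  exact_mod_cast this

theorem clustered_eq_biUnion (hf : Flat f) : clustered f = (leaders f).biUnion (fiber f) := by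
  ext v
  rw [mem_clustered, Finset.mem_biUnion]
  constructor
  · intro h
    obtain ⟨u, hu⟩ := Option.ne_none_iff_exists'.1 h
    exact ⟨u, mem_leaders.2 (hf _ _ hu), mem_fiber.2 hu⟩
  · rintro ⟨u, _, hu⟩
    rw [mem_fiber.1 hu]
    simp

/-- The leaders of the active clusters. -/
def activeLeaders (f : Fin n → Option (Fin n)) (x : Fin n → NodeState) : Finset (Fin n) :=
  (leaders f).filter fun u => (x u).active = true

/-- All clusters have between `s` and `2 s` nodes. -/
def Sized (ID : Fin n → ℕ) (I : Fin n → Finset (List Bool)) (s : ℕ) (x : Fin n → NodeState) :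
    Prop :=
  ∃ f, Rep ID I x f ∧ Flat f ∧
    (∀ u ∈ leaders f, s ≤ (fiber f u).card ∧ (fiber f u).card ≤ 2 * s) ∧
    99 / 100 * (n : ℝ) ≤ (clustered f).card

/-- All clusters have between `s` and `2 s` nodes, and about one in `s` of them is active. -/
def Activated (ID : Fin n → ℕ) (I : Fin n → Finset (List Bool)) (s : ℕ) (x : Fin n → NodeState) :
    Prop :=
  ∃ f, Rep ID I x f ∧ Flat f ∧
    (∀ u ∈ leaders f, s ≤ (fiber f u).card ∧ (fiber f u).card ≤ 2 * s) ∧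
    99 / 100 * (n : ℝ) ≤ (clustered f).card ∧
    n / (16 * (s : ℝ) ^ 2) ≤ (activeLeaders f x).card ∧
    ((activeLeaders f x).card : ℝ) ≤ 3 * n / (s : ℝ) ^ 2

/-- The active clusters have at least `t` nodes, the other ones at least `s`. -/
def Recruiting (ID : Fin n → ℕ) (I : Fin n → Finset (List Bool)) (s : ℕ) (t : ℝ)
    (x : Fin n → NodeState) : Prop :=
  ∃ f, Rep ID I x f ∧ Flat f ∧
    (∀ u ∈ leaders f, s ≤ (fiber f u).card) ∧
    (∀ u ∈ activeLeaders f x, t ≤ (fiber f u).card) ∧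
    99 / 100 * (n : ℝ) ≤ (clustered f).card ∧
    n / (16 * (s : ℝ) ^ 2) ≤ (activeLeaders f x).card

/-- A lower bound for the fraction of the nodes which are not reached by other active clusters. -/
def freeFraction : ℝ := Real.exp (-48) / 16

/-- The constant `γ` of the update `s ← ⌈γ s²⌉`. -/
def squareRate : ℝ := freeFraction / 8

theorem freeFraction_pos : 0 < freeFraction := by unfold freeFraction; positivity

theorem freeFraction_le : freeFraction ≤ 1 / 16 := by
  unfold freeFraction
  have : Real.exp (-48) ≤ 1 := Real.exp_le_one_iff.2 (by norm_num)
  linarith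

theorem squareRate_pos : 0 < squareRate := div_pos freeFraction_pos (by norm_num)

theorem triple_resize (hID : Function.Injective ID) {s : ℕ} (hs : 1 ≤ s) :
    Triple ID (clusterResize s) (Large ID I s) 0 (Sized ID I s) := by
  refine Triple.of_exists_pure ?_
  rintro x ⟨f, hx, hf, hsize, hX⟩
  obtain ⟨y, f', h1, h2, h3, h4, h5⟩ := run_resize hID hx hf hs hsize
  refine ⟨y, h1, f', h2, h3, h5, ?_⟩
  have : clustered f' = clustered f := by
    ext v
    rw [mem_clustered, mem_clustered, ne_eq, h4]
  rwa [this]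

/-- By their sizes there are between `n / (4 * s)` and `n / s` clusters, so the expected number of
active ones lies between `n / (4 * s ^ 2)` and `n / s ^ 2`. -/
theorem triple_activate (hID : Function.Injective ID) {s : ℕ} (hs : 1 ≤ s) :
    Triple ID (clusterActivate (1 / s)) (Sized ID I s)
      (2 * Real.exp (-(n / (16 * (s : ℝ) ^ 2)))) (Activated ID I s) := by
  have hs' : (1 : ℝ) ≤ s := by exact_mod_cast hs
  have hs0 : (0 : ℝ) < s := by linarith
  have hp0 : (0 : ℝ) ≤ 1 / s := by positivity
  have hp1 : (1 : ℝ) / s ≤ 1 := by rw [div_le_one hs0]; exact hs'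
  refine Triple.of_exists_map (by positivity) (coins n (1 / s)) ?_
  rintro x ⟨f, hx, hf, hsize, hX⟩
  obtain ⟨Z, h1, h2⟩ := run_activate hID hx (1 / (s : ℝ))
  refine ⟨Z, h1, ?_⟩
  have hA : ∀ b, activeLeaders f (Z b) = (leaders f).filter fun v => b v = true := by
    intro b
    unfold activeLeaders
    apply Finset.filter_congr
    intro u hu
    rw [(h2 b).2 u (mem_leaders.1 hu)]
  have hN1 : ((leaders f).card : ℝ) * s ≤ n := by
    refine (mul_card_le_card_biUnion_fiber (f := f) fun u hu => ?_).trans (card_le_n _)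
    exact_mod_cast (hsize u hu).1
  have hN2 : (n : ℝ) / 2 ≤ (leaders f).card * (2 * s) := by
    have h3 : ((clustered f).card : ℝ) ≤ (leaders f).card * (2 * s) := by
      rw [clustered_eq_biUnion hf]
      refine card_biUnion_fiber_le_mul fun u hu => ?_
      exact_mod_cast (hsize u hu).2
    have hn0 : (0 : ℝ) ≤ n := by positivity
    linarith
  have hN1' : 1 / (s : ℝ) * (leaders f).card ≤ n / (s : ℝ) ^ 2 := by
    rw [le_div_iff₀ (by positivity)]
    calc 1 / (s : ℝ) * (leaders f).card * (s : ℝ) ^ 2 = (leaders f).card * s := by field_simp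
      _ ≤ n := hN1
  have hN2' : n / (4 * (s : ℝ) ^ 2) ≤ 1 / (s : ℝ) * (leaders f).card := by
    rw [div_le_iff₀ (by positivity)]
    calc (n : ℝ) ≤ 4 * ((leaders f).card * s) := by linarith
      _ = 1 / (s : ℝ) * (leaders f).card * (4 * (s : ℝ) ^ 2) := by field_simp
  have e1 : (3 * n / (s : ℝ) ^ 2) = 3 * (n / (s : ℝ) ^ 2) := by ring
  have e2 : n / (4 * (s : ℝ) ^ 2) = (n / (s : ℝ) ^ 2) / 4 := by field_simp
  have e3 : n / (16 * (s : ℝ) ^ 2) = (n / (s : ℝ) ^ 2) / 16 := by field_simp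
  have h0 : 0 ≤ n / (s : ℝ) ^ 2 := by positivity
  rw [two_mul]
  refine outer_union_le (coins n (1 / s))
    (A := {b | 3 * n / (s : ℝ) ^ 2 ≤ (((leaders f).filter fun v => b v = true).card : ℝ)})
    (B := {b | (((leaders f).filter fun v => b v = true).card : ℝ) ≤ n / (16 * (s : ℝ) ^ 2)})
    (by positivity) (by positivity) ?_
    ((coins_card_ge hp0 hp1 (leaders f) _).trans ?_)
    ((coins_card_le hp0 hp1 (leaders f) _).trans ?_)
  · intro b hb
    by_contra hcon
    simp only [Set.mem_union, Set.mem_ofPred_eq, not_or, not_le] at hcon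
    refine hb ⟨f, (h2 b).1, hf, hsize, hX, ?_, ?_⟩
    · rw [hA]; exact hcon.2.le
    · rw [hA]; exact hcon.1.le
  · apply ENNReal.ofReal_le_ofReal
    apply Real.exp_le_exp.2
    linarith
  · apply ENNReal.ofReal_le_ofReal
    apply Real.exp_le_exp.2
    rw [e3]
    rw [e2] at hN2'
    linarith

/-- The clusters in `B` that are reached from `U`. -/
def reached (f : Fin n → Option (Fin n)) (B U : Finset (Fin n)) (ρ : Fin n → Fin n) :
    Finset (Fin n) :=
  B.filter fun u => ∃ o ∈ U, f (ρ o) = some u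

/-- The nodes of `T` reach many of the clusters that are not reached by the nodes of `O`. -/
theorem contacts_reached_le (hn : 0 < n) (f : Fin n → Option (Fin n)) (J T O : Finset (Fin n))
    (hTO : Disjoint T O) (w s : ℕ) (z ζ : ℝ) (hζ0 : 0 ≤ ζ) (hζ1 : ζ ≤ 1)
    (hsize : ∀ u ∈ J, s ≤ (fiber f u).card) (hz : ζ * n ≤ s * (z - w)) :
    (contacts n).toOuterMeasure
      {ρ | z ≤ (unhit f J O ρ).card ∧ (reached f (unhit f J O ρ) T ρ).card ≤ w} ≤
      ENNReal.ofReal (Real.exp (w - ζ * T.card / 2)) := by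
  classical
  -- As `T` and `O` are disjoint, exposing contacts of `T` does not affect which clusters `O` leaves
  -- unhit: the target set of the counter is fixed.
  have hB : ∀ o ∈ T, ∀ ρ y, unhit f J O (Function.update ρ o y) = unhit f J O ρ := by
    intro o ho ρ y
    unfold unhit
    apply Finset.filter_congr
    intro i _
    refine forall₂_congr fun o' ho' => ?_
    rw [Function.update_of_ne]
    rintro rfl
    exact Finset.disjoint_left.1 hTO ho ho'
  have hsub : ∀ U o, o ∉ U → o ∈ T → U ⊆ T → ∀ ρ y,
      reached f (unhit f J O ρ) U ρ ⊆
        reached f (unhit f J O (Function.update ρ o y)) (insert o U) (Function.update ρ o y) := by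
    intro U o ho hoT _ ρ y u hu
    unfold reached at hu ⊢
    rw [Finset.mem_filter] at hu ⊢
    rw [hB o hoT]
    obtain ⟨h1, o', h2, h3⟩ := hu
    refine ⟨h1, o', by simp [h2], ?_⟩
    rw [Function.update_of_ne]
    · exact h3
    · rintro rfl
      exact ho h2
  -- While at most `w` of at least `z` unhit clusters are reached, the others contain at least `s *
  -- (z - w) ≥ ζ * n` nodes, so the next contact reaches a new one with probability at least `ζ`.
  have h := contacts_counter_le hn T w (q := 1 - ζ) (by linarith) (by linarith)
    (fun ρ => z ≤ (unhit f J O ρ).card)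
    (fun U ρ => (reached f (unhit f J O ρ) U ρ).card)
    (fun o ho ρ y h => by rwa [hB o ho] at h)
    (fun U o ho hoT hUT ρ y => Finset.card_le_card (hsub U o ho hoT hUT ρ y)) (by
      intro U o ho hoT hUT ρ hgood hH
      set B := unhit f J O ρ with hBdef
      set R := reached f B U ρ with hR
      have hRB : R ⊆ B := Finset.filter_subset _ _
      have hdisj : (Finset.univ.filter fun y =>
          (reached f (unhit f J O (Function.update ρ o y)) (insert o U)
            (Function.update ρ o y)).card ≤ R.card) ⊆
          Finset.univ \ (B \ R).biUnion (fiber f) := by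
        intro y hy
        rw [Finset.mem_filter] at hy
        rw [Finset.mem_sdiff]
        refine ⟨Finset.mem_univ _, ?_⟩
        intro hcon
        obtain ⟨u, hu, hyu⟩ := Finset.mem_biUnion.1 hcon
        rw [Finset.mem_sdiff] at hu
        rw [mem_fiber] at hyu
        have h1 : insert u R ⊆ reached f (unhit f J O (Function.update ρ o y)) (insert o U)
            (Function.update ρ o y) := by
          apply Finset.insert_subset _ (hsub U o ho hoT hUT ρ y)
          unfold reached
          rw [Finset.mem_filter, hB o hoT]
          exact ⟨hu.1, o, by simp, by simpa using hyu⟩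
        have h2 := Finset.card_le_card h1
        rw [Finset.card_insert_of_notMem hu.2] at h2
        omega
      have h1 := Finset.card_le_card hdisj
      rw [Finset.card_sdiff_of_subset (Finset.subset_univ _), Finset.card_univ,
        Fintype.card_fin] at h1
      have h2 : ((B \ R).card : ℝ) * s ≤ ((B \ R).biUnion (fiber f)).card := by
        apply mul_card_le_card_biUnion_fiber
        intro u hu
        have hu' : u ∈ B := (Finset.mem_sdiff.1 hu).1
        exact_mod_cast hsize u (Finset.mem_filter.1 hu').1
      have h3 : (B.card : ℝ) ≤ (B \ R).card + R.card := by
        exact_mod_cast Finset.card_le_card_sdiff_add_card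
      have h4 : (R.card : ℝ) ≤ w := by exact_mod_cast hH
      have h5 : ((B \ R).biUnion (fiber f)).card ≤ n := by
        simpa using Finset.card_le_univ ((B \ R).biUnion (fiber f))
      have h6 : (((Finset.univ.filter fun y =>
          (reached f (unhit f J O (Function.update ρ o y)) (insert o U)
            (Function.update ρ o y)).card ≤ R.card).card : ℕ) : ℝ) ≤
          n - ((B \ R).biUnion (fiber f)).card := by
        rw [← Nat.cast_sub h5]
        exact_mod_cast h1
      refine h6.trans ?_
      have h7 : (s : ℝ) * (z - w) ≤ (B \ R).card * s := by
        rw [mul_comm]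
        gcongr
        linarith
      linarith)
  refine h.trans (le_of_eq ?_)
  congr 2
  ring

/-- For every active leader `l` two events suffice: the nodes `O l` of the other active clusters
leave at least `z` inactive clusters unhit, and the nodes of `l` reach more than `squareRate * s` of
these. Each such cluster brings `s` nodes. A union bound over `l` costs the factor `n`. -/
theorem triple_recruit_first (hn : 0 < n) (hID : Function.Injective ID) {s : ℕ} (hs : 24 ≤ s)
    (hsn : s ^ 2 ≤ n) :
    Triple ID (clusterPush (fun st => if st.active then st.follow else none) ++
        clusterMerge (fun st => if st.active then st.follow else
          (smallest st.heard).or st.follow))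
      (Activated ID I s) (n * (2 * Real.exp (-(squareRate * s))))
      (Recruiting ID I s (squareRate * (s : ℝ) ^ 2)) := by
  classical
  have hn' : (0 : ℝ) < n := by exact_mod_cast hn
  have hs' : (24 : ℝ) ≤ s := by exact_mod_cast hs
  have hs0 : (0 : ℝ) < s := by linarith
  have hsn' : (s : ℝ) ^ 2 ≤ n := by exact_mod_cast hsn
  refine Triple.of_exists_map (by positivity) (contacts n) ?_
  rintro x ⟨f, hx, hf, hsize, hX, ha1, ha2⟩
  obtain ⟨Y, hrun, hY⟩ := run_recruit hID hx hf
  refine ⟨Y, hrun, ?_⟩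
  set J : Finset (Fin n) := (leaders f).filter fun u => (x u).active = false with hJ
  set O : Fin n → Finset (Fin n) := fun l => ((activeLeaders f x).erase l).biUnion (fiber f) with hO
  set z : ℝ := freeFraction * n / s with hz
  have hsz : s * z = freeFraction * n := by rw [hz]; field_simp
  have hζ := freeFraction_pos
  have hζ1 := freeFraction_le
  -- the number of inactive clusters
  have hN : (n : ℝ) / (4 * s) ≤ (leaders f).card := by
    have h3 : ((clustered f).card : ℝ) ≤ (leaders f).card * (2 * s) := by
      rw [clustered_eq_biUnion hf]
      refine card_biUnion_fiber_le_mul fun u hu => ?_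
      exact_mod_cast (hsize u hu).2
    rw [div_le_iff₀ (by positivity)]
    linarith
  have hJN : ((leaders f).card : ℝ) = (activeLeaders f x).card + J.card := by
    have h3 := Finset.card_filter_add_card_filter_not (s := leaders f)
      (fun u => (x u).active = true)
    have h4 : J = (leaders f).filter fun u => ¬ (x u).active = true := by
      rw [hJ]; apply Finset.filter_congr; intro u _; simp
    rw [h4]
    exact_mod_cast h3.symm
  have hJc : (n : ℝ) / (8 * s) ≤ J.card := by
    -- This needs `24 ≤ s`: the active clusters then make up at most half of the guaranteed `n / (4
    -- * s)` clusters.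
    have h3 : 3 * (n : ℝ) / (s : ℝ) ^ 2 ≤ n / (8 * s) := by
      rw [div_le_div_iff₀ (by positivity) (by positivity)]
      have h5 : 24 * (s * n : ℝ) ≤ s * (s * n) := mul_le_mul_of_nonneg_right hs' (by positivity)
      nlinarith
    have h4 : (n : ℝ) / (4 * s) = n / (8 * s) + n / (8 * s) := by field_simp; norm_num
    linarith
  have hOc : ∀ l, ((O l).card : ℝ) ≤ 6 * n / s := by
    intro l
    have h3 : ((O l).card : ℝ) ≤ ((activeLeaders f x).erase l).card * (2 * s) := by
      refine card_biUnion_fiber_le_mul fun u hu => ?_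
      have hu' := (Finset.mem_filter.1 (Finset.mem_of_mem_erase hu)).1
      exact_mod_cast (hsize u hu').2
    have h4 : (((activeLeaders f x).erase l).card : ℝ) ≤ (activeLeaders f x).card := by
      exact_mod_cast Finset.card_erase_le
    calc ((O l).card : ℝ) ≤ (3 * n / (s : ℝ) ^ 2) * (2 * s) := h3.trans (by gcongr; linarith)
      _ = 6 * n / s := by field_simp; norm_num
  set w : ℕ := ⌊squareRate * s⌋₊ with hw
  have hγ := squareRate_pos
  have hγζ : squareRate = freeFraction / 8 := rfl
  have hw1 : (w : ℝ) ≤ squareRate * s := Nat.floor_le (by positivity)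
  have hw2 : squareRate * s < w + 1 := Nat.lt_floor_add_one _
  have hsw : (s : ℝ) * w ≤ freeFraction * n / 2 := by
    calc (s : ℝ) * w ≤ s * (squareRate * s) := by gcongr
      _ = squareRate * (s : ℝ) ^ 2 := by ring
      _ ≤ squareRate * n := by gcongr
      _ ≤ _ := by rw [hγζ]; nlinarith
  refine outer_biUnion_le (contacts n) (activeLeaders f x) (fun l =>
    {ρ | ((unhit f J (O l) ρ).card : ℝ) ≤ z} ∪
    {ρ | z ≤ (unhit f J (O l) ρ).card ∧
      (reached f (unhit f J (O l) ρ) (fiber f l) ρ).card ≤ w}) ?_ ?_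
  · intro ρ hρ
    by_contra hcon
    simp only [Set.mem_iUnion, Set.mem_union, Set.mem_ofPred_eq, not_exists, not_or, not_and,
      not_le] at hcon
    apply hρ
    obtain ⟨hact, h, hR, hh⟩ := hY ρ
    have hlead : ∀ u ∈ leaders f, h u ∈ leaders f ∧ h (h u) = h u ∧
        (h u = u ∨ (x u).active = false) := by
      intro u hu
      obtain ⟨h1, h2, h3⟩ := hh u hu
      by_cases hau : (x u).active = true
      · rw [h1 hau, h1 hau]
        exact ⟨hu, rfl, Or.inl rfl⟩
      · rw [Bool.not_eq_true] at hau
        by_cases hhit : ∃ l, Hit f (fun v => (x v).active) ρ l u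
        · obtain ⟨⟨o, h4, h5, _⟩, _⟩ := h2 hau hhit
          have h6 : h u ∈ leaders f := mem_leaders.2 (hf _ _ h4)
          exact ⟨h6, (hh _ h6).1 h5, Or.inr hau⟩
        · rw [h3 hau hhit, h3 hau hhit]
          exact ⟨hu, rfl, Or.inl rfl⟩
    have hsub : ∀ u, h u = u → fiber f u ⊆ fiber (fun v => (f v).map h) u := by
      intro u hu v hv
      rw [mem_fiber] at hv ⊢
      simp [hv, hu]
    have hleaders : ∀ u ∈ leaders (fun v => (f v).map h), u ∈ leaders f ∧ h u = u := by
      intro u hu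
      obtain ⟨t, h4, h5⟩ := Option.map_eq_some_iff.1 (mem_leaders.1 hu)
      obtain ⟨h6, h7, _⟩ := hlead t (mem_leaders.2 (hf _ _ h4))
      rw [h5] at h6 h7
      exact ⟨h6, h7⟩
    have hactive : activeLeaders (fun v => (f v).map h) (Y ρ) = activeLeaders f x := by
      ext u
      unfold activeLeaders
      rw [Finset.mem_filter, Finset.mem_filter, hact]
      constructor
      · rintro ⟨h4, h5⟩
        exact ⟨(hleaders u h4).1, h5⟩
      · rintro ⟨h4, h5⟩
        refine ⟨mem_leaders.2 ?_, h5⟩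
        simp [mem_leaders.1 h4, (hh u h4).1 h5]
    refine ⟨_, hR, ?_, ?_, ?_, ?_, ?_⟩
    · intro v u hv
      obtain ⟨t, h4, rfl⟩ := Option.map_eq_some_iff.1 hv
      obtain ⟨h6, h7, _⟩ := hlead t (mem_leaders.2 (hf _ _ h4))
      simp [mem_leaders.1 h6, h7]
    · intro u hu
      obtain ⟨h4, h5⟩ := hleaders u hu
      exact (hsize u h4).1.trans (Finset.card_le_card (hsub u h5))
    · intro l hl
      rw [hactive] at hl
      obtain ⟨h4, h5⟩ := hcon l hl
      have h6 := h5 h4.le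
      set R := reached f (unhit f J (O l) ρ) (fiber f l) ρ with hRdef
      have hRu : ∀ u ∈ R, u ∈ leaders f ∧ h u = l := by
        intro u hu
        obtain ⟨h7, o, h8, h9⟩ := Finset.mem_filter.1 hu
        obtain ⟨h10, h11⟩ := Finset.mem_filter.1 h7
        obtain ⟨h12, h13⟩ := Finset.mem_filter.1 h10
        refine ⟨h12, ?_⟩
        have hla : (x l).active = true := (Finset.mem_filter.1 hl).2
        obtain ⟨⟨o', h14, h15, h16⟩, _⟩ := (hh u h12).2.1 h13 ⟨l, o, mem_fiber.1 h8, hla, h9⟩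
        -- If `u` had moved to a leader other than `l`, another active cluster would have hit it,
        -- although it is unhit by `O l`. So the rule of the smallest ID does not matter.
        by_contra hne
        refine h11 o' ?_ h16
        rw [hO]
        simp only [Finset.mem_biUnion]
        refine ⟨h u, Finset.mem_erase.2 ⟨hne, Finset.mem_filter.2 ⟨?_, h15⟩⟩, mem_fiber.2 h14⟩
        exact mem_leaders.2 (hf _ _ h14)
      have h7 : R.biUnion (fiber f) ⊆ fiber (fun v => (f v).map h) l := by
        intro v hv
        obtain ⟨u, hu, hvu⟩ := Finset.mem_biUnion.1 hv
        rw [mem_fiber] at hvu ⊢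
        simp [hvu, (hRu u hu).2]
      have h8 : (R.card : ℝ) * s ≤ (R.biUnion (fiber f)).card := by
        apply mul_card_le_card_biUnion_fiber
        intro u hu
        exact_mod_cast (hsize u (hRu u hu).1).1
      have h9 : ((R.biUnion (fiber f)).card : ℝ) ≤
          (fiber (fun v => (f v).map h) l).card := by
        exact_mod_cast Finset.card_le_card h7
      have h10 : (w : ℝ) + 1 ≤ R.card := by exact_mod_cast h6
      calc squareRate * (s : ℝ) ^ 2 = squareRate * s * s := by ring
        _ ≤ R.card * s := by gcongr; linarith
        _ ≤ _ := h8.trans h9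
    · have : clustered (fun v => (f v).map h) = clustered f := by
        ext v
        rw [mem_clustered, mem_clustered]
        simp
      rwa [this]
    · rwa [hactive]
  · intro l hl
    have hll : l ∈ leaders f := (Finset.mem_filter.1 hl).1
    rw [two_mul]
    refine outer_union_le (contacts n) (by positivity) (by positivity) subset_rfl
      ((contacts_unhit_le hn f J (O l) (M := 2 * s) (z := z) (by positivity) ?_ ?_).trans ?_)
      ((contacts_reached_le hn f J (fiber f l) (O l) ?_ w s z (freeFraction / 2) (by linarith)
        (by linarith) ?_ ?_).trans ?_)
    · nlinarith
    · intro u hu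
      exact_mod_cast (hsize u (Finset.mem_filter.1 hu).1).2
    · apply ENNReal.ofReal_le_ofReal
      apply Real.exp_le_exp.2
      -- Classes have at most `2 * s` nodes and `O l` has at most `6 * n / s`, which gives the
      -- exponent `48`. The expected number of survivors is thus at least `2 * z`, twice the
      -- threshold.
      have h3 : Real.exp (-48) ≤ Real.exp (-(4 * (2 * (s : ℝ)) / n * (O l).card)) := by
        apply Real.exp_le_exp.2
        rw [neg_le_neg_iff]
        calc 4 * (2 * (s : ℝ)) / n * (O l).card ≤ 4 * (2 * (s : ℝ)) / n * (6 * n / s) := by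
              gcongr; exact hOc l
          _ = 48 := by field_simp; norm_num
      have h4 : Real.exp (-48) * (n / (8 * s)) ≤
          Real.exp (-(4 * (2 * (s : ℝ)) / n * (O l).card)) * J.card := by gcongr
      have h5 : Real.exp (-48) * (n / (8 * s)) = 2 * z := by
        rw [hz, freeFraction]; field_simp; norm_num
      have h6 : squareRate * s ≤ z := by
        rw [hz, le_div_iff₀ hs0]
        calc squareRate * s * s = squareRate * (s : ℝ) ^ 2 := by ring
          _ ≤ squareRate * n := by gcongr
          _ ≤ freeFraction * n := by gcongr; linarith
      linarith
    · rw [Finset.disjoint_left]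
      intro v hv hv'
      obtain ⟨u, h3, h4⟩ := Finset.mem_biUnion.1 hv'
      rw [mem_fiber] at hv h4
      rw [hv] at h4
      exact Finset.ne_of_mem_erase h3 (Option.some_injective _ h4).symm
    · intro u hu
      exact (hsize u (Finset.mem_filter.1 hu).1).1
    · rw [mul_sub, hsz]
      linarith
    · apply ENNReal.ofReal_le_ofReal
      apply Real.exp_le_exp.2
      have h3 : (s : ℝ) ≤ (fiber f l).card := by exact_mod_cast (hsize l hll).1
      -- Since `freeFraction = 8 * squareRate`, the exponent is at most `squareRate * s - 2 *
      -- squareRate * s`.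
      have h4 : freeFraction / 2 * s ≤ freeFraction / 2 * (fiber f l).card := by gcongr
      have h5 : freeFraction * s = 8 * (squareRate * s) := by rw [hγζ]; ring
      linarith

/-- A large set is reached by many random contacts. -/
theorem contacts_avoid_le (hn : 0 < n) (T G : Finset (Fin n)) :
    (contacts n).toOuterMeasure {ρ | ∀ o ∈ T, ρ o ∉ G} ≤
      ENNReal.ofReal (Real.exp (-(G.card / n * T.card / 2))) := by
  classical
  have hn' : (0 : ℝ) < n := by exact_mod_cast hn
  have hG := card_le_n G
  have hq : (G.card : ℝ) / n ≤ 1 := by rw [div_le_one hn']; exact hG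
  have hq0 : (0 : ℝ) ≤ G.card / n := by positivity
  have hsub : ∀ (U : Finset (Fin n)) o, o ∉ U → ∀ (ρ : Fin n → Fin n) y, (U.filter fun u => ρ u ∈ G) ⊆
      (insert o U).filter fun u => Function.update ρ o y u ∈ G := by
    intro U o ho ρ y u hu
    rw [Finset.mem_filter] at hu ⊢
    refine ⟨by simp [hu.1], ?_⟩
    rw [Function.update_of_ne]
    · exact hu.2
    · rintro rfl
      exact ho hu.1
  have h := contacts_counter_le hn T 0 (q := 1 - G.card / n) (by linarith) (by linarith)
    (fun _ => True) (fun U ρ => (U.filter fun u => ρ u ∈ G).card) (fun _ _ _ _ h => h)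
    (fun U o ho _ _ ρ y => Finset.card_le_card (hsub U o ho ρ y)) (by
      intro U o ho _ _ ρ _ _
      have h1 : (Finset.univ.filter fun y =>
          ((insert o U).filter fun u => Function.update ρ o y u ∈ G).card ≤
            (U.filter fun u => ρ u ∈ G).card) ⊆ Finset.univ \ G := by
        intro y hy
        rw [Finset.mem_filter] at hy
        rw [Finset.mem_sdiff]
        refine ⟨Finset.mem_univ _, fun hyG => ?_⟩
        have h2 : insert o (U.filter fun u => ρ u ∈ G) ⊆
            (insert o U).filter fun u => Function.update ρ o y u ∈ G :=
          Finset.insert_subset (by simpa using hyG) (hsub U o ho ρ y)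
        have h3 := Finset.card_le_card h2
        rw [Finset.card_insert_of_notMem (by simp [ho])] at h3
        omega
      have h2 := Finset.card_le_card h1
      rw [Finset.card_sdiff_of_subset (Finset.subset_univ _), Finset.card_univ,
        Fintype.card_fin] at h2
      have h3 : G.card ≤ n := by exact_mod_cast hG
      calc _ ≤ ((n - G.card : ℕ) : ℝ) := by exact_mod_cast h2
        _ = (1 - G.card / n) * n := by rw [Nat.cast_sub h3]; field_simp)
  refine (MeasureTheory.measure_mono ?_).trans (h.trans (le_of_eq ?_))
  · intro ρ hρ
    refine ⟨trivial, ?_⟩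
    rw [Nat.le_zero, Finset.card_eq_zero, Finset.filter_eq_empty_iff]
    exact fun o ho => hρ o ho
  · congr 2
    push_cast
    ring

/-- At least `n / (16 * s ^ 2)` active clusters of size `squareRate * s ^ 2` contain a fraction
`squareRate / 16` of all nodes. Hence every cluster is hit, all inactive ones join active ones, and
the survivors inherit the size of the active clusters. -/
theorem triple_recruit_second (hn : 0 < n) (hID : Function.Injective ID) {s : ℕ} (hs : 1 ≤ s) :
    Triple ID (clusterPush (fun st => if st.active then st.follow else none) ++
        clusterMerge (fun st => if st.active then st.follow else
          (smallest st.heard).or st.follow))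
      (Recruiting ID I s (squareRate * (s : ℝ) ^ 2)) (n * Real.exp (-(squareRate / 32 * s)))
      (Large ID I (nextSize squareRate s)) := by
  classical
  have hn' : (0 : ℝ) < n := by exact_mod_cast hn
  have hs' : (1 : ℝ) ≤ s := by exact_mod_cast hs
  have hs0 : (0 : ℝ) < s := by linarith
  have hγ := squareRate_pos
  refine Triple.of_exists_map (by positivity) (contacts n) ?_
  rintro x ⟨f, hx, hf, hsize, hsize', hX, ha1⟩
  obtain ⟨Y, hrun, hY⟩ := run_recruit hID hx hf
  refine ⟨Y, hrun, ?_⟩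
  set T := (activeLeaders f x).biUnion (fiber f) with hT
  have hTc : squareRate / 16 * n ≤ T.card := by
    have h1 := mul_card_le_card_biUnion_fiber hsize'
    calc squareRate / 16 * n = n / (16 * (s : ℝ) ^ 2) * (squareRate * (s : ℝ) ^ 2) := by field_simp
      _ ≤ (activeLeaders f x).card * (squareRate * (s : ℝ) ^ 2) := by gcongr
      _ ≤ _ := h1
  refine outer_biUnion_le (contacts n) (leaders f)
    (fun u => {ρ | ∀ o ∈ T, ρ o ∉ fiber f u}) ?_ ?_
  · intro ρ hρ
    by_contra hcon
    simp only [Set.mem_iUnion, Set.mem_ofPred_eq, not_exists, not_forall, not_not] at hcon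
    apply hρ
    obtain ⟨hact, h, hR, hh⟩ := hY ρ
    have hlead : ∀ u ∈ leaders f, h u ∈ activeLeaders f x ∧ h (h u) = h u := by
      intro u hu
      obtain ⟨h1, h2, h3⟩ := hh u hu
      by_cases hau : (x u).active = true
      · rw [h1 hau, h1 hau]
        exact ⟨Finset.mem_filter.2 ⟨hu, hau⟩, rfl⟩
      · rw [Bool.not_eq_true] at hau
        obtain ⟨o, ho, hou⟩ := hcon u hu
        obtain ⟨l, hl, hol⟩ := Finset.mem_biUnion.1 ho
        obtain ⟨⟨o, h4, h5, _⟩, _⟩ := h2 hau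
          ⟨l, o, mem_fiber.1 hol, (Finset.mem_filter.1 hl).2, mem_fiber.1 hou⟩
        have h6 : h u ∈ leaders f := mem_leaders.2 (hf _ _ h4)
        exact ⟨Finset.mem_filter.2 ⟨h6, h5⟩, (hh _ h6).1 h5⟩
    refine ⟨_, hR, ?_, ?_, ?_⟩
    · intro v u hv
      obtain ⟨t, h4, rfl⟩ := Option.map_eq_some_iff.1 hv
      obtain ⟨h6, h7⟩ := hlead t (mem_leaders.2 (hf _ _ h4))
      simp [mem_leaders.1 (Finset.mem_filter.1 h6).1, h7]
    · intro u hu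
      obtain ⟨t, h4, h5⟩ := Option.map_eq_some_iff.1 (mem_leaders.1 hu)
      obtain ⟨h6, h7⟩ := hlead t (mem_leaders.2 (hf _ _ h4))
      rw [h5] at h6 h7
      have h8 : fiber f u ⊆ fiber (fun v => (f v).map h) u := by
        intro v hv
        rw [mem_fiber] at hv ⊢
        simp [hv, h7]
      unfold nextSize
      rw [Nat.ceil_le]
      refine (hsize' u h6).trans ?_
      exact_mod_cast Finset.card_le_card h8
    · have : clustered (fun v => (f v).map h) = clustered f := by
        ext v
        rw [mem_clustered, mem_clustered]
        simp
      rwa [this]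
  · intro u hu
    refine (contacts_avoid_le hn T (fiber f u)).trans (ENNReal.ofReal_le_ofReal ?_)
    apply Real.exp_le_exp.2
    rw [neg_le_neg_iff]
    have h1 : (s : ℝ) ≤ (fiber f u).card := by exact_mod_cast hsize u hu
    calc squareRate / 32 * s = s / n * (squareRate / 16 * n) / 2 := by field_simp; norm_num
      _ ≤ _ := by gcongr

theorem triple_squareBody (hn : 0 < n) (hID : Function.Injective ID) {s : ℕ} (hs : 24 ≤ s)
    (hsn : s ^ 2 ≤ n) :
    Triple ID (squareBody s) (Large ID I s)
      (2 * Real.exp (-(n / (16 * (s : ℝ) ^ 2))) + 3 * (n * Real.exp (-(squareRate / 32 * s))))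
      (Large ID I (nextSize squareRate s)) := by
  have h := (((triple_resize (I := I) hID (by omega : 1 ≤ s)).append
    (triple_activate hID (by omega))).append
    ((triple_recruit_first hn hID hs hsn).append (triple_recruit_second hn hID (by omega))))
  have e : squareBody s = clusterResize s ++ clusterActivate (1 / s) ++
      ((clusterPush (fun st => if st.active then st.follow else none) ++
        clusterMerge (fun st => if st.active then st.follow else
          (smallest st.heard).or st.follow)) ++
       (clusterPush (fun st => if st.active then st.follow else none) ++
        clusterMerge (fun st => if st.active then st.follow else
          (smallest st.heard).or st.follow))) := by
    simp [squareBody, repeatSteps, List.replicate_succ]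
  rw [e]
  refine h.weaken (fun _ h => h) ?_ (fun _ h => h)
  have hγ := squareRate_pos
  have : Real.exp (-(squareRate * s)) ≤ Real.exp (-(squareRate / 32 * s)) := by
    apply Real.exp_le_exp.2
    have : 0 ≤ squareRate * s := by positivity
    linarith
  have h2 : (n : ℝ) * Real.exp (-(squareRate * s)) ≤ n * Real.exp (-(squareRate / 32 * s)) := by
    gcongr
  linarith

end Square

/-! ## Merging all clusters -/

section Merge

variable {n : ℕ} {ID : Fin n → ℕ} {I : Fin n → Finset (List Bool)} {f : Fin n → Option (Fin n)}

/-- The unclustered nodes. -/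
def unclustered (f : Fin n → Option (Fin n)) : Finset (Fin n) :=
  Finset.univ.filter fun v => f v = none

theorem mem_unclustered {v : Fin n} : v ∈ unclustered f ↔ f v = none := by simp [unclustered]

theorem card_unclustered (f : Fin n → Option (Fin n)) :
    ((unclustered f).card : ℝ) = n - (clustered f).card := by
  have h := Finset.card_filter_add_card_filter_not (s := (Finset.univ : Finset (Fin n)))
    (fun v => f v = none)
  rw [Finset.card_univ, Fintype.card_fin] at h
  have h' : (unclustered f).card + (clustered f).card = n := h
  rw [eq_sub_iff_add_eq]
  exact_mod_cast h'

/-- All clustered nodes follow the same leader, and at most `k` nodes are unclustered. -/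
def OneCluster (ID : Fin n → ℕ) (I : Fin n → Finset (List Bool)) (k : ℝ) (x : Fin n → NodeState) :
    Prop :=
  ∃ f u₀, Rep ID I x f ∧ f u₀ = some u₀ ∧ (∀ v, f v = none ∨ f v = some u₀) ∧
    ((unclustered f).card : ℝ) ≤ k

/-- The clusters of `f` have been merged as a whole; at least `P` nodes follow the leader with the
smallest ID. -/
def PartlyMerged (ID : Fin n → ℕ) (I : Fin n → Finset (List Bool)) (s : ℕ) (P : ℝ)
    (x : Fin n → NodeState) : Prop :=
  ∃ f f₁ u₀, Rep ID I x f₁ ∧ Flat f ∧ (∀ u ∈ leaders f, s ≤ (fiber f u).card) ∧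
    99 / 100 * (n : ℝ) ≤ (clustered f).card ∧ (∀ u ∈ leaders f, ID u₀ ≤ ID u) ∧
    (∀ v, f₁ v = none ↔ f v = none) ∧ (∀ v j, f₁ v = some j → f j = some j) ∧
    (∀ v w, f v = f w → f₁ v = f₁ w) ∧ f₁ u₀ = some u₀ ∧ P ≤ (fiber f₁ u₀).card

/-- The nodes in the clusters which are reached from `U`. -/
def hitNodes (f : Fin n → Option (Fin n)) (U : Finset (Fin n)) (ρ : Fin n → Fin n) :
    Finset (Fin n) :=
  (clustered f).filter fun v => ∃ o ∈ U, f (ρ o) = f v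

/-- Clusters have no upper size bound here, so hit nodes are counted, in units of `s`: a newly hit
cluster raises the counter by at least one. While the counter is at most `w`, fewer than `n / 2`
nodes are hit and at most `n / 100` are unclustered, so a contact fails with probability below `3 /
4`. -/
theorem contacts_hitNodes_le (hn : 0 < n) (hf : Flat f) (T : Finset (Fin n)) {s w : ℕ}
    (hs : 1 ≤ s) (hsize : ∀ u ∈ leaders f, s ≤ (fiber f u).card)
    (hX : 99 / 100 * (n : ℝ) ≤ (clustered f).card) (hw : ((w : ℝ) + 1) * s ≤ n / 2) :
    (contacts n).toOuterMeasure {ρ | (hitNodes f T ρ).card / s ≤ w} ≤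
      ENNReal.ofReal (Real.exp (w - T.card / 8)) := by
  classical
  have hsub : ∀ U o, o ∉ U → ∀ ρ y,
      hitNodes f U ρ ⊆ hitNodes f (insert o U) (Function.update ρ o y) := by
    intro U o ho ρ y v hv
    unfold hitNodes at hv ⊢
    rw [Finset.mem_filter] at hv ⊢
    obtain ⟨h1, o', h2, h3⟩ := hv
    refine ⟨h1, o', by simp [h2], ?_⟩
    rw [Function.update_of_ne]
    · exact h3
    · rintro rfl
      exact ho h2
  have h := contacts_counter_le hn T w (q := 3 / 4) (by norm_num) (by norm_num) (fun _ => True)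
    (fun U ρ => (hitNodes f U ρ).card / s) (fun _ _ _ _ h => h)
    (fun U o ho _ _ ρ y => Nat.div_le_div_right (Finset.card_le_card (hsub U o ho ρ y))) (by
      intro U o ho _ _ ρ _ hH
      have h1 : (Finset.univ.filter fun y =>
          (hitNodes f (insert o U) (Function.update ρ o y)).card / s ≤
            (hitNodes f U ρ).card / s) ⊆ unclustered f ∪ hitNodes f U ρ := by
        intro y hy
        rw [Finset.mem_filter] at hy
        by_contra hcon
        rw [Finset.mem_union, not_or, mem_unclustered] at hcon
        obtain ⟨u, hu⟩ := Option.ne_none_iff_exists'.1 hcon.1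
        have h2 : hitNodes f U ρ ∪ fiber f u ⊆
            hitNodes f (insert o U) (Function.update ρ o y) := by
          apply Finset.union_subset (hsub U o ho ρ y)
          intro v hv
          rw [mem_fiber] at hv
          unfold hitNodes
          rw [Finset.mem_filter, mem_clustered]
          refine ⟨by rw [hv]; simp, o, by simp, ?_⟩
          rw [Function.update_self, hv, hu]
        have h3 : Disjoint (hitNodes f U ρ) (fiber f u) := by
          rw [Finset.disjoint_left]
          intro v hv hv'
          apply hcon.2
          unfold hitNodes at hv ⊢
          rw [Finset.mem_filter] at hv ⊢
          obtain ⟨_, o', h4, h5⟩ := hv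
          rw [mem_fiber] at hv'
          exact ⟨mem_clustered.2 hcon.1, o', h4, by rw [h5, hv', hu]⟩
        have h4 := Finset.card_le_card h2
        rw [Finset.card_union_of_disjoint h3] at h4
        have h5 := hsize u (mem_leaders.2 (hf _ _ hu))
        have h6 : ((hitNodes f U ρ).card + s) / s ≤ (hitNodes f U ρ).card / s :=
          (Nat.div_le_div_right (by omega)).trans hy.2
        rw [Nat.add_div_right _ (by omega)] at h6
        omega
      have h2 := (Finset.card_le_card h1).trans (Finset.card_union_le _ _)
      have h3 : (hitNodes f U ρ).card < (w + 1) * s := by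
        rw [← Nat.div_lt_iff_lt_mul (by omega)]
        omega
      have h4 : ((hitNodes f U ρ).card : ℝ) ≤ ((w : ℝ) + 1) * s := by exact_mod_cast h3.le
      have h5 := card_unclustered f
      have h6 : (0 : ℝ) ≤ n := by positivity
      calc _ ≤ (((unclustered f).card + (hitNodes f U ρ).card : ℕ) : ℝ) := by exact_mod_cast h2
        _ ≤ _ := by push_cast; linarith)
  refine (MeasureTheory.measure_mono ?_).trans (h.trans (le_of_eq ?_))
  · exact fun ρ hρ => ⟨trivial, hρ⟩
  · congr 2
    ring

/-- The cluster of the smallest leader ID has at least `s` pushing nodes, and every cluster that it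
hits must join it, since no smaller ID is in circulation. -/
theorem triple_merge_first (hn : 0 < n) (hID : Function.Injective ID) {s : ℕ} (hs : 1 ≤ s)
    (hsn : (s : ℝ) ^ 2 ≤ n / 4) :
    Triple ID (clusterPush (fun st => st.follow) ++
        clusterMerge (fun st => smallest (st.heard ∪ st.follow.toFinset)))
      (Large ID I s) (Real.exp (-(s / 16))) (PartlyMerged ID I s ((s : ℝ) ^ 2 / 16)) := by
  classical
  have hn' : (0 : ℝ) < n := by exact_mod_cast hn
  have hs' : (1 : ℝ) ≤ s := by exact_mod_cast hs
  refine Triple.of_exists_map (by positivity) (contacts n) ?_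
  rintro x ⟨f, hx, hf, hsize, hX⟩
  obtain ⟨Y, hrun, hY⟩ := run_mergeAll hID hx
  refine ⟨Y, hrun, ?_⟩
  have hne : (leaders f).Nonempty := by
    by_contra hcon
    rw [Finset.not_nonempty_iff_eq_empty] at hcon
    rw [clustered_eq_biUnion hf, hcon] at hX
    simp at hX
    linarith
  obtain ⟨u₀, hu₀, hmin⟩ := Finset.exists_min_image (leaders f) ID hne
  -- More than `w` units of `s` nodes make `s ^ 2 / 16` nodes, and the exponent is at most `s / 16 -
  -- s / 8`.
  set w : ℕ := ⌊(s : ℝ) / 16⌋₊ with hw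
  have hw1 : (w : ℝ) ≤ s / 16 := Nat.floor_le (by positivity)
  have hw2 : (s : ℝ) / 16 < w + 1 := Nat.lt_floor_add_one _
  refine (MeasureTheory.measure_mono ?_).trans
    ((contacts_hitNodes_le hn hf (fiber f u₀) (w := w) hs hsize hX ?_).trans ?_)
  · intro ρ hρ
    by_contra hcon
    simp only [Set.mem_ofPred_eq, not_le] at hcon
    apply hρ
    obtain ⟨h, hR, hh⟩ := hY ρ
    have hXl : ∀ u l, f u = some u → Recv f f ρ l u ∨ f u = some l → f l = some l := by
      rintro u l hu (⟨o, h1, _⟩ | h1)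
      · obtain ⟨t, _, h3⟩ := Option.bind_eq_some_iff.1 h1
        exact hf _ _ h3
      · exact hf _ _ h1
    have hlead : ∀ u, f u = some u → ∃ l, h u = some l ∧ f l = some l ∧
        ∀ l', Recv f f ρ l' u ∨ f u = some l' → ID l ≤ ID l' := by
      intro u hu
      rcases hh u with ⟨l, h1, h2, h3⟩ | ⟨h1, _⟩
      · exact ⟨l, h3, hXl u l hu h1, h2⟩
      · exact absurd (Or.inr hu) (h1 u)
    have hu₀' := mem_leaders.1 hu₀
    have hto : ∀ u, f u = some u → Recv f f ρ u₀ u ∨ f u = some u₀ → h u = some u₀ := by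
      intro u hu h1
      obtain ⟨l, h2, h3, h4⟩ := hlead u hu
      have h5 : ID l = ID u₀ := le_antisymm (h4 u₀ h1) (hmin l (mem_leaders.2 h3))
      rw [h2, hID h5]
    have hh₀ : h u₀ = some u₀ := hto u₀ hu₀' (Or.inr hu₀')
    refine ⟨f, fun v => (f v).bind h, u₀, hR, hf, hsize, hX, hmin, ?_, ?_, ?_, ?_, ?_⟩
    · intro v
      dsimp only
      rcases hv : f v with _ | u
      · simp
      · obtain ⟨l, h2, _⟩ := hlead u (hf _ _ hv)
        simp [h2]
    · intro v j hj
      obtain ⟨u, h1, h2⟩ := Option.bind_eq_some_iff.1 hj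
      obtain ⟨l, h3, h4, _⟩ := hlead u (hf _ _ h1)
      rw [h2] at h3
      obtain rfl := Option.some_injective _ h3
      exact h4
    · intro v v' hvv
      simp only [hvv]
    · simp [hu₀', hh₀]
    · have h1 : hitNodes f (fiber f u₀) ρ ⊆ fiber (fun v => (f v).bind h) u₀ := by
        intro v hv
        unfold hitNodes at hv
        rw [Finset.mem_filter, mem_clustered] at hv
        obtain ⟨h2, o, h3, h4⟩ := hv
        obtain ⟨u, hu⟩ := Option.ne_none_iff_exists'.1 h2
        rw [mem_fiber] at h3 ⊢
        rw [hu] at h4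
        have h5 : h u = some u₀ := hto u (hf _ _ hu)
          (Or.inl ⟨o, by rw [h3]; exact hu₀', Or.inr h4⟩)
        simp [hu, h5]
      have h2 := Finset.card_le_card h1
      have h3 : (w + 1) * s ≤ (hitNodes f (fiber f u₀) ρ).card :=
        (Nat.le_div_iff_mul_le (by omega)).1 hcon
      have h4 : ((w : ℝ) + 1) * s ≤ (fiber (fun v => (f v).bind h) u₀).card := by
        exact_mod_cast h3.trans h2
      nlinarith
  · nlinarith
  · apply ENNReal.ofReal_le_ofReal
    apply Real.exp_le_exp.2
    have h1 : (s : ℝ) ≤ (fiber f u₀).card := by exact_mod_cast hsize u₀ hu₀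
    linarith

/-- The current clusters are unions of old ones, so it is enough that the followers of `u₀` hit each
old cluster, and those have at least `s` nodes. -/
theorem triple_merge_second (hn : 0 < n) (hID : Function.Injective ID) {s : ℕ} {P : ℝ} :
    Triple ID (clusterPush (fun st => st.follow) ++
        clusterMerge (fun st => smallest (st.heard ∪ st.follow.toFinset)))
      (PartlyMerged ID I s P) (n * Real.exp (-(s / n * P / 2))) (OneCluster ID I (n / 100)) := by
  classical
  have hn' : (0 : ℝ) < n := by exact_mod_cast hn
  refine Triple.of_exists_map (by positivity) (contacts n) ?_
  rintro x ⟨f, f₁, u₀, hx, hf, hsize, hX, hmin, hnone, hlead, hconst, hu₀, hP⟩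
  obtain ⟨Y, hrun, hY⟩ := run_mergeAll hID hx
  refine ⟨Y, hrun, ?_⟩
  refine outer_biUnion_le (contacts n) (leaders f)
    (fun u => {ρ | ∀ o ∈ fiber f₁ u₀, ρ o ∉ fiber f u}) ?_ ?_
  · intro ρ hρ
    by_contra hcon
    simp only [Set.mem_iUnion, Set.mem_ofPred_eq, not_exists, not_forall, not_not] at hcon
    apply hρ
    obtain ⟨h, hR, hh⟩ := hY ρ
    have key : ∀ v, f v ≠ none → (f₁ v).bind h = some u₀ := by
      intro v hv
      obtain ⟨u, hu⟩ := Option.ne_none_iff_exists'.1 hv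
      obtain ⟨j, hj⟩ := Option.ne_none_iff_exists'.1 (mt (hnone v).1 hv)
      obtain ⟨o, ho, hou⟩ := hcon u (mem_leaders.2 (hf _ _ hu))
      rw [mem_fiber] at ho hou
      -- The node that was hit lies in the old cluster of `v` and so relays `u₀` to the same node
      -- `j` from which `v` pulls, even if `j` does not follow itself.
      have h1 : f₁ (ρ o) = some j := by rw [← hj]; exact hconst _ _ (by rw [hou, hu])
      have h2 : Recv f₁ f₁ ρ u₀ j := ⟨o, by rw [ho]; exact hu₀, Or.inr h1⟩
      rw [hj, Option.bind_some]
      rcases hh j with ⟨l, h3, h4, h5⟩ | ⟨h3, _⟩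
      · have h6 : f l = some l := by
          rcases h3 with ⟨o', h7, _⟩ | h7
          · obtain ⟨t, _, h8⟩ := Option.bind_eq_some_iff.1 h7
            exact hlead _ _ h8
          · exact hlead _ _ h7
        have h7 : ID l = ID u₀ :=
          le_antisymm (h4 u₀ (Or.inl h2)) (hmin l (mem_leaders.2 h6))
        rw [h5, hID h7]
      · exact absurd (Or.inl h2) (h3 u₀)
    have hnone' : ∀ v, f v = none → (f₁ v).bind h = none := by
      intro v hv
      rw [(hnone v).2 hv]
      rfl
    refine ⟨_, u₀, hR, key u₀ ?_, ?_, ?_⟩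
    · intro hcon'
      rw [(hnone u₀).2 hcon'] at hu₀
      simp at hu₀
    · intro v
      by_cases hv : f v = none
      · exact Or.inl (hnone' v hv)
      · exact Or.inr (key v hv)
    · have h1 : unclustered (fun v => (f₁ v).bind h) = unclustered f := by
        ext v
        rw [mem_unclustered, mem_unclustered]
        constructor
        · intro h2
          by_contra hv
          rw [key v hv] at h2
          simp at h2
        · exact hnone' v
      rw [h1, card_unclustered]
      linarith
  · intro u hu
    refine (contacts_avoid_le hn _ _).trans (ENNReal.ofReal_le_ofReal ?_)
    apply Real.exp_le_exp.2
    rw [neg_le_neg_iff]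
    have h1 : (s : ℝ) ≤ (fiber f u).card := by exact_mod_cast hsize u hu
    have h2 : 0 ≤ (s : ℝ) / n := by positivity
    calc (s : ℝ) / n * P / 2 ≤ s / n * (fiber f₁ u₀).card / 2 := by gcongr
      _ ≤ _ := by gcongr

theorem triple_mergeAll (hn : 0 < n) (hID : Function.Injective ID) {s : ℕ} (hs : 1 ≤ s)
    (hsn : (s : ℝ) ^ 2 ≤ n / 4) :
    Triple ID mergeAllClusters (Large ID I s)
      (Real.exp (-(s / 16)) + n * Real.exp (-((s : ℝ) ^ 3 / (32 * n))))
      (OneCluster ID I (n / 100)) := by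
  have h := (triple_merge_first (I := I) hn hID hs hsn).append (triple_merge_second hn hID)
  have e : mergeAllClusters = (clusterPush (fun st => st.follow) ++
        clusterMerge (fun st => smallest (st.heard ∪ st.follow.toFinset))) ++
      (clusterPush (fun st => st.follow) ++
        clusterMerge (fun st => smallest (st.heard ∪ st.follow.toFinset))) := by
    simp [mergeAllClusters, repeatSteps, List.replicate_succ]
  rw [e]
  refine h.weaken (fun _ h => h) (le_of_eq ?_) (fun _ h => h)
  congr 4
  field_simp
  norm_num

/-! ## The unclustered nodes pull -/

/-- One iteration of UnclusteredNodesPull. -/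
def pullStep : List (Step NodeState) :=
  [.comm
      { Msg := Option ℕ
        act := fun st => if st.follow = none then .pull .random else .idle
        respond := fun st => some st.follow
        update := fun st _ ans =>
          if st.follow = none then { st with follow := ans.join } else st }]

/-- `G` is the set of unclustered nodes. A node stays in it exactly if it pulls from a node of `G`,
so the set can only shrink, and the adopted leader is always `u₀`. -/
theorem run_pullStep {k : ℝ} {x : Fin n → NodeState} (hx : OneCluster ID I k x) :
    ∃ (G : Finset (Fin n)) (Y : (Fin n → Fin n) → Fin n → NodeState), (G.card : ℝ) ≤ k ∧
      (∀ v, (x v).follow = none ↔ v ∈ G) ∧ run ID pullStep x = (contacts n).map Y ∧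
      (∀ ρ, OneCluster ID I (G.filter fun v => ρ v ∈ G).card (Y ρ)) ∧
      ∀ ρ v, (Y ρ v).follow = none ↔ v ∈ G ∧ ρ v ∈ G := by
  obtain ⟨f, u₀, hR, h1, h2, h3⟩ := hx
  obtain ⟨Y, hrun, hY⟩ := run_unclusteredPull hR
  have hnone : ∀ (ρ : Fin n → Fin n) v, (if f v = none then f (ρ v) else f v) = none ↔
      v ∈ unclustered f ∧ ρ v ∈ unclustered f := by
    intro ρ v
    rw [mem_unclustered, mem_unclustered]
    split_ifs with h
    · simp [h]
    · simp [h]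
  refine ⟨unclustered f, Y, h3, ?_, hrun, ?_, ?_⟩
  · intro v
    rw [hR.follow, Option.map_eq_none_iff, mem_unclustered]
  · intro ρ
    refine ⟨_, u₀, hY ρ, ?_, ?_, ?_⟩
    · simp [h1]
    · intro v
      split_ifs
      · exact h2 _
      · exact h2 _
    · apply le_of_eq
      congr 2
      ext v
      rw [mem_unclustered, hnone, Finset.mem_filter]
  · intro ρ v
    rw [(hY ρ).follow, Option.map_eq_none_iff, hnone]

theorem OneCluster.mono {k k' : ℝ} {x : Fin n → NodeState} (h : OneCluster ID I k x)
    (hk : k ≤ k') : OneCluster ID I k' x := by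
  obtain ⟨f, u₀, h1, h2, h3, h4⟩ := h
  exact ⟨f, u₀, h1, h2, h3, h4.trans hk⟩

/-- The fraction of unclustered nodes is squared. -/
theorem triple_pull_square (hn : 0 < n) {y η : ℝ} (hη : 0 ≤ η) :
    Triple ID pullStep (OneCluster ID I (n / 8 * max y η)) (Real.exp (-(η ^ 2 * n / 16)))
      (OneCluster ID I (n / 8 * max (y ^ 2) η)) := by
  have hn' : (0 : ℝ) < n := by exact_mod_cast hn
  refine Triple.of_exists_map (by positivity) (contacts n) ?_
  intro x hx
  obtain ⟨G, Y, hG, _, hrun, hY, _⟩ := run_pullStep hx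
  refine ⟨Y, hrun, ?_⟩
  -- Below the floor `η` monotonicity suffices. Above it, the expected number `|G|² / n` of
  -- remaining nodes is large enough for concentration.
  by_cases hsmall : (G.card : ℝ) ≤ n / 8 * η
  · have : {ρ | ¬ OneCluster ID I (n / 8 * max (y ^ 2) η) (Y ρ)} = ∅ := by
      ext ρ
      simp only [Set.mem_ofPred_eq, Set.mem_empty_iff_false, iff_false, not_not]
      refine (hY ρ).mono ?_
      have h1 : ((G.filter fun v => ρ v ∈ G).card : ℝ) ≤ G.card := by
        exact_mod_cast Finset.card_filter_le _ _
      refine h1.trans (hsmall.trans ?_)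
      gcongr
      exact le_max_right _ _
    rw [this]
    simp
  · push Not at hsmall
    have hGy : (G.card : ℝ) ≤ n / 8 * y := by
      rcases max_choice y η with h | h
      · rwa [h] at hG
      · rw [h] at hG
        linarith
    have hy : 0 ≤ y := by
      by_contra hy
      push Not at hy
      have : (0 : ℝ) ≤ G.card := by positivity
      nlinarith
    -- The threshold is eight times the mean `|G|² / n`. The normalisation by `n / 8` absorbs this
    -- factor, so that `y` is squared exactly.
    refine (MeasureTheory.measure_mono ?_).trans
      ((contacts_card_mem_ge hn G G (8 * (G.card : ℝ) ^ 2 / n)).trans ?_)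
    · intro ρ hρ
      by_contra hcon
      simp only [Set.mem_ofPred_eq, not_le] at hcon
      refine hρ ((hY ρ).mono (hcon.le.trans ?_))
      calc 8 * (G.card : ℝ) ^ 2 / n ≤ 8 * (n / 8 * y) ^ 2 / n := by gcongr
        _ = n / 8 * y ^ 2 := by field_simp
        _ ≤ _ := by gcongr; exact le_max_left _ _
    · apply ENNReal.ofReal_le_ofReal
      apply Real.exp_le_exp.2
      have h1 : η ^ 2 * n / 64 ≤ (G.card : ℝ) ^ 2 / n := by
        rw [le_div_iff₀ hn']
        calc η ^ 2 * n / 64 * n = (n / 8 * η) ^ 2 := by ring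
          _ ≤ _ := by gcongr
      have h2 : 2 * ((G.card : ℝ) / n) * G.card - 8 * (G.card : ℝ) ^ 2 / n =
          -6 * ((G.card : ℝ) ^ 2 / n) := by field_simp; ring
      rw [h2]
      have h3 : 0 ≤ η ^ 2 * n := by positivity
      linarith

theorem contacts_mem_le (hn : 0 < n) (v : Fin n) (G : Finset (Fin n)) :
    (contacts n).toOuterMeasure {ρ | ρ v ∈ G} ≤ ENNReal.ofReal (G.card / n) := by
  classical
  have hn' : (0 : ℝ) < n := by exact_mod_cast hn
  have h := avg_le_pow hn {v} (β := G.card / n) (by positivity)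
    (fun U ρ => if v ∈ U then (if ρ v ∈ G then 1 else 0) else 1) (by
      intro U o ho hov _ ρ
      rw [Finset.mem_singleton] at hov
      subst hov
      simp only [Finset.mem_insert_self, if_true, Function.update_self, Finset.sum_boole]
      rw [if_neg ho]
      have : (Finset.univ.filter fun y => y ∈ G) = G := by ext; simp
      rw [this]
      apply le_of_eq
      field_simp)
  simp only [Finset.mem_singleton, if_true, Finset.card_singleton, pow_one, Finset.notMem_empty,
    if_false, avg_const hn, mul_one] at h
  refine (contacts_le_avg _ _ ?_ ?_).trans (ENNReal.ofReal_le_ofReal h)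
  · intro ρ
    split_ifs <;> norm_num
  · intro ρ hρ
    have hρ' : ρ v ∈ G := hρ
    rw [if_pos hρ']

/-- Failure probabilities multiply when the second step can fail only if the first one did. The
almost sure invariant `R` makes the second bound available in every case. -/
theorem bind_outer_le_mul {α β : Type} (p : PMF α) (g : α → PMF β) (S : Set β) (Q R : α → Prop)
    {ε₁ ε₂ : ENNReal} (h1 : p.toOuterMeasure {a | ¬ Q a} ≤ ε₁)
    (hR : p.toOuterMeasure {a | ¬ R a} = 0)
    (h2 : ∀ a, Q a → R a → (g a).toOuterMeasure S = 0)
    (h3 : ∀ a, R a → (g a).toOuterMeasure S ≤ ε₂) :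
    (p.bind g).toOuterMeasure S ≤ ε₁ * ε₂ := by
  classical
  rw [PMF.toOuterMeasure_bind_apply]
  have hb : ∀ a, p a * (g a).toOuterMeasure S ≤ Set.indicator {a | ¬ Q a} p a * ε₂ := by
    intro a
    by_cases hRa : R a
    · by_cases ha : Q a
      · rw [h2 a ha hRa, mul_zero]
        exact zero_le
      · rw [Set.indicator_of_mem (by exact ha)]
        exact mul_le_mul_right (h3 a hRa) _
    · have hpa : p a = 0 := by
        rw [PMF.toOuterMeasure_apply, ENNReal.tsum_eq_zero] at hR
        have := hR a
        rwa [Set.indicator_of_mem (by exact hRa)] at this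
      rw [hpa, zero_mul]
      exact zero_le
  refine (ENNReal.tsum_le_tsum hb).trans ?_
  rw [ENNReal.tsum_mul_right, ← PMF.toOuterMeasure_apply]
  gcongr

theorem triple_pull_keep {k : ℝ} :
    Triple ID pullStep (OneCluster ID I k) 0 (OneCluster ID I k) := by
  refine Triple.of_exists_map le_rfl (contacts n) ?_
  intro x hx
  obtain ⟨G, Y, hG, _, hrun, hY, _⟩ := run_pullStep hx
  refine ⟨Y, hrun, ?_⟩
  have : {ρ | ¬ OneCluster ID I k (Y ρ)} = ∅ := by
    ext ρ
    simp only [Set.mem_ofPred_eq, Set.mem_empty_iff_false, iff_false, not_not]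
    refine (hY ρ).mono (le_trans ?_ hG)
    exact_mod_cast Finset.card_filter_le _ _
  rw [this]
  simp

theorem repeatSteps_succ' (r : ℕ) (L : List (Step NodeState)) :
    repeatSteps (r + 1) L = repeatSteps r L ++ L := by
  simp [repeatSteps, List.replicate_succ', List.flatten_append]

/-- To remain unclustered, `v` must pull from one of at most `k` unclustered nodes in each of the
`r` rounds. -/
theorem triple_pull_node (hn : 0 < n) {k : ℝ} (hk : 0 ≤ k) (v : Fin n) (r : ℕ) :
    Triple ID (repeatSteps r pullStep) (OneCluster ID I k) ((k / n) ^ r)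
      (fun y => (y v).follow ≠ none) := by
  have hn' : (0 : ℝ) < n := by exact_mod_cast hn
  induction r with
  | zero =>
    refine ⟨by simp, fun x _ => ?_⟩
    rw [pow_zero, ENNReal.ofReal_one]
    exact toOuterMeasure_le_one _ _
  | succ r ih =>
    refine ⟨by positivity, fun x hx => ?_⟩
    rw [repeatSteps_succ', run_append, pow_succ, ENNReal.ofReal_mul (by positivity)]
    have hkeep := Triple.repeatSteps (P := fun _ => OneCluster ID I k)
      (fun _ => triple_pull_keep) r
    rw [mul_zero] at hkeep
    refine bind_outer_le_mul _ _ _ (fun y => (y v).follow ≠ none) (OneCluster ID I k)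
      (ih.2 x hx) ?_ ?_ ?_
    · have := hkeep.2 x hx
      simpa using this
    · intro y hv hy
      obtain ⟨G, Y, hG, hxG, hrun, hY, hY'⟩ := run_pullStep hy
      rw [hrun, PMF.toOuterMeasure_map_apply]
      convert MeasureTheory.measure_empty (μ := (contacts n).toOuterMeasure)
      ext ρ
      simp only [ne_eq, not_not, Set.mem_preimage, Set.mem_ofPred_eq, Set.mem_empty_iff_false,
        iff_false, hY']
      rintro ⟨h, _⟩
      exact hv ((hxG v).2 h)
    · intro y hy
      obtain ⟨G, Y, hG, hxG, hrun, hY, hY'⟩ := run_pullStep hy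
      rw [hrun, PMF.toOuterMeasure_map_apply]
      refine (MeasureTheory.measure_mono ?_).trans ((contacts_mem_le hn v G).trans ?_)
      · intro ρ hρ
        simp only [ne_eq, not_not, Set.mem_preimage, Set.mem_ofPred_eq, hY'] at hρ
        exact hρ.2
      · apply ENNReal.ofReal_le_ofReal
        gcongr

theorem triple_pull_all (hn : 0 < n) {k : ℝ} (hk : 0 ≤ k) (r : ℕ) :
    Triple ID (repeatSteps r pullStep) (OneCluster ID I k) (n * (k / n) ^ r)
      (OneCluster ID I 0) := by
  have hn' : (0 : ℝ) < n := by exact_mod_cast hn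
  refine ⟨by positivity, fun x hx => ?_⟩
  have hkeep := (Triple.repeatSteps (P := fun _ => OneCluster ID I k)
      (fun _ => triple_pull_keep) r).2 x hx
  rw [mul_zero] at hkeep
  have hall : (run ID (repeatSteps r pullStep) x).toOuterMeasure
      {y | ∃ v, (y v).follow = none} ≤ ENNReal.ofReal (n * (k / n) ^ r) := by
    refine outer_biUnion_le _ Finset.univ (fun v => {y | ¬ (y v).follow ≠ none}) ?_ ?_
    · rintro y ⟨v, hv⟩
      simp only [Finset.mem_univ, Set.iUnion_true, Set.mem_iUnion]
      exact ⟨v, by simpa using hv⟩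
    · intro v _
      exact (triple_pull_node hn hk v r).2 x hx
  refine (outer_union_le _ le_rfl (by positivity) ?_ hkeep hall).trans (by rw [zero_add])
  intro y hy
  by_contra hcon
  simp only [Set.mem_union, Set.mem_ofPred_eq, not_or, not_not, not_exists] at hcon
  obtain ⟨⟨f, u₀, h1, h2, h3, h4⟩, h5⟩ := hcon
  refine hy ⟨f, u₀, h1, h2, h3, ?_⟩
  have : unclustered f = ∅ := by
    rw [Finset.eq_empty_iff_forall_notMem]
    intro v hv
    rw [mem_unclustered] at hv
    apply h5 v
    rw [h1.follow, hv]
    rfl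
  rw [this]
  simp

theorem triple_share (hID : Function.Injective ID) {m : List Bool} (hm : ∃ v, m ∈ I v) :
    Triple ID clusterShare (OneCluster ID I 0) 0 (fun x => ∀ v, m ∈ (x v).info) := by
  refine Triple.of_exists_pure ?_
  rintro x ⟨f, u₀, h1, h2, h3, h4⟩
  refine run_share hID h1 (u₀ := u₀) (fun v => (h3 v).resolve_left ?_) hm
  intro hv
  have h5 : (unclustered f).card = 0 := by
    have : ((unclustered f).card : ℝ) = 0 := le_antisymm h4 (by positivity)
    exact_mod_cast this
  rw [Finset.card_eq_zero] at h5
  have h6 := mem_unclustered.2 hv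
  rw [h5] at h6
  simp at h6

end Merge

/-! ## The loop of SquareClusters -/

section Loop

variable {n : ℕ} {ID : Fin n → ℕ} {I : Fin n → Finset (List Bool)}

theorem rounds_repeatSteps (k : ℕ) (L : List (Step NodeState)) :
    rounds (repeatSteps k L) = k * rounds L := by
  induction k with
  | zero => simp [repeatSteps, rounds]
  | succ k ih => rw [repeatSteps_succ', rounds_append, ih]; ring

theorem rounds_squareBody (s : ℕ) : rounds (squareBody s) = 11 := by
  simp only [squareBody, rounds_append, rounds_repeatSteps, clusterResize, clusterActivate,
    clusterPush, clusterMerge, rounds]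

theorem le_nextSize {γ : ℝ} {s : ℕ} (h : 1 ≤ γ * s) : s ≤ nextSize γ s := by
  have h1 : (s : ℝ) ≤ nextSize γ s := by
    refine le_trans ?_ (Nat.le_ceil _)
    have : (0 : ℝ) ≤ s := by positivity
    nlinarith
  exact_mod_cast h1

/-- The update at least squares `γ * s`, so `(γ * s) ^ 2 ^ k` bounds `γ` times the size after `k`
iterations from below. -/
theorem pow_le_pow_nextSize {γ : ℝ} (hγ : 0 ≤ γ) (s k : ℕ) :
    (γ * s) ^ 2 ^ (k + 1) ≤ (γ * nextSize γ s) ^ 2 ^ k := by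
  rw [pow_succ' 2 k, pow_mul]
  refine pow_le_pow_left₀ (by positivity) ?_ _
  have h : γ * (s : ℝ) ^ 2 ≤ nextSize γ s := Nat.le_ceil _
  calc (γ * s) ^ 2 = γ * (γ * (s : ℝ) ^ 2) := by ring
    _ ≤ _ := by gcongr

/-- `k` is a budget of iterations that decreases by one per turn. It cannot be exhausted while `s ≤
θ`, since for `k = 0` the hypotheses contradict each other. -/
theorem exists_squareLoop {γ θ : ℝ} (hγ : 0 < γ) (k : ℕ) :
    ∀ s : ℕ, (s : ℝ) ≤ θ → γ * θ < (γ * s) ^ 2 ^ k → ∃ L, SquareLoop γ θ s L := by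
  induction k with
  | zero =>
    intro s hs h
    rw [pow_zero, pow_one, mul_lt_mul_iff_right₀ hγ] at h
    linarith
  | succ k ih =>
    intro s hs h
    by_cases hnext : (nextSize γ s : ℝ) ≤ θ
    · obtain ⟨L, hL⟩ := ih (nextSize γ s) hnext (h.trans_le (pow_le_pow_nextSize hγ.le s k))
      exact ⟨_, .again s L hnext hL⟩
    · exact ⟨_, .exit s (not_le.1 hnext)⟩

theorem rounds_squareLoop {γ θ : ℝ} (hγ : 0 < γ) {s : ℕ} {L : List (Step NodeState)}
    (hL : SquareLoop γ θ s L) : ∀ k : ℕ, (s : ℝ) ≤ θ → γ * θ < (γ * s) ^ 2 ^ k →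
      rounds L ≤ 11 * k := by
  induction hL with
  | exit s h =>
    intro k hs hk
    rcases k with _ | k
    · rw [pow_zero, pow_one, mul_lt_mul_iff_right₀ hγ] at hk
      linarith
    · rw [rounds_squareBody]
      omega
  | again s L h _ ih =>
    intro k hs hk
    rcases k with _ | k
    · rw [pow_zero, pow_one, mul_lt_mul_iff_right₀ hγ] at hk
      linarith
    · have := ih k h (hk.trans_le (pow_le_pow_nextSize hγ.le s k))
      rw [rounds_append, rounds_squareBody]
      omega

theorem Large.mono {s t : ℕ} {x : Fin n → NodeState} (h : Large ID I s x) (hts : t ≤ s) :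
    Large ID I t x := by
  obtain ⟨f, h1, h2, h3, h4⟩ := h
  exact ⟨f, h1, h2, fun u hu => hts.trans (h3 u hu), h4⟩

/-- By `hγs` the sizes never decrease, so the body runs only for sizes between `s₀` and `θ`, where
`ε` bounds its failure. The exit condition yields clusters of size at least `⌈θ⌉₊`. -/
theorem triple_squareLoop (hn : 0 < n) (hID : Function.Injective ID) {θ ε : ℝ} {s₀ : ℕ}
    (hε0 : 0 ≤ ε) (hs₀ : 24 ≤ s₀) (hγs : 1 ≤ squareRate * s₀) (hθ : θ ^ 2 ≤ n)
    (hε : ∀ s : ℕ, s₀ ≤ s → (s : ℝ) ≤ θ →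
      2 * Real.exp (-(n / (16 * (s : ℝ) ^ 2))) + 3 * (n * Real.exp (-(squareRate / 32 * s))) ≤ ε)
    {s : ℕ} {L : List (Step NodeState)} (hL : SquareLoop squareRate θ s L) :
    ∀ k : ℕ, s₀ ≤ s → (s : ℝ) ≤ θ → squareRate * θ < (squareRate * s) ^ 2 ^ k →
      Triple ID L (Large ID I s) (k * ε) (Large ID I ⌈θ⌉₊) := by
  have hγ := squareRate_pos
  have hbody : ∀ s : ℕ, s₀ ≤ s → (s : ℝ) ≤ θ →
      Triple ID (squareBody s) (Large ID I s) ε (Large ID I (nextSize squareRate s)) := by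
    intro s h1 h2
    refine (triple_squareBody hn hID (by omega) ?_).weaken (fun _ h => h) (hε s h1 h2)
      (fun _ h => h)
    have h3 : (s : ℝ) ^ 2 ≤ n := le_trans (by gcongr) hθ
    exact_mod_cast h3
  induction hL with
  | exit s h =>
    intro k h1 hs hk
    refine (hbody s h1 hs).weaken (fun _ h => h) ?_ (fun _ hx => hx.mono (Nat.ceil_le.2 h.le))
    rcases k with _ | k
    · rw [pow_zero, pow_one, mul_lt_mul_iff_right₀ hγ] at hk
      linarith
    · push_cast
      nlinarith [mul_nonneg (Nat.cast_nonneg (α := ℝ) k) hε0]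
  | again s L h _ ih =>
    intro k h1 hs hk
    rcases k with _ | k
    · rw [pow_zero, pow_one, mul_lt_mul_iff_right₀ hγ] at hk
      linarith
    · have h2 : 1 ≤ squareRate * s := hγs.trans (by gcongr)
      have h3 := ih k (h1.trans (le_nextSize h2)) h
        (hk.trans_le (pow_le_pow_nextSize hγ.le s k))
      refine ((hbody s h1 hs).append h3).weaken (fun _ h => h) (le_of_eq ?_) (fun _ h => h)
      push_cast
      ring

end Loop

/-! ## The phases with their failure probabilities -/

section Assembly

variable {n : ℕ} {ID : Fin n → ℕ} {I : Fin n → Finset (List Bool)}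

theorem log_le_exp_pow_loopCount {a : ℝ} (h : 0 < a) (h0 : 0 < Real.log n) :
    Real.log n ≤ Real.exp a ^ loopCount (1 / a) n := by
  rw [← Real.exp_nat_mul, ← Real.log_le_iff_le_exp h0]
  have : 1 / a * Real.log (Real.log n) ≤ loopCount (1 / a) n := Nat.le_ceil _
  calc Real.log (Real.log n) = 1 / a * Real.log (Real.log n) * a := by field_simp
    _ ≤ _ := by gcongr

theorem log_le_two_pow_loopCount (h : 0 < Real.log n) :
    Real.log n ≤ 2 ^ loopCount (1 / Real.log 2) n := by
  have h1 := log_le_exp_pow_loopCount (n := n) (Real.log_pos one_lt_two) h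
  rwa [Real.exp_log (by norm_num)] at h1

/-- Starting from `n / (4 * (C * log n))` clustered nodes, the pushes have to gain the factor `4 *
(C * log n)`. -/
theorem triple_growInitialClusters (hn : 0 < n) (hID : Function.Injective ID)
    {select : Finset ℕ → ℕ} (hsel : ∀ S : Finset ℕ, S.Nonempty → select S ∈ S)
    (A : Finset (Fin n)) (m : List Bool) {C a : ℝ} (hC : 0 < C) (hL : 0 < Real.log n)
    (hCL : 1 ≤ C * Real.log n)
    (ha : 4 * (C * Real.log n) ≤ (1 + 1 / 1600) ^ loopCount a n) :
    Triple ID (growInitialClusters C a select n) (· = initial ID A m)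
      ((2 + loopCount a n) * Real.exp (-(n / (3200 * (C * Real.log n)))))
      (Grown ID (fun v => if v ∈ A then {m} else ∅) (3 * (n / (C * Real.log n)))
        (199 / 200 * n)) := by
  have hn' : (0 : ℝ) < n := by exact_mod_cast hn
  set p : ℝ := 1 / (C * Real.log n) with hp
  have hp0 : 0 ≤ p := by positivity
  have hp1 : p ≤ 1 := by rw [hp, div_le_one (by positivity)]; exact hCL
  set k := loopCount a n with hk
  have h1 := triple_initial_coin ID A m hp0 hp1
  have h2 := Triple.repeatSteps (ID := ID)
    (P := fun i => Grown ID (fun v => if v ∈ A then {m} else ∅) (3 * (n * p))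
      (min ((1 + 1 / 1600) ^ i * (n * p / 4)) (199 / 200 * n)))
    (ε := Real.exp (-(n * p / 4 / 800))) (fun i => by
      rw [pow_succ', mul_assoc]
      refine triple_grow hn hID hsel ?_
      refine le_mul_of_one_le_left (by positivity) (one_le_pow₀ (by norm_num))) k
  have h3 := (h1.weaken (fun _ h => h) le_rfl (fun x hx => ?_)).append h2
  · refine h3.weaken (fun _ h => h) ?_ ?_
    · have e1 : n / (3200 * (C * Real.log n)) = n * p / 4 / 800 := by
        rw [hp]; field_simp; norm_num
      rw [e1, add_mul]
      have h4 : 0 ≤ n * p := by positivity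
      have h5 : Real.exp (-(n * p / 4)) ≤ Real.exp (-(n * p / 4 / 800)) :=
        Real.exp_le_exp.2 (by linarith)
      linarith
    · rintro x ⟨f, h4, h5, h6, h7⟩
      refine ⟨f, h4, h5, ?_, le_trans ?_ h7⟩
      · rw [hp] at h6
        convert h6 using 2
        field_simp
      · rw [le_min_iff]
        refine ⟨?_, le_rfl⟩
        have h8 : (n : ℝ) = 4 * (C * Real.log n) * (n * p / 4) := by rw [hp]; field_simp
        have h9 : 4 * (C * Real.log n) * (n * p / 4) ≤
            (1 + 1 / 1600) ^ k * (n * p / 4) := by gcongr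
        linarith
  · obtain ⟨f, h4, h5, h6, h7⟩ := hx
    refine ⟨f, h4, h5, h6, (min_le_left _ _).trans ?_⟩
    rw [pow_zero, one_mul]
    exact h7

/-- The iterations are split in two: squaring brings the unclustered fraction below `n ^ (-1/4)`,
then `r` further pulls leave a given node unclustered with probability at most `n ^ (-r/4)`. Surplus
pulls do no harm. -/
theorem triple_unclusteredNodesPull (hn : 0 < n) (hL : 0 < Real.log n) {b : ℝ} {r : ℕ}
    (hb : loopCount (1 / Real.log 2) n + r ≤ loopCount b n) :
    Triple ID (unclusteredNodesPull b n) (OneCluster ID I (n / 100))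
      (loopCount (1 / Real.log 2) n * Real.exp (-(√n / 16)) +
        n * Real.exp (-(r / 4 * Real.log n)))
      (OneCluster ID I 0) := by
  have hn' : (0 : ℝ) < n := by exact_mod_cast hn
  set k := loopCount (1 / Real.log 2) n with hk
  obtain ⟨r', hr'⟩ := Nat.exists_eq_add_of_le hb
  -- `η = n ^ (-1/4)` makes `η ^ 2 * n = √n`, so each squaring round still fails only with
  -- exponentially small probability in `√n`.
  set η : ℝ := Real.exp (-(Real.log n / 4)) with hη
  have hη2 : η ^ 2 * n = √n := by
    rw [Real.sqrt_eq_rpow, Real.rpow_def_of_pos hn', hη, ← Real.exp_nat_mul]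
    nth_rw 2 [← Real.exp_log hn']
    rw [← Real.exp_add]
    congr 1
    push_cast
    ring
  have h1 := Triple.repeatSteps (ID := ID)
    (P := fun i => OneCluster ID I (n / 8 * max ((8 / 100) ^ 2 ^ i) η))
    (ε := Real.exp (-(η ^ 2 * n / 16))) (fun i => by
      rw [pow_succ 2 i, pow_mul]
      exact triple_pull_square hn (Real.exp_pos _).le) k
  rw [hη2] at h1
  have h2 := triple_pull_all (ID := ID) (I := I) hn (k := n / 8 * η) (by positivity) (r + r')
  have hsplit : unclusteredNodesPull b n = repeatSteps k pullStep ++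
      repeatSteps (r + r') pullStep := by
    show repeatSteps (loopCount b n) pullStep = _
    rw [hr', add_assoc]
    simp only [repeatSteps, List.replicate_add, List.flatten_append]
  rw [hsplit]
  -- The start `n / 100` is `n / 8` times `8 / 100 ≤ 1 / e`, and `2 ^ k ≥ log n`; so `k` squarings
  -- go even below `1 / n`.
  have hy : (8 / 100 : ℝ) ^ 2 ^ k ≤ η := by
    have h3 := log_le_two_pow_loopCount hL
    have h4 : (8 / 100 : ℝ) ≤ Real.exp (-1) := by
      rw [Real.exp_neg]
      have := Real.exp_one_lt_d9
      calc (8 / 100 : ℝ) ≤ (3 : ℝ)⁻¹ := by norm_num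
        _ ≤ _ := inv_anti₀ (Real.exp_pos _) (by linarith)
    calc (8 / 100 : ℝ) ^ 2 ^ k ≤ Real.exp (-1) ^ 2 ^ k := by gcongr
      _ = Real.exp (-(2 ^ k)) := by rw [← Real.exp_nat_mul]; congr 1; push_cast; ring
      _ ≤ η := by
        apply Real.exp_le_exp.2
        linarith
  refine ((h1.weaken (fun x hx => ?_) le_rfl (fun x hx => ?_)).append h2).weaken
    (fun _ h => h) ?_ (fun _ h => h)
  · exact hx.mono (by
      calc (n : ℝ) / 100 = n / 8 * (8 / 100) ^ 2 ^ 0 := by norm_num; ring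
        _ ≤ _ := by gcongr; exact le_max_left _ _)
  · exact hx.mono (by rw [max_eq_right hy])
  · gcongr
    have h5 : n / 8 * η / n = η / 8 := by field_simp
    have h6 : η ≤ 1 := Real.exp_le_one_iff.2 (by linarith)
    have h7 : 0 ≤ η := (Real.exp_pos _).le
    calc (n / 8 * η / n) ^ (r + r') ≤ η ^ (r + r') := by
          rw [h5]
          exact pow_le_pow_left₀ (by positivity) (by linarith) _
      _ ≤ η ^ r := pow_le_pow_of_le_one h7 h6 (by omega)
      _ = _ := by rw [hη, ← Real.exp_nat_mul]; congr 1; ring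

theorem one_sub_le_outer {α : Type} (p : PMF α) (Q : α → Prop) {ε : ℝ} (hε : 0 ≤ ε)
    (h : p.toOuterMeasure {a | ¬ Q a} ≤ ENNReal.ofReal ε) :
    ENNReal.ofReal (1 - ε) ≤ p.toOuterMeasure {a | Q a} := by
  have h1 : (1 : ENNReal) ≤ p.toOuterMeasure {a | Q a} + p.toOuterMeasure {a | ¬ Q a} := by
    have h2 : p.toOuterMeasure Set.univ = 1 :=
      (PMF.toOuterMeasure_apply_eq_one_iff p Set.univ).2 (Set.subset_univ _)
    rw [← h2]
    refine (MeasureTheory.measure_mono ?_).trans (MeasureTheory.measure_union_le _ _)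
    intro a _
    by_cases ha : Q a
    · exact Or.inl ha
    · exact Or.inr ha
  rw [ENNReal.ofReal_sub _ hε, ENNReal.ofReal_one, tsub_le_iff_right]
  exact h1.trans (by gcongr)

end Assembly

/-! ## The choice of the constants -/

section Constants

theorem eventually_log_pow_le_sqrt (B : ℝ) :
    ∀ᶠ n : ℕ in Filter.atTop, B ≤ Real.log (Real.log n) ∧ B * Real.log n ^ 4 ≤ √(n : ℝ) := by
  have hcast : Filter.Tendsto (fun n : ℕ => (n : ℝ)) Filter.atTop Filter.atTop :=
    tendsto_natCast_atTop_atTop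
  have h1 : ∀ᶠ x : ℝ in Filter.atTop, B ≤ Real.log (Real.log x) :=
    (Real.tendsto_log_atTop.comp Real.tendsto_log_atTop).eventually_ge_atTop B
  have h2 : ∀ᶠ x : ℝ in Filter.atTop, ‖Real.log x ^ 8‖ ≤ (1 / (B ^ 2 + 1)) * ‖id x‖ :=
    (Real.isLittleO_pow_log_id_atTop (n := 8)).bound (by positivity)
  filter_upwards [hcast.eventually h1, hcast.eventually h2] with n h3 h4
  have h5 : (0 : ℝ) ≤ n := by positivity
  set x : ℝ := (n : ℝ)
  refine ⟨h3, Real.le_sqrt_of_sq_le ?_⟩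
  have h6 : 0 ≤ Real.log x ^ 8 := by positivity
  rw [Real.norm_of_nonneg h6, id, Real.norm_of_nonneg h5, one_div_mul_eq_div,
    le_div_iff₀ (by positivity)] at h4
  nlinarith

theorem loopCount_le {a : ℝ} {n : ℕ} (ha : 0 ≤ a) (h : 0 ≤ Real.log (Real.log n)) :
    (loopCount a n : ℝ) ≤ a * Real.log (Real.log n) + 1 :=
  (Nat.ceil_lt_add_one (by positivity)).le

/-- The rate of growth of the initial clusters. -/
def growRate : ℝ := Real.log (1 + 1 / 1600) / 2

theorem growRate_pos : 0 < growRate := by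
  unfold growRate
  have := Real.log_pos (by norm_num : (1 : ℝ) < 1 + 1 / 1600)
  positivity

/-- The factor `1 / 2` in `growRate` gains `log² n` instead of `log n`. This covers `4 * C * log n`
for large `n`, so the number of iterations need not depend on `C`. -/
theorem log_sq_le_pow_loopCount {n : ℕ} (h : 0 < Real.log n) :
    Real.log n ^ 2 ≤ (1 + 1 / 1600) ^ loopCount (1 / growRate) n := by
  have h1 := log_le_exp_pow_loopCount (n := n) growRate_pos h
  calc Real.log n ^ 2 ≤ (Real.exp growRate ^ loopCount (1 / growRate) n) ^ 2 := by gcongr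
    _ = (Real.exp growRate ^ 2) ^ loopCount (1 / growRate) n := by
        rw [← pow_mul, ← pow_mul, mul_comm]
    _ = _ := by
        congr 1
        rw [← Real.exp_nat_mul, growRate]
        push_cast
        rw [mul_div_cancel₀ _ (two_ne_zero), Real.exp_log (by norm_num)]

/-- The minimal size of the clusters that are kept. -/
def sizeConst (c : ℝ) : ℝ := 32 * (c + 4) / squareRate

/-- The inverse density of the initial leaders. -/
def leaderConst (c : ℝ) : ℝ := 1200 * sizeConst c

/-- The number of additional iterations of UnclusteredNodesPull. -/
def extraPulls (c : ℝ) : ℕ := ⌈4 * (c + 4)⌉₊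

/-- `n` is large in terms of `c`. -/
structure IsLarge (c : ℝ) (n : ℕ) : Prop where
  loglog : 1 ≤ Real.log (Real.log n)
  log_ge : 100 ≤ Real.log n
  log_c : 16 * (c + 4) ≤ Real.log n
  log_C : 4 * leaderConst c ≤ Real.log n
  sqrt_C : 3200 * leaderConst c * (c + 4) * Real.log n ^ 4 ≤ √(n : ℝ)
  sqrt_C' : (sizeConst c + 1) * Real.log n ^ 4 ≤ √(n : ℝ)
  sqrt_c : 32 * (c + 4) * Real.log n ^ 4 ≤ √(n : ℝ)
  pulls : extraPulls c + 1 ≤ Real.log (Real.log n)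
  count : (50 + 1 / growRate + 10 / Real.log 2) * Real.log n ^ 4 ≤ √(n : ℝ)

theorem sizeConst_pos {c : ℝ} (hc : 0 < c) : 0 < sizeConst c :=
  div_pos (by positivity) squareRate_pos

theorem eventually_isLarge {c : ℝ} (hc : 0 < c) : ∀ᶠ n : ℕ in Filter.atTop, IsLarge c n := by
  have h1 := sizeConst_pos hc
  have h2 : 0 < leaderConst c := by unfold leaderConst; positivity
  have h3 := growRate_pos
  have h4 := Real.log_pos one_lt_two
  set B : ℝ := 100 + 16 * (c + 4) + 4 * leaderConst c + 3200 * leaderConst c * (c + 4) +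
    (sizeConst c + 1) + 32 * (c + 4) + (extraPulls c + 1) +
    (50 + 1 / growRate + 10 / Real.log 2) with hB
  have p1 : 0 ≤ 16 * (c + 4) := by positivity
  have p2 : 0 ≤ 3200 * leaderConst c * (c + 4) := by positivity
  have p3 : (0 : ℝ) ≤ extraPulls c := by positivity
  have p4 : 0 ≤ 1 / growRate := by positivity
  have p5 : 0 ≤ 10 / Real.log 2 := by positivity
  filter_upwards [eventually_log_pow_le_sqrt B] with n ⟨h5, h6⟩
  have h7 : Real.log (Real.log n) ≤ Real.log n := by
    apply Real.log_le_self
    exact Real.log_natCast_nonneg n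
  have h8 : 0 ≤ Real.log n ^ 4 := by positivity
  have key : ∀ t, t ≤ B → t * Real.log n ^ 4 ≤ √(n : ℝ) := fun t ht =>
    (mul_le_mul_of_nonneg_right ht h8).trans h6
  refine ⟨?_, ?_, ?_, ?_, key _ ?_, key _ ?_, key _ ?_, ?_, key _ ?_⟩ <;> linarith

end Constants

/-! ### Numerical estimates for large `n` and composition of the phases -/

section Main

variable {n : ℕ} {c : ℝ}

/-- The failure probability of a single step is at most `n ^ (-(c + 2))`. -/
def unitFailure (c : ℝ) (n : ℕ) : ℝ := Real.exp (-((c + 2) * Real.log n))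

theorem IsLarge.pos (h : IsLarge c n) : 0 < n := by
  rcases Nat.eq_zero_or_pos n with rfl | hn
  · have := h.log_ge
    norm_num at this
  · exact hn

theorem IsLarge.log_pos (h : IsLarge c n) : 0 < Real.log n := by linarith [h.log_ge]

theorem IsLarge.one_le_log_pow (h : IsLarge c n) (k : ℕ) : 1 ≤ Real.log n ^ k :=
  one_le_pow₀ (by linarith [h.log_ge])

theorem IsLarge.sq_sqrt : √(n : ℝ) * √(n : ℝ) = n := Real.mul_self_sqrt (by positivity)

theorem exp_neg_le_unitFailure {t : ℝ} (ht : (c + 2) * Real.log n ≤ t) :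
    Real.exp (-t) ≤ unitFailure c n :=
  Real.exp_le_exp.2 (by linarith)

theorem mul_exp_neg_le_unitFailure (hn : 0 < n) {t : ℝ} (ht : (c + 3) * Real.log n ≤ t) :
    n * Real.exp (-t) ≤ unitFailure c n := by
  have hn' : (0 : ℝ) < n := by exact_mod_cast hn
  calc n * Real.exp (-t) = Real.exp (Real.log n - t) := by
        rw [sub_eq_add_neg, Real.exp_add, Real.exp_log hn']
    _ ≤ _ := Real.exp_le_exp.2 (by linarith)

theorem IsLarge.threshold (hc : 0 < c) (h : IsLarge c n) :
    ((⌈sizeConst c * Real.log n⌉₊ : ℕ) : ℝ) ≤ √(n : ℝ) / Real.log n := by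
  have h1 := h.log_ge
  have h2 := h.sqrt_C'
  have h3 := sizeConst_pos hc
  have h4 := h.log_pos
  rw [le_div_iff₀ h4]
  have h5 : ((⌈sizeConst c * Real.log n⌉₊ : ℕ) : ℝ) ≤ sizeConst c * Real.log n + 1 :=
    (Nat.ceil_lt_add_one (by positivity)).le
  have h6 : Real.log n ≤ Real.log n ^ 4 := le_self_pow₀ (by linarith) (by norm_num)
  have h7 : Real.log n ^ 2 ≤ Real.log n ^ 4 := pow_le_pow_right₀ (by linarith) (by norm_num)
  calc _ ≤ (sizeConst c * Real.log n + 1) * Real.log n := by gcongr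
    _ = sizeConst c * Real.log n ^ 2 + Real.log n := by ring
    _ ≤ sizeConst c * Real.log n ^ 4 + Real.log n ^ 4 := by gcongr
    _ = (sizeConst c + 1) * Real.log n ^ 4 := by ring
    _ ≤ _ := h2

/-- This explains `sizeConst`: the exponent `squareRate / 32 * s` of the second recruiting push
becomes at least `(c + 4) * log n`, enough for a union bound over the nodes. -/
theorem rate_mul_ge (hc : 0 < c) {s : ℕ}
    (hs : ⌈sizeConst c * Real.log n⌉₊ ≤ s) :
    32 * (c + 4) * Real.log n ≤ squareRate * s := by
  have h1 : sizeConst c * Real.log n ≤ s := Nat.ceil_le.1 hs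
  have h2 := squareRate_pos
  calc 32 * (c + 4) * Real.log n = squareRate * (sizeConst c * Real.log n) := by
        unfold sizeConst; field_simp
    _ ≤ _ := by gcongr

/-- The initial value of `squareRate * s` is at least `e`, and `2 ^ k ≥ log n`, so `k` squarings
exceed `n` and hence the threshold. -/
theorem IsLarge.loop_bound (hc : 0 < c) (h : IsLarge c n) :
    squareRate * (√(n : ℝ) / Real.log n) <
      (squareRate * (⌈sizeConst c * Real.log n⌉₊ : ℕ)) ^ 2 ^ loopCount (1 / Real.log 2) n := by
  have h1 := rate_mul_ge (n := n) (s := ⌈sizeConst c * Real.log n⌉₊) hc le_rfl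
  have h2 := h.log_ge
  have hn' : (0 : ℝ) < n := by exact_mod_cast h.pos
  have hg := squareRate_pos
  have hg1 : squareRate ≤ 1 := by
    have := freeFraction_le
    unfold squareRate
    linarith
  have h3 : Real.exp 1 ≤ squareRate * (⌈sizeConst c * Real.log n⌉₊ : ℕ) := by
    have := Real.exp_one_lt_d9
    nlinarith
  have h4 : (n : ℝ) ≤ Real.exp 1 ^ 2 ^ loopCount (1 / Real.log 2) n := by
    rw [← Real.exp_nat_mul, mul_one]
    conv_lhs => rw [← Real.exp_log hn']
    apply Real.exp_le_exp.2
    have := log_le_two_pow_loopCount (n := n) h.log_pos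
    exact_mod_cast this
  have h5 : √(n : ℝ) / Real.log n < n := by
    rw [div_lt_iff₀ h.log_pos]
    have h6 : 1 ≤ √(n : ℝ) := by
      rw [Real.one_le_sqrt]
      exact_mod_cast h.pos
    have h7 := IsLarge.sq_sqrt (n := n)
    nlinarith
  have h6 : 0 ≤ √(n : ℝ) / Real.log n := by have := h.log_pos; positivity
  calc squareRate * (√(n : ℝ) / Real.log n) ≤ 1 * (√(n : ℝ) / Real.log n) := by gcongr
    _ < n := by rw [one_mul]; exact h5
    _ ≤ _ := h4.trans (by gcongr)

/-- The factor `1200` in `leaderConst` comes from here: rounding up at most doubles `sizeConst c *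
log n`, and `3 * 2 / 1200 = 1 / 200`. -/
theorem IsLarge.dissolve (hc : 0 < c) (h : IsLarge c n) :
    3 * (n / (leaderConst c * Real.log n)) * (⌈sizeConst c * Real.log n⌉₊ : ℕ) ≤
      (n : ℝ) / 200 := by
  have h1 := sizeConst_pos hc
  have h2 := h.log_pos
  have h4 : 1 ≤ sizeConst c * Real.log n := by
    have h5 : squareRate ≤ 1 := by
      have := freeFraction_le
      unfold squareRate
      linarith
    have h6 : 1 ≤ sizeConst c := by
      unfold sizeConst
      rw [le_div_iff₀ squareRate_pos]
      linarith
    have := h.log_ge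
    nlinarith
  have h3 : ((⌈sizeConst c * Real.log n⌉₊ : ℕ) : ℝ) ≤ 2 * (sizeConst c * Real.log n) := by
    have := (Nat.ceil_lt_add_one (by positivity : 0 ≤ sizeConst c * Real.log n)).le
    linarith
  calc _ ≤ 3 * (n / (leaderConst c * Real.log n)) * (2 * (sizeConst c * Real.log n)) := by
        have : 0 < leaderConst c := by unfold leaderConst; positivity
        gcongr
    _ = (n : ℝ) / 200 := by unfold leaderConst; field_simp; ring

/-- The upper limit on `s` controls the activation, as it gives `n / s ^ 2 ≥ log² n`; the lower
limit controls the recruiting. -/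
theorem IsLarge.body (hc : 0 < c) (h : IsLarge c n) (s : ℕ)
    (hs : ⌈sizeConst c * Real.log n⌉₊ ≤ s) (hsθ : (s : ℝ) ≤ √(n : ℝ) / Real.log n) :
    2 * Real.exp (-(n / (16 * (s : ℝ) ^ 2))) + 3 * (n * Real.exp (-(squareRate / 32 * s))) ≤
      5 * unitFailure c n := by
  have h1 := rate_mul_ge hc hs
  have h2 := h.log_pos
  have h0 := h.log_ge
  have hs0 : (0 : ℝ) < s := by
    have := squareRate_pos
    by_contra hcon
    have : (s : ℝ) = 0 := le_antisymm (not_lt.1 hcon) (by positivity)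
    rw [this] at h1
    have : 0 < 32 * (c + 4) * Real.log n := by positivity
    linarith
  have h3 : (s : ℝ) * Real.log n ≤ √(n : ℝ) := by rwa [le_div_iff₀ h2] at hsθ
  have h4 : (s : ℝ) ^ 2 * Real.log n ^ 2 ≤ n := by
    have h5 := IsLarge.sq_sqrt (n := n)
    calc (s : ℝ) ^ 2 * Real.log n ^ 2 = (s * Real.log n) * (s * Real.log n) := by ring
      _ ≤ √(n : ℝ) * √(n : ℝ) := by gcongr
      _ = n := h5
  have h5 : (c + 2) * Real.log n ≤ n / (16 * (s : ℝ) ^ 2) := by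
    rw [le_div_iff₀ (by positivity)]
    have h6 := h.log_c
    calc (c + 2) * Real.log n * (16 * (s : ℝ) ^ 2) = (s : ℝ) ^ 2 * (16 * (c + 2) * Real.log n) := by
          ring
      _ ≤ (s : ℝ) ^ 2 * (Real.log n * Real.log n) := by gcongr; linarith
      _ = (s : ℝ) ^ 2 * Real.log n ^ 2 := by ring
      _ ≤ n := h4
  have h6 := exp_neg_le_unitFailure h5
  have h7 := mul_exp_neg_le_unitFailure (c := c) h.pos (t := squareRate / 32 * s) (by
    nlinarith)
  linarith

theorem IsLarge.sqrt_le (h : IsLarge c n) {a t : ℝ} (ht : t * Real.log n ^ 4 ≤ √(n : ℝ))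
    (ha : 0 ≤ t) (k : ℕ) (hk : k ≤ 4) (hat : a ≤ t) : a * Real.log n ^ k ≤ √(n : ℝ) := by
  have h0 := h.log_ge
  have h1 : Real.log n ^ k ≤ Real.log n ^ 4 := pow_le_pow_right₀ (by linarith) hk
  have h2 : 0 ≤ Real.log n ^ k := by positivity
  calc a * Real.log n ^ k ≤ t * Real.log n ^ k := by gcongr
    _ ≤ t * Real.log n ^ 4 := by gcongr
    _ ≤ _ := ht

/-- For `s ≥ √n / log n` one has `s ^ 3 / n ≥ √n / log³ n`. That this exceeds a multiple of `log n`
is the reason for the fourth powers in `IsLarge`. -/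
theorem IsLarge.merge (hc : 0 < c) (h : IsLarge c n) :
    ((⌈√(n : ℝ) / Real.log n⌉₊ : ℕ) : ℝ) ^ 2 ≤ (n : ℝ) / 4 ∧
    Real.exp (-((⌈√(n : ℝ) / Real.log n⌉₊ : ℕ) / 16)) +
      n * Real.exp (-((⌈√(n : ℝ) / Real.log n⌉₊ : ℕ) ^ 3 / (32 * n))) ≤ 2 * unitFailure c n := by
  have h0 := h.log_ge
  have h1 := h.log_pos
  have hn' : (0 : ℝ) < n := by exact_mod_cast h.pos
  have hq := IsLarge.sq_sqrt (n := n)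
  have hc4 : 32 * (c + 4) * Real.log n ^ 4 ≤ √(n : ℝ) := h.sqrt_c
  have hθ1 : 1 ≤ √(n : ℝ) / Real.log n := by
    rw [le_div_iff₀ h1]
    have := h.sqrt_le (a := 1) hc4 (by positivity) 1 (by norm_num) (by linarith)
    simpa using this
  set θ := √(n : ℝ) / Real.log n with hθ
  set σ : ℕ := ⌈θ⌉₊ with hσ
  have hσ1 : θ ≤ σ := Nat.le_ceil _
  have hσ2 : (σ : ℝ) ≤ 2 * θ := by
    have := (Nat.ceil_lt_add_one (by linarith : 0 ≤ θ)).le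
    linarith
  have hθ2 : θ ^ 2 * Real.log n ^ 2 = n := by
    rw [hθ, div_pow, Real.sq_sqrt hn'.le]; field_simp
  constructor
  · have h2 : 16 ≤ Real.log n ^ 2 := by nlinarith
    have h3 : θ ^ 2 * 16 ≤ n := by
      rw [← hθ2]; gcongr
    calc (σ : ℝ) ^ 2 ≤ (2 * θ) ^ 2 := by gcongr
      _ ≤ (n : ℝ) / 4 := by linarith
  · have e1 : (c + 2) * Real.log n ≤ (σ : ℝ) / 16 := by
      have h2 := h.sqrt_le (a := 16 * (c + 2)) hc4 (by positivity) 2 (by norm_num) (by linarith)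
      have h3 : 16 * (c + 2) * Real.log n ≤ θ := by
        rw [hθ, le_div_iff₀ h1]
        linarith [h2]
      linarith
    have e2 : (c + 3) * Real.log n ≤ (σ : ℝ) ^ 3 / (32 * n) := by
      have h2 := h.sqrt_le (a := 32 * (c + 3)) hc4 (by positivity) 4 le_rfl (by linarith)
      have h3 : 32 * (c + 3) * Real.log n * n ≤ θ ^ 3 := by
        calc 32 * (c + 3) * Real.log n * n = (32 * (c + 3) * Real.log n ^ 4) * n /
              Real.log n ^ 3 := by field_simp
          _ ≤ √(n : ℝ) * n / Real.log n ^ 3 := by gcongr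
          _ = θ ^ 3 := by
            rw [hθ]
            nth_rw 2 [← hq]
            field_simp
      rw [le_div_iff₀ (by positivity)]
      calc (c + 3) * Real.log n * (32 * n) = 32 * (c + 3) * Real.log n * n := by ring
        _ ≤ θ ^ 3 := h3
        _ ≤ _ := by gcongr
    have e3 := exp_neg_le_unitFailure e1
    have e4 := mul_exp_neg_le_unitFailure h.pos e2
    linarith

theorem IsLarge.grow (hc : 0 < c) (h : IsLarge c n) :
    Real.exp (-(n / (3200 * (leaderConst c * Real.log n)))) ≤ unitFailure c n := by
  have h1 := h.log_pos
  have h0 := h.log_ge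
  have hC : 0 < leaderConst c := by
    have := sizeConst_pos hc
    unfold leaderConst
    positivity
  apply exp_neg_le_unitFailure
  rw [le_div_iff₀ (by positivity)]
  have h2 := h.sqrt_le (a := 3200 * leaderConst c * (c + 2)) h.sqrt_C (by positivity) 2
    (by norm_num) (by gcongr; norm_num)
  have h3 : 1 ≤ √(n : ℝ) := by
    rw [Real.one_le_sqrt]
    exact_mod_cast h.pos
  have h4 := IsLarge.sq_sqrt (n := n)
  calc (c + 2) * Real.log n * (3200 * (leaderConst c * Real.log n))
      = 3200 * leaderConst c * (c + 2) * Real.log n ^ 2 := by ring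
    _ ≤ √(n : ℝ) := h2
    _ ≤ n := by nlinarith

/-- Doubling the constant `1 / log 2` leaves at least `log log n` spare iterations, which cover the
constantly many extra pulls and the rounding. -/
theorem IsLarge.pull_count (h : IsLarge c n) :
    loopCount (1 / Real.log 2) n + extraPulls c ≤ loopCount (2 / Real.log 2) n := by
  have h1 := h.pulls
  have hl := Real.log_pos one_lt_two
  have hl2 := Real.log_two_lt_d9
  have h2 := loopCount_le (a := 1 / Real.log 2) (n := n) (by positivity) (by linarith [h.loglog])
  have h3 : 2 / Real.log 2 * Real.log (Real.log n) ≤ loopCount (2 / Real.log 2) n := Nat.le_ceil _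
  have h4 : Real.log (Real.log n) ≤ 1 / Real.log 2 * Real.log (Real.log n) := by
    refine le_mul_of_one_le_left (by linarith [h.loglog]) ?_
    rw [le_div_iff₀ hl]
    linarith
  have h5 : 2 / Real.log 2 * Real.log (Real.log n) =
      1 / Real.log 2 * Real.log (Real.log n) + 1 / Real.log 2 * Real.log (Real.log n) := by ring
  have h6 : (loopCount (1 / Real.log 2) n : ℝ) + extraPulls c ≤ loopCount (2 / Real.log 2) n := by
    linarith
  exact_mod_cast h6

theorem IsLarge.pull (hc : 0 < c) (h : IsLarge c n) :
    Real.exp (-(√(n : ℝ) / 16)) ≤ unitFailure c n ∧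
      n * Real.exp (-(extraPulls c / 4 * Real.log n)) ≤ unitFailure c n := by
  constructor
  · apply exp_neg_le_unitFailure
    have := h.sqrt_le (a := 16 * (c + 2)) h.sqrt_c (by positivity) 1 (by norm_num) (by linarith)
    rw [pow_one] at this
    linarith
  · apply mul_exp_neg_le_unitFailure h.pos
    have h1 : 4 * (c + 4) ≤ extraPulls c := Nat.le_ceil _
    have := h.log_pos
    gcongr
    linarith

/-- The units of failure are `2` plus one per iteration for growth, `5` per squaring iteration, `2`
for merging, and one per squaring pull plus `1` for the last pulls. Their number is at most `n`, so
the exponent `c + 2` leaves a factor `n` to spare. -/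
theorem IsLarge.total (h : IsLarge c n) :
    (loopCount (1 / growRate) n + 6 * loopCount (1 / Real.log 2) n + 5) * unitFailure c n ≤
      (n : ℝ) ^ (-c) := by
  have hn' : (0 : ℝ) < n := by exact_mod_cast h.pos
  have hg := growRate_pos
  have hl := Real.log_pos one_lt_two
  have hLL := h.loglog
  have h1 := loopCount_le (a := 1 / growRate) (n := n) (by positivity) (by linarith)
  have h2 := loopCount_le (a := 1 / Real.log 2) (n := n) (by positivity) (by linarith)
  have h3 : Real.log (Real.log n) ≤ Real.log n := Real.log_le_self h.log_pos.le
  have h4 := h.sqrt_le h.count (by positivity) 1 (by norm_num) le_rfl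
  have h5 : 1 ≤ √(n : ℝ) := by
    rw [Real.one_le_sqrt]
    exact_mod_cast h.pos
  have h6 := IsLarge.sq_sqrt (n := n)
  have h7 : √(n : ℝ) ≤ n := by nlinarith
  have h8 : (1 : ℝ) ≤ n := by linarith
  have h9 : (loopCount (1 / growRate) n + 6 * loopCount (1 / Real.log 2) n + 5 : ℝ) ≤ n := by
    have e1 : 1 / growRate * Real.log (Real.log n) ≤ 1 / growRate * Real.log n := by gcongr
    have e2 : 1 / Real.log 2 * Real.log (Real.log n) ≤ 1 / Real.log 2 * Real.log n := by gcongr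
    have e3 : 0 ≤ 1 / Real.log 2 * Real.log n := by have := h.log_pos; positivity
    have e4 : (50 + 1 / growRate + 10 / Real.log 2) * Real.log n ^ 1 = 50 * Real.log n +
        1 / growRate * Real.log n + 10 * (1 / Real.log 2 * Real.log n) := by ring
    have e5 := h.log_ge
    linarith
  calc _ ≤ (n : ℝ) * unitFailure c n := by
        have : 0 ≤ unitFailure c n := (Real.exp_pos _).le
        gcongr
    _ ≤ (n : ℝ) * n * unitFailure c n := by
        have : 0 ≤ unitFailure c n := (Real.exp_pos _).le
        gcongr
        nlinarith
    _ = (n : ℝ) ^ (-c) := by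
        rw [Real.rpow_def_of_pos hn', unitFailure]
        nth_rw 1 [← Real.exp_log hn']
        nth_rw 2 [← Real.exp_log hn']
        rw [← Real.exp_add, ← Real.exp_add]
        congr 1
        ring

/-- The steps of ClusterOne, if those of the loop of SquareClusters are `Lsq`. -/
def clusterOneSteps (C C' a b : ℝ) (select : Finset ℕ → ℕ) (n : ℕ)
    (Lsq : List (Step NodeState)) : List (Step NodeState) :=
  growInitialClusters C a select n ++ (clusterDissolve ⌈C' * Real.log n⌉₊ ++ Lsq) ++
    mergeAllClusters ++ unclusteredNodesPull b n ++ clusterShare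

theorem clusterOne_iff {C C' γ a b : ℝ} {select : Finset ℕ → ℕ} {n : ℕ}
    {L : List (Step NodeState)} : ClusterOne C C' γ a b select n L ↔
      ∃ Lsq, SquareLoop γ (√(n : ℝ) / Real.log n) ⌈C' * Real.log n⌉₊ Lsq ∧
        L = clusterOneSteps C C' a b select n Lsq :=
  Iff.rfl

theorem rounds_clusterOneSteps (C C' a b : ℝ) (select : Finset ℕ → ℕ) (n : ℕ)
    (Lsq : List (Step NodeState)) :
    rounds (clusterOneSteps C C' a b select n Lsq) =
      3 * loopCount a n + loopCount b n + rounds Lsq + 12 := by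
  simp only [clusterOneSteps, growInitialClusters, mergeAllClusters, unclusteredNodesPull,
    rounds_append, rounds_repeatSteps, clusterDissolve, clusterShare, clusterPush, clusterMerge,
    rounds]
  ring

theorem triple_clusterOneSteps (hc : 0 < c) (h : IsLarge c n) {select : Finset ℕ → ℕ}
    (hsel : ∀ S : Finset ℕ, S.Nonempty → select S ∈ S) {ID : Fin n → ℕ}
    (hID : Function.Injective ID) {A : Finset (Fin n)} (hA : A.Nonempty) (m : List Bool)
    {Lsq : List (Step NodeState)}
    (hLsq : SquareLoop squareRate (√(n : ℝ) / Real.log n) ⌈sizeConst c * Real.log n⌉₊ Lsq) :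
    Triple ID (clusterOneSteps (leaderConst c) (sizeConst c) (1 / growRate) (2 / Real.log 2)
        select n Lsq)
      (· = initial ID A m) ((n : ℝ) ^ (-c)) (fun x => ∀ v, m ∈ (x v).info) := by
  have hn := h.pos
  have hL := h.log_pos
  have h0 := h.log_ge
  have hC' := sizeConst_pos hc
  have hC : 0 < leaderConst c := by unfold leaderConst; positivity
  have hlogC := h.log_C
  have hU : 0 ≤ unitFailure c n := (Real.exp_pos _).le
  have hrate := rate_mul_ge (n := n) (s := ⌈sizeConst c * Real.log n⌉₊) hc le_rfl
  have hγs : 32 ≤ squareRate * (⌈sizeConst c * Real.log n⌉₊ : ℕ) := by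
    nlinarith
  have hs₀ : 24 ≤ ⌈sizeConst c * Real.log n⌉₊ := by
    have hg1 : squareRate ≤ 1 := by
      have := freeFraction_le
      unfold squareRate
      linarith
    have h1 : (24 : ℝ) ≤ (⌈sizeConst c * Real.log n⌉₊ : ℕ) := by
      have : (0 : ℝ) ≤ (⌈sizeConst c * Real.log n⌉₊ : ℕ) := by positivity
      nlinarith
    exact_mod_cast h1
  have hCL : 1 ≤ leaderConst c * Real.log n := by
    have h1 : 1 ≤ sizeConst c := by
      have hg1 : squareRate ≤ 1 := by
        have := freeFraction_le
        unfold squareRate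
        linarith
      unfold sizeConst
      rw [le_div_iff₀ squareRate_pos]
      linarith
    unfold leaderConst
    nlinarith
  have hθ : (√(n : ℝ) / Real.log n) ^ 2 ≤ n := by
    rw [div_pow, Real.sq_sqrt (by positivity)]
    exact div_le_self (by positivity) (h.one_le_log_pow 2)
  have hσ : 1 ≤ ⌈√(n : ℝ) / Real.log n⌉₊ := by
    have h1 : (0 : ℝ) < n := by exact_mod_cast hn
    exact Nat.ceil_pos.2 (by positivity)
  set I : Fin n → Finset (List Bool) := fun v => if v ∈ A then {m} else ∅ with hI
  have t1 := triple_growInitialClusters hn hID hsel A m hC hL hCL (a := 1 / growRate) (by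
    refine le_trans ?_ (log_sq_le_pow_loopCount hL)
    nlinarith)
  have t2 := triple_dissolve (I := I) hID (h.dissolve hc)
  have t3 := triple_squareLoop (I := I) hn hID (ε := 5 * unitFailure c n) (by positivity) hs₀
    (by linarith) hθ (h.body hc) hLsq (loopCount (1 / Real.log 2) n) le_rfl (h.threshold hc)
    (h.loop_bound hc)
  have t4 := triple_mergeAll (I := I) hn hID hσ (h.merge hc).1
  have t5 := triple_unclusteredNodesPull (ID := ID) (I := I) hn hL h.pull_count
  have t6 := triple_share (I := I) hID (m := m) (by
    obtain ⟨v, hv⟩ := hA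
    exact ⟨v, by simp [hI, hv]⟩)
  refine ((((t1.append (t2.append t3)).append t4).append t5).append t6).weaken (fun _ h => h) ?_
    (fun _ h => h)
  refine le_trans ?_ h.total
  have e1 := h.grow hc
  have e2 := (h.merge hc).2
  have e3 := h.pull hc
  have e4 : (2 + loopCount (1 / growRate) n : ℝ) *
      Real.exp (-(n / (3200 * (leaderConst c * Real.log n)))) ≤
      (2 + loopCount (1 / growRate) n) * unitFailure c n := by gcongr
  have e5 : (loopCount (1 / Real.log 2) n : ℝ) * Real.exp (-(√(n : ℝ) / 16)) ≤
      loopCount (1 / Real.log 2) n * unitFailure c n := by gcongr; exact e3.1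
  linarith [e3.2]

end Main

end Gossip

end

theorem mainTheorem4 (c : ℝ) (hc : 0 < c) :
    ∃ C C' γ a b K : ℝ, 0 < C ∧ 0 < C' ∧ 0 < γ ∧ 0 < a ∧ 0 < b ∧ 0 < K ∧
      ∃ n₀ : ℕ, ∀ n : ℕ, n₀ ≤ n →
        ∀ select : Finset ℕ → ℕ, (∀ S : Finset ℕ, S.Nonempty → select S ∈ S) →
          (∃ L, Gossip.ClusterOne C C' γ a b select n L) ∧
          ∀ L, Gossip.ClusterOne C C' γ a b select n L →
            (Gossip.rounds L : ℝ) ≤ K * Real.log (Real.log n) ∧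
            ∀ (ID : Fin n → ℕ), Function.Injective ID →
              ∀ (A : Finset (Fin n)), A.Nonempty → ∀ m : List Bool,
                ENNReal.ofReal (1 - (n : ℝ) ^ (-c)) ≤
                  (Gossip.run ID L (Gossip.initial ID A m)).toOuterMeasure
                    {x | ∀ v, m ∈ (x v).info} := by
  have hC' := Gossip.sizeConst_pos hc
  have hg := Gossip.growRate_pos
  have hl := Real.log_pos one_lt_two
  obtain ⟨n₀, hn₀⟩ := Filter.eventually_atTop.1 (Gossip.eventually_isLarge hc)
  -- In `K`, growth takes `3` rounds per iteration; the `13` combines `11` rounds per squaring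
  -- iteration with the doubled number of pulls. The `27 = 3 + 1 + 11 + 12` collects the roundings
  -- and the fixed rounds, and is absorbed by `log log n ≥ 1`.
  refine ⟨Gossip.leaderConst c, Gossip.sizeConst c, Gossip.squareRate, 1 / Gossip.growRate,
    2 / Real.log 2, 3 * (1 / Gossip.growRate) + 13 * (1 / Real.log 2) + 27,
    by unfold Gossip.leaderConst; positivity, hC', Gossip.squareRate_pos, by positivity,
    by positivity, by positivity, n₀, ?_⟩
  intro n hn select hsel
  have h := hn₀ n hn
  constructor
  · obtain ⟨Lsq, hLsq⟩ := Gossip.exists_squareLoop Gossip.squareRate_pos _ _ (h.threshold hc)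
      (h.loop_bound hc)
    exact ⟨_, Gossip.clusterOne_iff.2 ⟨Lsq, hLsq, rfl⟩⟩
  · intro L hL
    obtain ⟨Lsq, hLsq, rfl⟩ := Gossip.clusterOne_iff.1 hL
    constructor
    · have h1 := Gossip.rounds_squareLoop Gossip.squareRate_pos hLsq _ (h.threshold hc)
        (h.loop_bound hc)
      have h2 := Gossip.rounds_clusterOneSteps (Gossip.leaderConst c) (Gossip.sizeConst c)
        (1 / Gossip.growRate) (2 / Real.log 2) select n Lsq
      have hLL := h.loglog
      have h3 := Gossip.loopCount_le (a := 1 / Gossip.growRate) (n := n) (by positivity)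
        (by linarith)
      have h4 := Gossip.loopCount_le (a := 1 / Real.log 2) (n := n) (by positivity) (by linarith)
      have h5 := Gossip.loopCount_le (a := 2 / Real.log 2) (n := n) (by positivity) (by linarith)
      have h6 : (Gossip.rounds Lsq : ℝ) ≤ 11 * Gossip.loopCount (1 / Real.log 2) n := by
        exact_mod_cast h1
      have h7 : (Gossip.rounds (Gossip.clusterOneSteps (Gossip.leaderConst c) (Gossip.sizeConst c)
          (1 / Gossip.growRate) (2 / Real.log 2) select n Lsq) : ℝ) =
          3 * Gossip.loopCount (1 / Gossip.growRate) n + Gossip.loopCount (2 / Real.log 2) n +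
            Gossip.rounds Lsq + 12 := by
        rw [h2]
        push_cast
        ring
      have h8 : 2 / Real.log 2 = 2 * (1 / Real.log 2) := by ring
      rw [h7]
      rw [h8] at h5
      rw [h8]
      nlinarith
    · intro ID hID A hA m
      have h1 := Gossip.triple_clusterOneSteps hc h hsel hID hA m hLsq
      have h2 := h1.2 (Gossip.initial ID A m) rfl
      convert Gossip.one_sub_le_outer _ _ h1.1 h2 using 1
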